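/- Let $d\ge 2$, $m\ge 1$, $Y=(-1/2,1/2)^d$, and let $\mathbb T^d$ be the flat torus with unit cell $Y$. Let $A=(a_{ij}^{\alpha\beta})$, $1\le i,j\le d$, $1\le\alpha,\beta\le m$, be a measurable real coefficient tensor on $\mathbb R^d$ which is symmetric ($a_{ij}^{\alpha\beta}=a_{ji}^{\beta\alpha}$), $\mathbb Z^d$-periodic, and strongly elliptic: for some $\mu>0$, $\mu|\xi|^2\le a_{ij}^{\alpha\beta}(y)\xi_i^\alpha\xi_j^\beta\le\mu^{-1}|\xi|^2$ for all $y\in\mathbb R^d$, $\xi\in\mathbb R^{dm}$. Let $\omega$ be a non-empty connected open set with Lipschitz boundary, $\overline\omega\subset Y$, such that $Y\setminus\overline\omega$ is connected (for $d=2$ the last condition is equivalent to simple connectedness of $\omega$). Write $A\nabla u\cdot\nabla v=a_{ij}^{\alpha\beta}\partial_ju^\beta\,\partial_iv^\alpha$. Let $H^{1/2}(\partial\omega)$ be the space of traces on $\partial\omega$ of functions in $H^1(\mathbb T^d;\mathbb R^m)$, with the quotient norm (each such function has exactly one trace in $L^2(\partial\omega;\mathbb R^m)$), let $H^{-1/2}(\partial\omega)$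 be its dual, and let $H_0^{-1/2}(\partial\omega)$ be the subspace of those $\psi\in H^{-1/2}(\partial\omega)$ with $\langle\psi,c\rangle=0$ for all constants $c\in\mathbb R^m$. Then: 1. For every $\psi\in H_0^{-1/2}(\partial\omega)$ there is a unique $u=:\mathcal S\psi\in H^1(\mathbb T^d;\mathbb R^m)$ with $\int_Y u=0$ and $$\int_Y A\nabla u\cdot\nabla v\,dy+\langle\psi,v\rangle_{-1/2,1/2}=0\qquad\text{for all } v\in H^1(\mathbb T^d;\mathbb R^m),$$ and $\mathcal S$ is linear. 2. $\langle\phi,\psi\rangle_H:=\int_Y A\nabla\mathcal S\phi\cdot\nabla\mathcal S\psi\,dy$ is an inner product on $H_0^{-1/2}(\partial\omega)$, for which it is a (real) Hilbert space $H$. 3. Define the conormal derivatives of $u=\mathcal S\psi$ on $\partial\omega$ weakly by $\langle\partial u/\partial\nu_A|_+,v\rangle=-\int_{Y\setminus\omega}A\nabla u\cdot\nabla v$ and $\langle\partial u/\partial\nu_A|_-,v\rangle=\int_{\omega}A\nabla u\cdot\nabla v$ for $v\in H^1(\mathbb T^d;\mathbb R^m)$. Then there is a bounded linear operator $K:H\to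 H$ with $$K\psi=\frac{\partial\mathcal S\psi}{\partial\nu_A}\Big|_+-\frac12\psi=\frac{\partial\mathcal S\psi}{\partial\nu_A}\Big|_-+\frac12\psi\qquad\text{for all }\psi\in H.$$ 4. $K$ is self-adjoint on $H$, and its spectrum is contained in $(-1/2,1/2)$. -/

import Mathlib

open MeasureTheory Filter Topology Set
open scoped InnerProductSpace

noncomputable section

namespace PeriodicLayer

/-! ### The unit cell and periodic test functions -/

/-- The unit cell `Y = (-1/2, 1/2)^d`. -/
def cell (d : ℕ) : Set (EuclideanSpace ℝ (Fin d)) :=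
  {y | ∀ i, -(1 / 2 : ℝ) < y i ∧ y i < 1 / 2}

/-- The lattice vector `n ∈ ℤ^d`, viewed in `ℝ^d`. -/
def latticeVec {d : ℕ} (n : Fin d → ℤ) : EuclideanSpace ℝ (Fin d) :=
  WithLp.toLp 2 (fun i => (n i : ℝ))

/-- `ℤ^d`-periodic functions on `ℝ^d`, that is, functions on the flat torus `𝕋^d`. -/
def IsPeriodic {d : ℕ} {F : Type*} (f : EuclideanSpace ℝ (Fin d) → F) : Prop :=
  ∀ (y : EuclideanSpace ℝ (Fin d)) (n : Fin d → ℤ), f (y + latticeVec n) = f y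

/-- The classical partial derivative `∂_i f (y)`. -/
def pderiv {d : ℕ} {F : Type*} [NormedAddCommGroup F] [NormedSpace ℝ F]
    (f : EuclideanSpace ℝ (Fin d) → F) (i : Fin d) (y : EuclideanSpace ℝ (Fin d)) : F :=
  fderiv ℝ f y (EuclideanSpace.single i 1)

/-- The classical gradient of an `ℝ^m`-valued function; the entry `(i, α)` is `∂_i f^α`. -/
def classicalGrad {d m : ℕ} (f : EuclideanSpace ℝ (Fin d) → EuclideanSpace ℝ (Fin m))
    (y : EuclideanSpace ℝ (Fin d)) : EuclideanSpace ℝ (Fin d × Fin m) :=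
  WithLp.toLp 2 (fun p => pderiv f p.1 y p.2)

/-! ### The Sobolev space `H^1(𝕋^d; ℝ^m)` -/

/-- `L^2(Y; ℝ^m)`. -/
abbrev L2Val (d m : ℕ) : Type :=
  Lp (EuclideanSpace ℝ (Fin m)) 2
    ((volume : Measure (EuclideanSpace ℝ (Fin d))).restrict (cell d))

/-- `L^2(Y; ℝ^{d × m})`, the space of gradients. -/
abbrev L2Grad (d m : ℕ) : Type :=
  Lp (EuclideanSpace ℝ (Fin d × Fin m)) 2
    ((volume : Measure (EuclideanSpace ℝ (Fin d))).restrict (cell d))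

/-- `g` is the weak gradient of `u` on the torus: for all smooth periodic `η`,
`∫_Y u^α ∂_i η = - ∫_Y g_i^α η`. -/
def IsWeakGrad {d m : ℕ} (u : L2Val d m) (g : L2Grad d m) : Prop :=
  ∀ η : EuclideanSpace ℝ (Fin d) → ℝ, ContDiff ℝ (⊤ : ℕ∞) η → IsPeriodic η →
    ∀ (i : Fin d) (α : Fin m),
      ∫ y in cell d, u y α * pderiv η i y = - ∫ y in cell d, g y (i, α) * η y

theorem isCompact_closedCell (d : ℕ) :
    IsCompact {y : EuclideanSpace ℝ (Fin d) | ∀ i, y i ∈ Icc (-(1 / 2 : ℝ)) (1 / 2)} := by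
  have h : IsCompact (Set.univ.pi fun _ : Fin d => Icc (-(1 / 2 : ℝ)) (1 / 2)) :=
    isCompact_univ_pi fun _ => isCompact_Icc
  have := (EuclideanSpace.equiv (Fin d) ℝ).toHomeomorph.isCompact_preimage.2 h
  convert this using 1
  ext y
  exact ⟨fun h i _ => h i, fun h i => h i trivial⟩

/-- Integrability behind the weak formulation: an `L^2(Y)` coordinate times a continuous function. -/
theorem integrable_coord_mul {d : ℕ} {ι : Type*} [Fintype ι]
    (u : Lp (EuclideanSpace ℝ ι) 2
      ((volume : Measure (EuclideanSpace ℝ (Fin d))).restrict (cell d)))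
    (k : ι) {f : EuclideanSpace ℝ (Fin d) → ℝ} (hf : Continuous f) :
    IntegrableOn (fun y => u y k * f y) (cell d) := by
  have hsub : cell d ⊆ {y : EuclideanSpace ℝ (Fin d) | ∀ i, y i ∈ Icc (-(1 / 2 : ℝ)) (1 / 2)} :=
    fun y hy i => ⟨(hy i).1.le, (hy i).2.le⟩
  have hmeas : MeasurableSet (cell d) := by
    have : cell d = ⋂ i, {y : EuclideanSpace ℝ (Fin d) | -(1 / 2 : ℝ) < y i ∧ y i < 1 / 2} := by
      ext y; simp [cell]
    rw [this]
    refine MeasurableSet.iInter fun i => ?_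
    have hc : Continuous fun y : EuclideanSpace ℝ (Fin d) => y i := by fun_prop
    exact (isOpen_Ioo.preimage hc).measurableSet
  have : IsFiniteMeasure
      ((volume : Measure (EuclideanSpace ℝ (Fin d))).restrict (cell d)) :=
    ⟨by
      rw [Measure.restrict_apply_univ]
      exact (measure_mono hsub).trans_lt (isCompact_closedCell d).measure_lt_top⟩
  have h1 : Integrable (fun y => u y k)
      ((volume : Measure (EuclideanSpace ℝ (Fin d))).restrict (cell d)) :=
    ((EuclideanSpace.proj k : EuclideanSpace ℝ ι →L[ℝ] ℝ).integrable_comp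
      ((Lp.memLp u).integrable (by norm_num)))
  obtain ⟨C, hC⟩ := (isCompact_closedCell d).exists_bound_of_continuousOn hf.continuousOn
  refine Integrable.mul_bdd (c := C) h1 hf.aestronglyMeasurable ?_
  exact (ae_restrict_iff' hmeas).2 (Eventually.of_forall fun y hy => hC y (hsub hy))

theorem continuous_pderiv {d : ℕ} {η : EuclideanSpace ℝ (Fin d) → ℝ} (h : ContDiff ℝ (⊤ : ℕ∞) η)
    (i : Fin d) : Continuous (pderiv η i) :=
  (h.continuous_fderiv (by simp)).clm_apply continuous_const

/-- `H^1(𝕋^d; ℝ^m)`, realized as the set of pairs `(u, ∇u)` in `L^2 × L^2`; the norm is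
`(‖u‖² + ‖∇u‖²)^{1/2}`. -/
def H1 (d m : ℕ) : Submodule ℝ (WithLp 2 (L2Val d m × L2Grad d m)) where
  carrier := {p | IsWeakGrad p.fst p.snd}
  zero_mem' := by
    intro η _ _ i α
    have h1 : ∫ y in cell d, (0 : L2Val d m) y α * pderiv η i y = 0 := by
      refine integral_eq_zero_of_ae ?_
      filter_upwards [Lp.coeFn_zero (EuclideanSpace ℝ (Fin m)) 2
        ((volume : Measure (EuclideanSpace ℝ (Fin d))).restrict (cell d))] with y hy
      rw [hy]
      simp
    have h2 : ∫ y in cell d, (0 : L2Grad d m) y (i, α) * η y = 0 := by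
      refine integral_eq_zero_of_ae ?_
      filter_upwards [Lp.coeFn_zero (EuclideanSpace ℝ (Fin d × Fin m)) 2
        ((volume : Measure (EuclideanSpace ℝ (Fin d))).restrict (cell d))] with y hy
      rw [hy]
      simp
    simp only [WithLp.zero_fst, WithLp.zero_snd]
    rw [h1, h2, neg_zero]
  add_mem' := by
    intro p q hp hq η hη hper i α
    have e1 : ∫ y in cell d, (p.fst + q.fst : L2Val d m) y α * pderiv η i y
        = (∫ y in cell d, p.fst y α * pderiv η i y)
          + ∫ y in cell d, q.fst y α * pderiv η i y := by
      rw [← integral_add (integrable_coord_mul _ _ (continuous_pderiv hη i))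
        (integrable_coord_mul _ _ (continuous_pderiv hη i))]
      refine integral_congr_ae ?_
      filter_upwards [Lp.coeFn_add p.fst q.fst] with y hy
      simp only [hy, Pi.add_apply, PiLp.add_apply, add_mul]
    have e2 : ∫ y in cell d, (p.snd + q.snd : L2Grad d m) y (i, α) * η y
        = (∫ y in cell d, p.snd y (i, α) * η y) + ∫ y in cell d, q.snd y (i, α) * η y := by
      rw [← integral_add (integrable_coord_mul _ _ hη.continuous)
        (integrable_coord_mul _ _ hη.continuous)]
      refine integral_congr_ae ?_
      filter_upwards [Lp.coeFn_add p.snd q.snd] with y hy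
      simp only [hy, Pi.add_apply, PiLp.add_apply, add_mul]
    simp only [WithLp.add_fst, WithLp.add_snd]
    rw [e1, e2, hp η hη hper i α, hq η hη hper i α]
    ring
  smul_mem' := by
    intro c p hp η hη hper i α
    have e1 : ∫ y in cell d, (c • p.fst : L2Val d m) y α * pderiv η i y
        = c * ∫ y in cell d, p.fst y α * pderiv η i y := by
      rw [← integral_const_mul]
      refine integral_congr_ae ?_
      filter_upwards [Lp.coeFn_smul c p.fst] with y hy
      simp only [hy, Pi.smul_apply, PiLp.smul_apply, smul_eq_mul, mul_assoc]
    have e2 : ∫ y in cell d, (c • p.snd : L2Grad d m) y (i, α) * η y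
        = c * ∫ y in cell d, p.snd y (i, α) * η y := by
      rw [← integral_const_mul]
      refine integral_congr_ae ?_
      filter_upwards [Lp.coeFn_smul c p.snd] with y hy
      simp only [hy, Pi.smul_apply, PiLp.smul_apply, smul_eq_mul, mul_assoc]
    simp only [WithLp.smul_fst, WithLp.smul_snd]
    rw [e1, e2, hp η hη hper i α]
    ring

/-- The function underlying an element of `H^1`. -/
def sobVal {d m : ℕ} (u : H1 d m) : L2Val d m := (u : WithLp 2 (L2Val d m × L2Grad d m)).fst

/-- The weak gradient of an element of `H^1`. -/
def sobGrad {d m : ℕ} (u : H1 d m) : L2Grad d m := (u : WithLp 2 (L2Val d m × L2Grad d m)).snd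

/-! ### Lipschitz domains -/

/-- `ω` has Lipschitz boundary: near each boundary point `x`, in suitable orthonormal coordinates
with last axis `e`, the set `ω` is the region strictly below the graph of a Lipschitz function
(defined on the hyperplane orthogonal to `e`). -/
def HasLipschitzBoundary {d : ℕ} (ω : Set (EuclideanSpace ℝ (Fin d))) : Prop :=
  ∀ x ∈ frontier ω, ∃ e : EuclideanSpace ℝ (Fin d), ‖e‖ = 1 ∧
    ∃ (L : NNReal) (γ : EuclideanSpace ℝ (Fin d) → ℝ), LipschitzWith L γ ∧
      ∃ ρ > 0, ∀ y ∈ Metric.ball x ρ, (y ∈ ω ↔ ⟪e, y⟫_ℝ < γ (y - ⟪e, y⟫_ℝ • e))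

/-- The inclusion `ω`: a domain with Lipschitz boundary, at positive distance from the boundary of
the cell `Y`, and not separating the cell. -/
structure IsInclusion {d : ℕ} (ω : Set (EuclideanSpace ℝ (Fin d))) : Prop where
  isOpen : IsOpen ω
  isConnected : IsConnected ω
  closure_subset : closure ω ⊆ cell d
  lipschitz : HasLipschitzBoundary ω
  isConnected_compl : IsConnected (cell d \ closure ω)

/-! ### Traces, and the spaces `H^{1/2}(∂ω)`, `H^{-1/2}(∂ω)`, `H_0^{-1/2}(∂ω)` -/

/-- The surface measure on `∂ω` (the `(d-1)`-dimensional Hausdorff measure, up to a constant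
factor depending on `d` only, which plays no role). -/
def surface {d : ℕ} (ω : Set (EuclideanSpace ℝ (Fin d))) : Measure (EuclideanSpace ℝ (Fin d)) :=
  (Measure.hausdorffMeasure ((d : ℝ) - 1)).restrict (frontier ω)

/-- `L^2(∂ω; ℝ^m)`. -/
abbrev L2Bdry {d : ℕ} (ω : Set (EuclideanSpace ℝ (Fin d))) (m : ℕ) : Type :=
  Lp (EuclideanSpace ℝ (Fin m)) 2 (surface ω)

/-- `g` is the trace of `v` on `∂ω`: there are smooth periodic functions `f n` that converge to `v`
in `H^1(𝕋^d)` and whose restrictions to `∂ω` converge to `g` in `L^2(∂ω)`. -/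
def HasTrace {d m : ℕ} (ω : Set (EuclideanSpace ℝ (Fin d))) (v : H1 d m) (g : L2Bdry ω m) :
    Prop :=
  ∃ f : ℕ → EuclideanSpace ℝ (Fin d) → EuclideanSpace ℝ (Fin m),
    (∀ n, ContDiff ℝ (⊤ : ℕ∞) (f n) ∧ IsPeriodic (f n)) ∧
    Tendsto (fun n => eLpNorm (fun y => f n y - sobVal v y) 2 (volume.restrict (cell d)))
      atTop (𝓝 0) ∧
    Tendsto (fun n => eLpNorm (fun y => classicalGrad (f n) y - sobGrad v y) 2
      (volume.restrict (cell d))) atTop (𝓝 0) ∧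
    Tendsto (fun n => eLpNorm (fun y => f n y - g y) 2 (surface ω)) atTop (𝓝 0)

theorem tendsto_eLpNorm_add {X F : Type*} [MeasurableSpace X] [NormedAddCommGroup F]
    {μ : Measure X} {a b : ℕ → X → F} {c : ℕ → X → F}
    (ha : ∀ n, AEStronglyMeasurable (a n) μ) (hb : ∀ n, AEStronglyMeasurable (b n) μ)
    (hc : ∀ n, c n =ᵐ[μ] a n + b n)
    (ha0 : Tendsto (fun n => eLpNorm (a n) 2 μ) atTop (𝓝 0))
    (hb0 : Tendsto (fun n => eLpNorm (b n) 2 μ) atTop (𝓝 0)) :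
    Tendsto (fun n => eLpNorm (c n) 2 μ) atTop (𝓝 0) := by
  have h := ha0.add hb0
  rw [add_zero] at h
  refine tendsto_of_tendsto_of_tendsto_of_le_of_le tendsto_const_nhds h (fun _ => zero_le) ?_
  intro n
  simp only
  rw [eLpNorm_congr_ae (hc n)]
  exact eLpNorm_add_le (ha n) (hb n) (by norm_num)

theorem tendsto_eLpNorm_smul {X F : Type*} [MeasurableSpace X] [NormedAddCommGroup F]
    [NormedSpace ℝ F] {μ : Measure X} {a c : ℕ → X → F} (t : ℝ)
    (hc : ∀ n, c n =ᵐ[μ] t • a n)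
    (ha0 : Tendsto (fun n => eLpNorm (a n) 2 μ) atTop (𝓝 0)) :
    Tendsto (fun n => eLpNorm (c n) 2 μ) atTop (𝓝 0) := by
  have h := ENNReal.Tendsto.const_mul (a := ‖t‖ₑ) ha0 (Or.inr (by simp))
  rw [mul_zero] at h
  refine h.congr fun n => ?_
  rw [eLpNorm_congr_ae (hc n), eLpNorm_const_smul]

theorem continuous_classicalGrad {d m : ℕ}
    {f : EuclideanSpace ℝ (Fin d) → EuclideanSpace ℝ (Fin m)} (h : ContDiff ℝ (⊤ : ℕ∞) f) :
    Continuous (classicalGrad f) := by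
  refine (PiLp.continuous_toLp 2 _).comp (continuous_pi fun p => ?_)
  have h1 : Continuous fun y => fderiv ℝ f y (EuclideanSpace.single p.1 1) :=
    (h.continuous_fderiv (by simp)).clm_apply continuous_const
  exact (EuclideanSpace.proj p.2 : EuclideanSpace ℝ (Fin m) →L[ℝ] ℝ).continuous.comp h1

/-- The graph of the trace map, a linear subspace of `H^1(𝕋^d) × L^2(∂ω)`. -/
def traceGraph {d : ℕ} (ω : Set (EuclideanSpace ℝ (Fin d))) (m : ℕ) :
    Submodule ℝ (H1 d m × L2Bdry ω m) where
  carrier := {p | HasTrace ω p.1 p.2}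
  zero_mem' := by
    refine ⟨fun _ _ => 0, fun n => ⟨contDiff_const, fun _ _ => rfl⟩, ?_, ?_, ?_⟩
    · refine tendsto_const_nhds.congr fun n => ?_
      refine ((eLpNorm_congr_ae ?_).trans eLpNorm_zero).symm
      filter_upwards [Lp.coeFn_zero (EuclideanSpace ℝ (Fin m)) 2
        ((volume : Measure (EuclideanSpace ℝ (Fin d))).restrict (cell d))] with y hy
      simpa [sobVal] using hy
    · refine tendsto_const_nhds.congr fun n => ?_
      refine ((eLpNorm_congr_ae ?_).trans eLpNorm_zero).symm
      filter_upwards [Lp.coeFn_zero (EuclideanSpace ℝ (Fin d × Fin m)) 2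
        ((volume : Measure (EuclideanSpace ℝ (Fin d))).restrict (cell d))] with y hy
      have h0 : classicalGrad (fun _ : EuclideanSpace ℝ (Fin d) =>
          (0 : EuclideanSpace ℝ (Fin m))) y = 0 := by
        ext p; simp [classicalGrad, pderiv]
      simpa [sobGrad, h0] using hy
    · refine tendsto_const_nhds.congr fun n => ?_
      refine ((eLpNorm_congr_ae ?_).trans eLpNorm_zero).symm
      filter_upwards [Lp.coeFn_zero (EuclideanSpace ℝ (Fin m)) 2 (surface ω)] with y hy
      simpa using hy
  add_mem' := by
    rintro p q ⟨f, hf, f1, f2, f3⟩ ⟨k, hk, k1, k2, k3⟩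
    refine ⟨fun n y => f n y + k n y, fun n => ⟨(hf n).1.add (hk n).1, fun y l => ?_⟩, ?_, ?_, ?_⟩
    · simp only [(hf n).2 y l, (hk n).2 y l]
    · refine tendsto_eLpNorm_add
        (fun n => (hf n).1.continuous.aestronglyMeasurable.sub (Lp.aestronglyMeasurable _))
        (fun n => (hk n).1.continuous.aestronglyMeasurable.sub (Lp.aestronglyMeasurable _))
        (fun n => ?_) f1 k1
      filter_upwards [Lp.coeFn_add (sobVal p.1) (sobVal q.1)] with y hy
      have : sobVal (p + q).1 y = (sobVal p.1) y + (sobVal q.1) y := hy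
      simp only [this, Pi.add_apply, Pi.sub_apply]
      abel
    · refine tendsto_eLpNorm_add
        (fun n => (continuous_classicalGrad (hf n).1).aestronglyMeasurable.sub
          (Lp.aestronglyMeasurable _))
        (fun n => (continuous_classicalGrad (hk n).1).aestronglyMeasurable.sub
          (Lp.aestronglyMeasurable _))
        (fun n => ?_) f2 k2
      filter_upwards [Lp.coeFn_add (sobGrad p.1) (sobGrad q.1)] with y hy
      have h1 : sobGrad (p + q).1 y = (sobGrad p.1) y + (sobGrad q.1) y := hy
      have h2 : classicalGrad (fun y => f n y + k n y) y
          = classicalGrad (f n) y + classicalGrad (k n) y := by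
        ext r
        have hfd := ((hf n).1.differentiable (by simp)) y
        have hkd := ((hk n).1.differentiable (by simp)) y
        simp [classicalGrad, pderiv, fderiv_fun_add hfd hkd]
      simp only [h1, h2, Pi.add_apply, Pi.sub_apply]
      abel
    · refine tendsto_eLpNorm_add
        (fun n => (hf n).1.continuous.aestronglyMeasurable.sub (Lp.aestronglyMeasurable _))
        (fun n => (hk n).1.continuous.aestronglyMeasurable.sub (Lp.aestronglyMeasurable _))
        (fun n => ?_) f3 k3
      filter_upwards [Lp.coeFn_add p.2 q.2] with y hy
      have : (p + q).2 y = p.2 y + q.2 y := hy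
      simp only [this, Pi.add_apply, Pi.sub_apply]
      abel
  smul_mem' := by
    rintro c p ⟨f, hf, f1, f2, f3⟩
    refine ⟨fun n y => c • f n y, fun n => ⟨(hf n).1.const_smul c, fun y l => ?_⟩,
      ?_, ?_, ?_⟩
    · simp only [(hf n).2 y l]
    · refine tendsto_eLpNorm_smul c (fun n => ?_) f1
      filter_upwards [Lp.coeFn_smul c (sobVal p.1)] with y hy
      have : sobVal (c • p).1 y = c • (sobVal p.1) y := hy
      simp only [this, Pi.smul_apply, smul_sub]
    · refine tendsto_eLpNorm_smul c (fun n => ?_) f2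
      filter_upwards [Lp.coeFn_smul c (sobGrad p.1)] with y hy
      have h1 : sobGrad (c • p).1 y = c • (sobGrad p.1) y := hy
      have h2 : classicalGrad (fun y => c • f n y) y = c • classicalGrad (f n) y := by
        ext r
        have hfd := ((hf n).1.differentiable (by simp)) y
        simp [classicalGrad, pderiv, fderiv_fun_const_smul hfd]
      simp only [h1, h2, Pi.smul_apply, smul_sub]
    · refine tendsto_eLpNorm_smul c (fun n => ?_) f3
      filter_upwards [Lp.coeFn_smul c p.2] with y hy
      have : (c • p).2 y = c • p.2 y := hy
      simp only [this, Pi.smul_apply, smul_sub]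

/-- `H^{1/2}(∂ω; ℝ^m)`: the space of traces on `∂ω` of `H^1` functions. -/
def HHalf {d : ℕ} (ω : Set (EuclideanSpace ℝ (Fin d))) (m : ℕ) : Submodule ℝ (L2Bdry ω m) :=
  (traceGraph ω m).map (LinearMap.snd ℝ (H1 d m) (L2Bdry ω m))

/-- The norm of `H^{1/2}(∂ω)`: the infimum of the `H^1` norms of all functions with trace `g`. -/
def halfNorm {d m : ℕ} {ω : Set (EuclideanSpace ℝ (Fin d))} (g : HHalf ω m) : ℝ :=
  sInf {r | ∃ v : H1 d m, HasTrace ω v (g : L2Bdry ω m) ∧ r = ‖v‖}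

/-- `H^{-1/2}(∂ω; ℝ^m)`, the dual of `H^{1/2}(∂ω; ℝ^m)`: the linear functionals that are bounded
for the `H^{1/2}` norm. The value `ψ g` is the pairing `⟨ψ, g⟩_{-1/2,1/2}`. -/
def HMinusHalf {d : ℕ} (ω : Set (EuclideanSpace ℝ (Fin d))) (m : ℕ) :
    Submodule ℝ (Module.Dual ℝ (HHalf ω m)) where
  carrier := {ψ | ∃ C : ℝ, ∀ g, |ψ g| ≤ C * halfNorm g}
  zero_mem' := ⟨0, fun g => by simp⟩
  add_mem' := by
    rintro φ ψ ⟨C, hC⟩ ⟨D, hD⟩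
    refine ⟨C + D, fun g => ?_⟩
    rw [LinearMap.add_apply, add_mul]
    exact (abs_add_le _ _).trans (add_le_add (hC g) (hD g))
  smul_mem' := by
    rintro c ψ ⟨C, hC⟩
    refine ⟨|c| * C, fun g => ?_⟩
    rw [LinearMap.smul_apply, smul_eq_mul, abs_mul, mul_assoc]
    exact mul_le_mul_of_nonneg_left (hC g) (abs_nonneg c)

/-- `H_0^{-1/2}(∂ω; ℝ^m)`: the elements of `H^{-1/2}(∂ω; ℝ^m)` that vanish on constants. -/
def HMinusHalfZero {d : ℕ} (ω : Set (EuclideanSpace ℝ (Fin d))) (m : ℕ) :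
    Submodule ℝ (Module.Dual ℝ (HHalf ω m)) where
  carrier := {ψ | ψ ∈ HMinusHalf ω m ∧ ∀ (c : EuclideanSpace ℝ (Fin m)) (g : HHalf ω m),
    ((g : L2Bdry ω m) : EuclideanSpace ℝ (Fin d) → EuclideanSpace ℝ (Fin m))
      =ᵐ[surface ω] (fun _ => c) → ψ g = 0}
  zero_mem' := ⟨Submodule.zero_mem _, fun _ _ _ => rfl⟩
  add_mem' := by
    rintro φ ψ ⟨h1, h2⟩ ⟨k1, k2⟩
    refine ⟨Submodule.add_mem _ h1 k1, fun c g hg => ?_⟩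
    rw [LinearMap.add_apply, h2 c g hg, k2 c g hg, add_zero]
  smul_mem' := by
    rintro t ψ ⟨h1, h2⟩
    refine ⟨Submodule.smul_mem _ t h1, fun c g hg => ?_⟩
    rw [LinearMap.smul_apply, h2 c g hg, smul_zero]

/-! ### Coefficients, single-layer potential, conormal derivatives -/

/-- The coefficient `A(y) = (a_{ij}^{αβ}(y))`, with `A y i j α β = a_{ij}^{αβ}(y)`, is measurable,
symmetric, strongly elliptic with constant `μ`, and periodic. -/
structure IsCoefficient {d m : ℕ}
    (A : EuclideanSpace ℝ (Fin d) → Fin d → Fin d → Fin m → Fin m → ℝ) (μ : ℝ) : Prop where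
  measurable : ∀ i j α β, Measurable fun y => A y i j α β
  symm : ∀ y i j α β, A y i j α β = A y j i β α
  pos : 0 < μ
  lower : ∀ (y : EuclideanSpace ℝ (Fin d)) (ξ : EuclideanSpace ℝ (Fin d × Fin m)),
    μ * ‖ξ‖ ^ 2 ≤ ∑ i, ∑ j, ∑ α, ∑ β, A y i j α β * ξ (i, α) * ξ (j, β)
  upper : ∀ (y : EuclideanSpace ℝ (Fin d)) (ξ : EuclideanSpace ℝ (Fin d × Fin m)),
    ∑ i, ∑ j, ∑ α, ∑ β, A y i j α β * ξ (i, α) * ξ (j, β) ≤ μ⁻¹ * ‖ξ‖ ^ 2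
  periodic : IsPeriodic A

/-- The bilinear form `∫_D A∇u·∇v = ∫_D a_{ij}^{αβ} ∂_j u^β ∂_i v^α` for `D ⊆ Y`. -/
def form {d m : ℕ} (A : EuclideanSpace ℝ (Fin d) → Fin d → Fin d → Fin m → Fin m → ℝ)
    (D : Set (EuclideanSpace ℝ (Fin d))) (u v : H1 d m) : ℝ :=
  ∫ y in D, ∑ i, ∑ j, ∑ α, ∑ β, A y i j α β * sobGrad u y (j, β) * sobGrad v y (i, α)

/-- `u` is the weak periodic single-layer potential of `ψ`: it has mean zero, and
`∫_Y A∇u·∇v + ⟨ψ, v⟩ = 0` for all `v ∈ H^1(𝕋^d)`, where `⟨ψ, v⟩` is `ψ` at the trace of `v`. -/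
def IsSingleLayer {d m : ℕ} (A : EuclideanSpace ℝ (Fin d) → Fin d → Fin d → Fin m → Fin m → ℝ)
    {ω : Set (EuclideanSpace ℝ (Fin d))} (ψ : Module.Dual ℝ (HHalf ω m)) (u : H1 d m) : Prop :=
  ∫ y in cell d, sobVal u y = 0 ∧
    ∀ (v : H1 d m) (g : HHalf ω m), HasTrace ω v (g : L2Bdry ω m) →
      form A (cell d) u v + ψ g = 0

/-- `ℓ` is the exterior conormal derivative `∂u/∂ν_A|_+` on `∂ω` (`ν` the outward unit normal of
`ω`), in the weak sense of Green's formula: `⟨ℓ, v⟩ = - ∫_{Y∖ω} A∇u·∇v`. -/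
def IsConormalExt {d m : ℕ} (A : EuclideanSpace ℝ (Fin d) → Fin d → Fin d → Fin m → Fin m → ℝ)
    {ω : Set (EuclideanSpace ℝ (Fin d))} (u : H1 d m) (ℓ : Module.Dual ℝ (HHalf ω m)) : Prop :=
  ∀ (v : H1 d m) (g : HHalf ω m), HasTrace ω v (g : L2Bdry ω m) →
    ℓ g = - form A (cell d \ ω) u v

/-- `ℓ` is the interior conormal derivative `∂u/∂ν_A|_-` on `∂ω`, in the weak sense of Green's
formula: `⟨ℓ, v⟩ = ∫_ω A∇u·∇v`. -/
def IsConormalInt {d m : ℕ} (A : EuclideanSpace ℝ (Fin d) → Fin d → Fin d → Fin m → Fin m → ℝ)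
    {ω : Set (EuclideanSpace ℝ (Fin d))} (u : H1 d m) (ℓ : Module.Dual ℝ (HHalf ω m)) : Prop :=
  ∀ (v : H1 d m) (g : HHalf ω m), HasTrace ω v (g : L2Bdry ω m) →
    ℓ g = form A ω u v

end PeriodicLayer

end

open PeriodicLayer

open MeasureTheory Filter Topology Set
open scoped InnerProductSpace

noncomputable section

namespace PeriodicLayer

set_option linter.unusedSectionVars false

/-! ### Bounded Lipschitz functions -/

section BddLip

variable {X F G H : Type*} [PseudoMetricSpace X] [NormedAddCommGroup F] [NormedSpace ℝ F]
  [NormedAddCommGroup G] [NormedSpace ℝ G] [NormedAddCommGroup H] [NormedSpace ℝ H]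

/-! Write a(u,v) for the energy over Y, and split it as a = a_int + a_ext into the energies over ω
and over Y∖ω. The trace map identifies the functionals in H_0^{-1/2} with the bounded functionals on
H^1(𝕋^d) that kill the functions of zero trace and the constants (`exists_dual`). The equation for
the potential is solved by Lax–Milgram on the orthogonal complement of the constants, where a
Poincaré inequality makes a coercive. The potential map S is injective, and its range consists of
the mean-zero u with a(u,v) = 0 for every v of zero trace (`mem_range_singleLayer`). These
conditions are closed, and the energy norm on H is equivalent to the H^1 norm of the potential, so H
is complete.

A function of zero trace can be cut off outside ω without leaving H^1 (`HasTrace.exists_cut`). Hence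
a_int(Sψ,·) depends on traces only: it is the interior conormal derivative, and since a(Sψ,·) = -ψ
the exterior one exceeds it by ψ. Adding ψ/2 to the interior one defines K, and a(SKψ,v) = (a_ext -
a_int)(Sψ,v)/2 (`form_singleLayer_neumannPoincare`). The symmetry of K is therefore that of A, and
boundedness follows because an everywhere defined symmetric operator on a Hilbert space is
continuous.

The spectral claim reduces to a_int(u,u) ≥ κ a(u,u) and a_ext(u,u) ≥ κ a(u,u) for u = Sψ with a
common κ > 0. The functional a(u,·) sees only the trace modulo constants. On either side D of the
boundary, a smooth function minus a suitable constant has the trace of a function whose H^1 norm is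
controlled by the gradient on D alone: localize, fold along the Lipschitz graphs, and use the
Poincaré inequality of the connected set D (`exists_extension`). By density, a(u,u) is at most a
constant times the product of the L^2 norms of ∇u over Y and over D, and ellipticity turns this into
the claim (`exists_le_form_of_bound`).

The remaining analysis is kept elementary. Smooth functions are dense because an element of H^1
orthogonal to all Fourier modes is zero. Traces come from the fundamental theorem of calculus on
lines transversal to the graph. Green's formula is needed only as an estimate of ∫_ω ∂H by the L^1
norm of H on ∂ω, so neither a normal vector nor a surface Jacobian appears. -/

/-- Bounded Lipschitz functions. -/
def BddLip (f : X → F) : Prop := (∃ K, LipschitzWith K f) ∧ ∃ C : ℝ, ∀ x, ‖f x‖ ≤ C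

theorem lipschitzWith_of_norm_sub_le {f : X → F} {K : ℝ}
    (h : ∀ x y, ‖f x - f y‖ ≤ K * dist x y) : LipschitzWith K.toNNReal f := by
  refine LipschitzWith.of_dist_le_mul fun x y => ?_
  rw [dist_eq_norm]
  exact (h x y).trans (mul_le_mul_of_nonneg_right (Real.le_coe_toNNReal K) dist_nonneg)

theorem norm_sub_le_mul_dist {f : X → F} {K : NNReal} (h : LipschitzWith K f) (x y : X) :
    ‖f x - f y‖ ≤ K * dist x y := by
  rw [← dist_eq_norm]; exact h.dist_le_mul x y

theorem BddLip.continuous {f : X → F} (hf : BddLip f) : Continuous f := hf.1.choose_spec.continuous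

/-- The increment of the product is B(Δf, g) + B(f, Δg), so boundedness of each factor is what makes
the product Lipschitz. Hence the two conditions are bundled: the class is stable under products,
smooth cutoffs and composition with folds. -/
theorem BddLip.bilin (B : F →L[ℝ] G →L[ℝ] H) {f : X → F} {g : X → G} (hf : BddLip f)
    (hg : BddLip g) : BddLip fun x => B (f x) (g x) := by
  obtain ⟨⟨K, hK⟩, C, hC⟩ := hf
  obtain ⟨⟨L, hL⟩, D, hD⟩ := hg
  refine ⟨⟨_, lipschitzWith_of_norm_sub_le (K := ‖B‖ * (K * D + C * L)) fun x y => ?_⟩,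
    ‖B‖ * C * D, fun x => ?_⟩
  · have h1 : B (f x) (g x) - B (f y) (g y) = B (f x - f y) (g x) + B (f y) (g x - g y) := by
      simp
    have hC0 : 0 ≤ C := (norm_nonneg _).trans (hC x)
    have hd : 0 ≤ dist x y := dist_nonneg
    rw [h1]
    calc _ ≤ ‖B‖ * ‖f x - f y‖ * ‖g x‖ + ‖B‖ * ‖f y‖ * ‖g x - g y‖ :=
          (norm_add_le _ _).trans (add_le_add (B.le_opNorm₂ _ _) (B.le_opNorm₂ _ _))
      _ ≤ ‖B‖ * (K * dist x y) * D + ‖B‖ * C * (L * dist x y) := by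
          gcongr
          exacts [norm_sub_le_mul_dist hK x y, hD x, hC y, norm_sub_le_mul_dist hL x y]
      _ = _ := by ring
  · have hC0 : 0 ≤ C := (norm_nonneg _).trans (hC x)
    refine (B.le_opNorm₂ _ _).trans ?_
    gcongr
    exacts [hC x, hD x]

theorem BddLip.add {f g : X → F} (hf : BddLip f) (hg : BddLip g) : BddLip fun x => f x + g x := by
  obtain ⟨⟨K, hK⟩, C, hC⟩ := hf
  obtain ⟨⟨L, hL⟩, D, hD⟩ := hg
  exact ⟨⟨K + L, hK.add hL⟩, C + D, fun x => (norm_add_le _ _).trans (add_le_add (hC x) (hD x))⟩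

theorem BddLip.neg {f : X → F} (hf : BddLip f) : BddLip fun x => -f x := by
  obtain ⟨⟨K, hK⟩, C, hC⟩ := hf
  exact ⟨⟨K, hK.neg⟩, C, fun x => by simpa using hC x⟩

theorem BddLip.sub {f g : X → F} (hf : BddLip f) (hg : BddLip g) : BddLip fun x => f x - g x := by
  simpa only [sub_eq_add_neg] using hf.add hg.neg

theorem bddLip_const (c : F) : BddLip fun _ : X => c :=
  ⟨⟨0, LipschitzWith.const c⟩, ‖c‖, fun _ => le_rfl⟩

theorem BddLip.clm (L : F →L[ℝ] G) {f : X → F} (hf : BddLip f) : BddLip fun x => L (f x) := by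
  obtain ⟨⟨K, hK⟩, C, hC⟩ := hf
  exact ⟨⟨_, L.lipschitz.comp hK⟩, ‖L‖ * C, fun x => (L.le_opNorm _).trans
    (mul_le_mul_of_nonneg_left (hC x) (norm_nonneg _))⟩

theorem BddLip.comp_lipschitz {Y : Type*} [PseudoMetricSpace Y] {f : X → F} (hf : BddLip f)
    {φ : Y → X} {L : NNReal} (hφ : LipschitzWith L φ) : BddLip fun y => f (φ y) := by
  obtain ⟨⟨K, hK⟩, C, hC⟩ := hf
  exact ⟨⟨_, hK.comp hφ⟩, C, fun x => hC _⟩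

theorem BddLip.smul {f : X → ℝ} {g : X → F} (hf : BddLip f) (hg : BddLip g) :
    BddLip fun x => f x • g x := BddLip.bilin (ContinuousLinearMap.lsmul ℝ ℝ) hf hg

theorem BddLip.mul {f g : X → ℝ} (hf : BddLip f) (hg : BddLip g) : BddLip fun x => f x * g x :=
  hf.smul hg

theorem BddLip.normSq {W : Type*} [NormedAddCommGroup W] [InnerProductSpace ℝ W] {f : X → W}
    (hf : BddLip f) : BddLip fun x => ‖f x‖ ^ 2 := by
  have h : (fun x => ‖f x‖ ^ 2) = fun x => innerSL ℝ (f x) (f x) :=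
    funext fun x => (real_inner_self_eq_norm_sq _).symm
  rw [h]
  exact BddLip.bilin (innerSL ℝ (E := W)) hf hf

theorem BddLip.sum {ι : Type*} (s : Finset ι) {f : ι → X → F} (hf : ∀ i ∈ s, BddLip (f i)) :
    BddLip fun x => ∑ i ∈ s, f i x := by
  classical
  induction s using Finset.induction_on with
  | empty => simpa using bddLip_const (0 : F)
  | insert a s ha ih =>
    simp only [Finset.sum_insert ha]
    exact (hf a (by simp)).add (ih fun i hi => hf i (by simp [hi]))

end BddLip

theorem BddLip.of_contDiff {V F : Type*} [NormedAddCommGroup V] [NormedSpace ℝ V]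
    [NormedAddCommGroup F] [NormedSpace ℝ F] {f : V → F} (hf : ContDiff ℝ (⊤ : ℕ∞) f)
    (hc : HasCompactSupport f) : BddLip f :=
  ⟨ContDiff.lipschitzWith_of_hasCompactSupport hc hf (by simp),
    hf.continuous.bounded_above_of_compact_support hc⟩

/-! ### One-dimensional and integration-by-parts facts for Lipschitz functions -/

/-- Lipschitz functions are absolutely continuous, so the fundamental theorem of calculus holds with
the almost everywhere derivative. -/
theorem enorm_sub_le_lintegral_deriv {g : ℝ → ℝ} {K : NNReal} (hg : LipschitzWith K g) {a b : ℝ}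
    (hab : a ≤ b) : ‖g b - g a‖ₑ ≤ ∫⁻ s in Ioc a b, ‖deriv g s‖ₑ := by
  rw [← (LipschitzOnWith.absolutelyContinuousOnInterval
    (hg.lipschitzOnWith (s := uIcc a b))).integral_deriv_eq_sub,
    intervalIntegral.integral_of_le hab]
  exact enorm_integral_le_lintegral_enorm _

section Lipschitz

variable {V F : Type*} [NormedAddCommGroup V] [NormedSpace ℝ V] [FiniteDimensional ℝ V]
  [MeasurableSpace V] [BorelSpace V] {ν : Measure V} [ν.IsAddHaarMeasure]
  [NormedAddCommGroup F] [NormedSpace ℝ F] [FiniteDimensional ℝ F]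

theorem norm_fderiv_apply_le_of_lipschitz {f : V → F} {K : NNReal} (hf : LipschitzWith K f)
    (y v : V) : ‖fderiv ℝ f y v‖ ≤ K * ‖v‖ :=
  (ContinuousLinearMap.le_opNorm _ _).trans
    (mul_le_mul_of_nonneg_right (norm_fderiv_le_of_lipschitz ℝ hf) (norm_nonneg _))

theorem integrable_fderiv_apply {g : V → F} {K : NNReal} (hg : LipschitzWith K g)
    (hc : HasCompactSupport g) (v : V) : Integrable (fun y => fderiv ℝ g y v) ν := by
  borelize F
  have hc' : HasCompactSupport fun y => fderiv ℝ g y v :=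
    hc.fderiv_apply ℝ v
  refine (IntegrableOn.integrable_of_forall_notMem_eq_zero (s := tsupport fun y => fderiv ℝ g y v)
    ?_ fun x hx => image_eq_zero_of_notMem_tsupport (f := fun y => fderiv ℝ g y v) hx)
  refine Measure.integrableOn_of_bounded (M := K * ‖v‖) hc'.isCompact.measure_lt_top.ne
    (measurable_fderiv_apply_const ℝ g v).aestronglyMeasurable ?_
  exact Eventually.of_forall fun y => norm_fderiv_apply_le_of_lipschitz hg y v

/-- Integration by parts against the constant 1; Rademacher's theorem identifies the line derivative
with the Fréchet derivative almost everywhere. -/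
theorem integral_fderiv_eq_zero {g : V → ℝ} {K : NNReal} (hg : LipschitzWith K g)
    (hc : HasCompactSupport g) (v : V) : ∫ y, fderiv ℝ g y v ∂ν = 0 := by
  have h := LipschitzWith.integral_lineDeriv_mul_eq (μ := ν) (LipschitzWith.const (1 : ℝ)) hg hc (-v)
  have h0 : ∀ x : V, lineDeriv ℝ (fun _ : V => (1 : ℝ)) x (-v) = 0 := fun x => by simp [lineDeriv]
  simp only [h0, zero_mul, integral_zero, neg_neg, mul_one] at h
  rw [h]
  refine integral_congr_ae ?_
  filter_upwards [hg.ae_differentiableAt] with y hy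
  exact hy.lineDeriv_eq_fderiv.symm

/-- Only the local growth of g ∘ φ at y matters, so φ need not be differentiable there. This is what
makes the bound usable at every point for a fold, which has kinks along the graph. -/
theorem norm_fderiv_comp_le {g : V → F} {φ : V → V} {K : NNReal} (hφ : LipschitzWith K φ) {y : V}
    (hg : DifferentiableAt ℝ g (φ y)) :
    ‖fderiv ℝ (fun x => g (φ x)) y‖ ≤ K * ‖fderiv ℝ g (φ y)‖ := by
  refine le_of_forall_pos_le_add fun ε hε => ?_
  have hδ : 0 < ε / (K + 1) := by positivity
  have hle : K * (‖fderiv ℝ g (φ y)‖ + ε / (K + 1)) ≤ K * ‖fderiv ℝ g (φ y)‖ + ε := by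
    have : (K : ℝ) * (ε / (K + 1)) ≤ ε := by
      rw [mul_div_assoc', div_le_iff₀ (by positivity)]
      nlinarith
    linarith [mul_add (K : ℝ) ‖fderiv ℝ g (φ y)‖ (ε / (K + 1))]
  refine le_trans (norm_fderiv_le_of_lip' ℝ (by positivity) ?_) hle
  have h1 := hg.hasFDerivAt.isLittleO.def hδ
  filter_upwards [hφ.continuous.continuousAt.eventually h1] with x hx
  have h2 : ‖φ x - φ y‖ ≤ K * ‖x - y‖ := by
    simpa [dist_eq_norm] using hφ.dist_le_mul x y
  calc ‖g (φ x) - g (φ y)‖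
      ≤ ‖g (φ x) - g (φ y) - fderiv ℝ g (φ y) (φ x - φ y)‖ + ‖fderiv ℝ g (φ y) (φ x - φ y)‖ := by
        simpa using norm_add_le (g (φ x) - g (φ y) - fderiv ℝ g (φ y) (φ x - φ y))
          (fderiv ℝ g (φ y) (φ x - φ y))
    _ ≤ ε / (K + 1) * ‖φ x - φ y‖ + ‖fderiv ℝ g (φ y)‖ * ‖φ x - φ y‖ :=
        add_le_add hx (ContinuousLinearMap.le_opNorm _ _)
    _ = (‖fderiv ℝ g (φ y)‖ + ε / (K + 1)) * ‖φ x - φ y‖ := by ring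
    _ ≤ (‖fderiv ℝ g (φ y)‖ + ε / (K + 1)) * (K * ‖x - y‖) := by gcongr
    _ = _ := by ring

end Lipschitz

/-! ### Gradients -/

section Grad

variable {d m : ℕ}

theorem norm_classicalGrad_sq (f : EuclideanSpace ℝ (Fin d) → EuclideanSpace ℝ (Fin m))
    (y : EuclideanSpace ℝ (Fin d)) :
    ‖classicalGrad f y‖ ^ 2 = ∑ i, ‖pderiv f i y‖ ^ 2 := by
  simp only [EuclideanSpace.norm_sq_eq, classicalGrad, Fintype.sum_prod_type]

theorem norm_classicalGrad_le (f : EuclideanSpace ℝ (Fin d) → EuclideanSpace ℝ (Fin m))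
    (y : EuclideanSpace ℝ (Fin d)) :
    ‖classicalGrad f y‖ ^ 2 ≤ d * ‖fderiv ℝ f y‖ ^ 2 := by
  rw [norm_classicalGrad_sq]
  calc _ ≤ ∑ _i : Fin d, ‖fderiv ℝ f y‖ ^ 2 := by
        refine Finset.sum_le_sum fun i _ => ?_
        gcongr
        refine (ContinuousLinearMap.le_opNorm _ _).trans ?_
        simp
    _ = _ := by simp

/-- The operator norm is at most the Frobenius norm, by Cauchy–Schwarz. With `norm_classicalGrad_le`
the two measures of the gradient are interchangeable up to constants. -/
theorem norm_fderiv_le_classicalGrad (f : EuclideanSpace ℝ (Fin d) → EuclideanSpace ℝ (Fin m))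
    (y : EuclideanSpace ℝ (Fin d)) : ‖fderiv ℝ f y‖ ≤ ‖classicalGrad f y‖ := by
  refine ContinuousLinearMap.opNorm_le_bound _ (norm_nonneg _) fun v => ?_
  have hv : v = ∑ i, v i • EuclideanSpace.single i (1 : ℝ) := by
    ext j
    simp [Finset.sum_apply, Pi.single_apply]
  have h1 : fderiv ℝ f y v = ∑ i, v i • pderiv f i y := by
    conv_lhs => rw [hv]
    simp [pderiv]
  have h2 : ‖fderiv ℝ f y v‖ ≤ ∑ i, |v i| * ‖pderiv f i y‖ := by
    rw [h1]
    refine (norm_sum_le _ _).trans (le_of_eq ?_)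
    simp [norm_smul]
  refine h2.trans (abs_le_of_sq_le_sq' ?_ (by positivity)).2
  refine (Finset.sum_mul_sq_le_sq_mul_sq _ _ _).trans (le_of_eq ?_)
  rw [mul_pow, norm_classicalGrad_sq, EuclideanSpace.norm_sq_eq v, mul_comm]
  simp

end Grad

/-! ### Graph charts -/

/-- A direction `dir` together with a Lipschitz function `height` that grows at unit speed in the
direction `dir`; the set `{height < 0}` is the region below a Lipschitz graph. -/
structure GraphChart (d : ℕ) where
  dir : EuclideanSpace ℝ (Fin d)
  height : EuclideanSpace ℝ (Fin d) → ℝ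
  lip : NNReal
  norm_dir : ‖dir‖ = 1
  lipschitz : LipschitzWith lip height
  height_add : ∀ y s, height (y + s • dir) = height y + s

namespace GraphChart

variable {d : ℕ} (c : GraphChart d)

/-- The chart with the two sides of the graph exchanged. -/
def flip : GraphChart d where
  dir := -c.dir
  height := fun y => -c.height y
  lip := c.lip
  norm_dir := by rw [norm_neg, c.norm_dir]
  lipschitz := c.lipschitz.neg
  height_add := fun y s => by
    have := c.height_add y (-s)
    rw [neg_smul] at this
    rw [smul_neg, this]
    ring

theorem continuous_height : Continuous c.height := c.lipschitz.continuous

/-- The point of the graph `{height = 0}` on the line through `y` in the direction `dir`. -/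
def foot (y : EuclideanSpace ℝ (Fin d)) : EuclideanSpace ℝ (Fin d) := y - c.height y • c.dir

theorem foot_lipschitz : LipschitzWith (1 + c.lip) c.foot := by
  have h : LipschitzWith c.lip fun y => c.height y • c.dir := by
    refine LipschitzWith.of_dist_le_mul fun x y => ?_
    rw [dist_eq_norm, ← sub_smul, norm_smul, c.norm_dir, mul_one, ← dist_eq_norm]
    exact c.lipschitz.dist_le_mul x y
  exact LipschitzWith.id.sub h

@[simp]
theorem height_foot (y : EuclideanSpace ℝ (Fin d)) : c.height (c.foot y) = 0 := by
  have := c.height_add y (-c.height y)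
  rw [neg_smul, ← sub_eq_add_neg] at this
  rw [foot, this]
  ring

theorem height_foot_add (y : EuclideanSpace ℝ (Fin d)) (s : ℝ) :
    c.height (c.foot y + s • c.dir) = s := by
  rw [c.height_add, c.height_foot, zero_add]

/-- The map that is the identity below the graph and reflects the region above it. -/
def fold (y : EuclideanSpace ℝ (Fin d)) : EuclideanSpace ℝ (Fin d) :=
  y - (2 * max (c.height y) 0) • c.dir

theorem fold_lipschitz : LipschitzWith (1 + 2 * c.lip) c.fold := by
  have h : LipschitzWith (2 * c.lip) fun y => (2 * max (c.height y) 0) • c.dir := by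
    refine LipschitzWith.of_dist_le_mul fun x y => ?_
    rw [dist_eq_norm, ← sub_smul, norm_smul, c.norm_dir, mul_one, ← dist_eq_norm]
    have h1 := (c.lipschitz.max_const 0).dist_le_mul x y
    rw [Real.dist_eq] at h1
    rw [dist_eq_norm, Real.norm_eq_abs, ← mul_sub, abs_mul, abs_two]
    simp only [NNReal.coe_mul, NNReal.coe_ofNat]
    rw [mul_assoc]
    linarith
  exact LipschitzWith.id.sub h

theorem fold_of_nonpos {y : EuclideanSpace ℝ (Fin d)} (h : c.height y ≤ 0) : c.fold y = y := by
  simp [fold, max_eq_right h]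

theorem height_fold (y : EuclideanSpace ℝ (Fin d)) : c.height (c.fold y) = -|c.height y| := by
  have := c.height_add y (-(2 * max (c.height y) 0))
  rw [neg_smul, ← sub_eq_add_neg] at this
  rw [fold, this]
  rcases le_total (c.height y) 0 with h | h
  · rw [max_eq_right h, abs_of_nonpos h]; ring
  · rw [max_eq_left h, abs_of_nonneg h]; ring

theorem fold_foot_add (y : EuclideanSpace ℝ (Fin d)) (s : ℝ) :
    c.fold (c.foot y + s • c.dir) = c.foot y + (-|s|) • c.dir := by
  rw [fold, c.height_foot_add, add_sub_assoc, ← sub_smul]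
  congr 2
  rcases le_total s 0 with h | h
  · rw [max_eq_right h, abs_of_nonpos h]; ring
  · rw [max_eq_left h, abs_of_nonneg h]; ring

/-- Folding preserves |height|, and height vanishes at x, so the displacement is at most twice lip
times the distance from the folded point to x. Functions localized near x thus stay localized after
folding. -/
theorem mem_closedBall_of_fold_mem {x y : EuclideanSpace ℝ (Fin d)} {r : ℝ}
    (hx : c.height x = 0) (hy : c.fold y ∈ Metric.closedBall x r) :
    y ∈ Metric.closedBall x ((1 + 2 * c.lip) * r) := by
  rw [mem_closedBall_iff_norm] at hy ⊢
  have h1 := c.lipschitz.dist_le_mul (c.fold y) x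
  rw [Real.dist_eq, hx, sub_zero, c.height_fold, abs_neg, abs_abs, dist_eq_norm] at h1
  have h2 : y - x = (c.fold y - x) + (2 * max (c.height y) 0) • c.dir := by
    rw [fold]; abel
  have h3 : |2 * max (c.height y) 0| ≤ 2 * |c.height y| := by
    rw [abs_mul, abs_two]
    rw [abs_of_nonneg (le_max_right (c.height y) 0)]
    exact mul_le_mul_of_nonneg_left (max_le (le_abs_self _) (abs_nonneg _)) zero_le_two
  rw [h2]
  refine (norm_add_le _ _).trans ?_
  rw [norm_smul, c.norm_dir, mul_one, Real.norm_eq_abs]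
  have h4 : (c.lip : ℝ) * ‖c.fold y - x‖ ≤ c.lip * r := by gcongr
  linarith

/-! #### Coordinates -/

/-- The hyperplane orthogonal to the direction of a chart. -/
abbrev hyperplane : Submodule ℝ (EuclideanSpace ℝ (Fin d)) := (ℝ ∙ c.dir)ᗮ

theorem dir_ne_zero : c.dir ≠ 0 := fun h => by simpa [h] using c.norm_dir

theorem finrank_hyperplane : (Module.finrank ℝ c.hyperplane : ℝ) = (d : ℝ) - 1 := by
  have h := Submodule.finrank_add_finrank_orthogonal (ℝ ∙ c.dir)
  rw [finrank_span_singleton c.dir_ne_zero, finrank_euclideanSpace, Fintype.card_fin] at h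
  have h' : (1 : ℝ) + Module.finrank ℝ c.hyperplane = d := by exact_mod_cast h
  linarith

/-- The `(d-1)`-dimensional measure on the hyperplane. -/
def area : Measure c.hyperplane := Measure.hausdorffMeasure ((d : ℝ) - 1)

instance : c.area.IsAddHaarMeasure := by
  rw [area, ← c.finrank_hyperplane]
  infer_instance

theorem dir_inner_hyperplane (z : c.hyperplane) : ⟪c.dir, (z : EuclideanSpace ℝ (Fin d))⟫_ℝ = 0 :=
  Submodule.mem_orthogonal_singleton_iff_inner_right.1 z.2

theorem inner_dir_self : ⟪c.dir, c.dir⟫_ℝ = 1 := by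
  rw [real_inner_self_eq_norm_sq, c.norm_dir, one_pow]

/-- The splitting of the space into the direction of the chart and its orthogonal complement. -/
def splitting : (ℝ × c.hyperplane) ≃L[ℝ] EuclideanSpace ℝ (Fin d) :=
  LinearEquiv.toContinuousLinearEquiv
    { toFun := fun p => (p.2 : EuclideanSpace ℝ (Fin d)) + p.1 • c.dir
      map_add' := fun p q => by
        simp only [Prod.snd_add, Prod.fst_add, Submodule.coe_add, add_smul]; abel
      map_smul' := fun r p => by
        simp [smul_add, mul_smul]
      invFun := fun y => (⟪c.dir, y⟫_ℝ, ⟨y - ⟪c.dir, y⟫_ℝ • c.dir,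
        Submodule.mem_orthogonal_singleton_iff_inner_right.2 (by
          rw [inner_sub_right, inner_smul_right, c.inner_dir_self]; ring)⟩)
      left_inv := fun p => by
        have h : ⟪c.dir, (p.2 : EuclideanSpace ℝ (Fin d)) + p.1 • c.dir⟫_ℝ = p.1 := by
          rw [inner_add_right, inner_smul_right, c.inner_dir_self, c.dir_inner_hyperplane]; ring
        ext1
        · exact h
        · ext1; simp [h]
      right_inv := fun y => by simp }

theorem splitting_apply (p : ℝ × c.hyperplane) :
    c.splitting p = (p.2 : EuclideanSpace ℝ (Fin d)) + p.1 • c.dir := rfl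

/-- Fubini's theorem in the coordinates of a chart. -/
theorem exists_lintegral_eq : ∃ C : ENNReal, C ≠ 0 ∧ C ≠ ⊤ ∧
    ∀ (S : Set ℝ), MeasurableSet S → ∀ h : EuclideanSpace ℝ (Fin d) → ENNReal, Measurable h →
      ∫⁻ y in c.height ⁻¹' S, h y
        = C * ∫⁻ z : c.hyperplane, (∫⁻ s in S, h (c.foot z + s • c.dir)) ∂c.area := by
  have hH : (((volume : Measure ℝ).prod c.area).map c.splitting).IsAddHaarMeasure :=
    ContinuousLinearEquiv.isAddHaarMeasure_map c.splitting _
  -- Uniqueness of Haar measure supplies the constant, so the normalization of the Hausdorff measure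
  -- on the hyperplane never has to be computed.
  have hC := Measure.isAddLeftInvariant_eq_smul (volume : Measure (EuclideanSpace ℝ (Fin d)))
    (((volume : Measure ℝ).prod c.area).map c.splitting)
  have hC0 := Measure.addHaarScalarFactor_pos_of_isAddHaarMeasure
    (volume : Measure (EuclideanSpace ℝ (Fin d)))
    (((volume : Measure ℝ).prod c.area).map c.splitting)
  set C := Measure.addHaarScalarFactor (volume : Measure (EuclideanSpace ℝ (Fin d)))
    (((volume : Measure ℝ).prod c.area).map c.splitting)
  refine ⟨C, by simpa using hC0.ne', ENNReal.coe_ne_top, fun S hS h hh => ?_⟩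
  have hm : MeasurableSet (c.height ⁻¹' S) := c.continuous_height.measurable hS
  have hk : Measurable ((c.height ⁻¹' S).indicator h) := hh.indicator hm
  rw [← lintegral_indicator hm, hC, lintegral_smul_measure,
    lintegral_map hk c.splitting.continuous.measurable, ENNReal.smul_def, smul_eq_mul,
    lintegral_prod_symm' (fun p => (c.height ⁻¹' S).indicator h (c.splitting p)) (hk.comp c.splitting.continuous.measurable)]
  congr 1
  refine lintegral_congr fun z => ?_
  rw [← lintegral_indicator hS]
  -- Shifting the vertical variable by the height of z straightens the graph: the new variable is
  -- the height above it.
  rw [← lintegral_sub_right_eq_self _ (c.height z)]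
  refine lintegral_congr fun s => ?_
  have h1 : c.splitting (s - c.height z, z) = c.foot z + s • c.dir := by
    rw [splitting_apply, foot, sub_smul]; simp only; abel
  rw [h1]
  by_cases hs : s ∈ S
  · rw [indicator_of_mem hs, indicator_of_mem]
    rwa [mem_preimage, c.height_foot_add]
  · rw [indicator_of_notMem hs, indicator_of_notMem]
    rwa [mem_preimage, c.height_foot_add]

theorem volume_height_zero : volume {y | c.height y = 0} = 0 := by
  obtain ⟨C, -, -, hC⟩ := c.exists_lintegral_eq
  have h := hC {0} (measurableSet_singleton 0) (fun _ => 1) measurable_const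
  simp only [setLIntegral_one, measure_singleton, lintegral_zero, mul_zero] at h
  exact h

/-- The orthogonal projection to the hyperplane is 1-Lipschitz and inverts `foot`, so it cannot
increase Hausdorff measure. Together with `exists_lintegral_surface_le` this makes surface measure
on the graph comparable with flat measure, without an area formula. -/
theorem lintegral_foot_le {h : EuclideanSpace ℝ (Fin d) → ENNReal} (hh : Measurable h) :
    ∫⁻ z : c.hyperplane, h (c.foot z) ∂c.area
      ≤ ∫⁻ y in {y | c.height y = 0}, h y ∂Measure.hausdorffMeasure ((d : ℝ) - 1) := by
  have hfm : Measurable fun z : c.hyperplane => c.foot z :=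
    (c.foot_lipschitz.continuous.comp continuous_subtype_val).measurable
  rw [← lintegral_map hh hfm]
  refine lintegral_mono' (Measure.le_iff.2 fun S hS => ?_) le_rfl
  have h0 : MeasurableSet {y | c.height y = 0} :=
    c.continuous_height.measurable (measurableSet_singleton 0)
  rw [Measure.map_apply hfm hS, Measure.restrict_apply hS, area]
  let P := c.hyperplane.orthogonalProjectionOnto
  have hP : LipschitzWith 1 P := by
    refine LipschitzWith.of_dist_le_mul fun x y => ?_
    rw [dist_eq_norm, ← map_sub, NNReal.coe_one, one_mul, dist_eq_norm]
    exact c.hyperplane.norm_orthogonalProjectionOnto_apply_le _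
  have hPf : ∀ z : c.hyperplane, P (c.foot z) = z := fun z => by
    have hd : P c.dir = 0 := by
      rw [Submodule.orthogonalProjectionOnto_eq_zero_iff]
      exact Submodule.le_orthogonal_orthogonal _ (Submodule.mem_span_singleton_self _)
    rw [foot, map_sub, map_smul, hd, smul_zero, sub_zero]
    exact Submodule.orthogonalProjectionOnto_mem_subspace_eq_self z
  have hsub : (fun z : c.hyperplane => c.foot z) ⁻¹' S ⊆ P '' (S ∩ {y | c.height y = 0}) :=
    fun z hz => ⟨c.foot z, ⟨hz, c.height_foot _⟩, hPf z⟩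
  refine (measure_mono hsub).trans ?_
  have hd0 : 0 ≤ (d : ℝ) - 1 := by rw [← c.finrank_hyperplane]; positivity
  refine ((hP.lipschitzOnWith).hausdorffMeasure_image_le hd0).trans ?_
  simp

/-- The map `foot` sends the hyperplane onto the graph with Lipschitz constant 1 + lip, hence
enlarges (d-1)-dimensional Hausdorff measure by at most that constant to the power d-1. -/
theorem exists_lintegral_surface_le : ∃ C : ENNReal, C ≠ ⊤ ∧
    ∀ h : EuclideanSpace ℝ (Fin d) → ENNReal, Measurable h →
      ∫⁻ y in {y | c.height y = 0}, h y ∂Measure.hausdorffMeasure ((d : ℝ) - 1)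
        ≤ C * ∫⁻ z : c.hyperplane, h (c.foot z) ∂c.area := by
  have hd0 : 0 ≤ (d : ℝ) - 1 := by rw [← c.finrank_hyperplane]; positivity
  refine ⟨((1 + c.lip : NNReal) : ENNReal) ^ ((d : ℝ) - 1),
    ENNReal.rpow_ne_top_of_nonneg hd0 ENNReal.coe_ne_top, fun h hh => ?_⟩
  have hfm : Measurable fun z : c.hyperplane => c.foot z :=
    (c.foot_lipschitz.continuous.comp continuous_subtype_val).measurable
  rw [← lintegral_map hh hfm, ← smul_eq_mul, ← lintegral_smul_measure]
  refine lintegral_mono' (Measure.le_iff.2 fun S hS => ?_) le_rfl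
  rw [Measure.smul_apply, Measure.map_apply hfm hS, Measure.restrict_apply hS, area, smul_eq_mul]
  have hL : LipschitzWith (1 + c.lip) fun z : c.hyperplane => c.foot z := fun x y =>
    c.foot_lipschitz x y
  have hsub : S ∩ {y | c.height y = 0}
      ⊆ (fun z : c.hyperplane => c.foot z) '' ((fun z : c.hyperplane => c.foot z) ⁻¹' S) := by
    rintro y ⟨hyS, hy0 : c.height y = 0⟩
    obtain ⟨⟨s, z⟩, rfl⟩ := c.splitting.surjective y
    rw [splitting_apply] at hyS hy0 ⊢
    simp only at hyS hy0 ⊢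
    rw [c.height_add] at hy0
    have h1 : c.foot z = (z : EuclideanSpace ℝ (Fin d)) + s • c.dir := by
      rw [foot, show c.height z = -s by linarith, neg_smul, sub_neg_eq_add]
    exact ⟨z, by rwa [mem_preimage, h1], h1⟩
  refine (measure_mono hsub).trans ?_
  exact (hL.lipschitzOnWith).hausdorffMeasure_image_le hd0

/-- On each line in the direction of the chart the fold is s ↦ -|s|, which covers the lower
half-line twice. -/
theorem lintegral_comp_fold_le {h : EuclideanSpace ℝ (Fin d) → ENNReal} (hh : Measurable h) :
    ∫⁻ y, h (c.fold y) ≤ 2 * ∫⁻ y in {y | c.height y < 0}, h y := by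
  obtain ⟨C, -, hCt, hC⟩ := c.exists_lintegral_eq
  have h1 := hC univ MeasurableSet.univ _ (hh.comp c.fold_lipschitz.continuous.measurable)
  have h2 := hC (Iio 0) measurableSet_Iio h hh
  rw [preimage_univ, Measure.restrict_univ] at h1
  rw [show {y | c.height y < 0} = c.height ⁻¹' (Iio 0) from rfl, h2]
  refine h1.le.trans ?_
  rw [mul_left_comm, ← lintegral_const_mul' _ _ ENNReal.ofNat_ne_top]
  gcongr with z
  simp only [Function.comp_apply, c.fold_foot_add]
  rw [Measure.restrict_univ, two_mul]
  set k : ℝ → ENNReal := fun s => h (c.foot z + s • c.dir) with hk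
  have hkm : Measurable k := hh.comp (by fun_prop)
  have hneg : ∫⁻ s in Ioi (0 : ℝ), k (-s) = ∫⁻ s in Iio (0 : ℝ), k s := by
    have := (Measure.measurePreserving_neg (volume : Measure ℝ)).setLIntegral_comp_preimage
      measurableSet_Iio hkm (s := Iio 0)
    rw [← this]
    congr 2
    ext s; simp
  have hle : ∀ s : ℝ, s ≠ 0 → k (-|s|)
      ≤ (Iio (0 : ℝ)).indicator k s + (Ioi (0 : ℝ)).indicator (fun s => k (-s)) s := by
    intro s hs
    rcases lt_or_gt_of_ne hs with h | h
    · rw [abs_of_neg h, neg_neg, indicator_of_mem (by exact h)]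
      exact le_self_add
    · rw [abs_of_pos h, indicator_of_mem (s := Ioi 0) (by exact h)]
      exact le_add_self
  calc ∫⁻ s : ℝ, k (-|s|)
      ≤ ∫⁻ s : ℝ, ((Iio (0 : ℝ)).indicator k s + (Ioi (0 : ℝ)).indicator (fun s => k (-s)) s) := by
        refine lintegral_mono_ae ?_
        filter_upwards [Measure.ae_ne volume (0 : ℝ)] with s hs using hle s hs
    _ = (∫⁻ s in Iio 0, k s) + ∫⁻ s in Iio 0, k s := by
        rw [lintegral_add_left (hkm.indicator measurableSet_Iio),
          lintegral_indicator measurableSet_Iio, lintegral_indicator measurableSet_Ioi, hneg]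

end GraphChart

/-! ### Estimates across a Lipschitz graph -/

namespace GraphChart

variable {d : ℕ} (c : GraphChart d)

/-- Line derivatives are used because differentiability almost everywhere in space says nothing
about a given line, whereas the line derivative is the one-dimensional derivative on every line. -/
theorem enorm_sub_foot_le {G : EuclideanSpace ℝ (Fin d) → ℝ} {K : NNReal}
    (hG : LipschitzWith K G) (z : EuclideanSpace ℝ (Fin d)) {a b : ℝ} (hab : a ≤ b) :
    ‖G (c.foot z + b • c.dir) - G (c.foot z + a • c.dir)‖ₑ
      ≤ ∫⁻ s in Ioc a b, ‖lineDeriv ℝ G (c.foot z + s • c.dir) c.dir‖ₑ := by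
  have hline : LipschitzWith 1 fun s : ℝ => c.foot z + s • c.dir := by
    refine LipschitzWith.of_dist_le_mul fun s t => ?_
    rw [dist_add_left, dist_eq_norm, ← sub_smul, norm_smul, c.norm_dir, mul_one,
      NNReal.coe_one, one_mul, ← dist_eq_norm]
  refine (enorm_sub_le_lintegral_deriv (hG.comp hline) hab).trans (le_of_eq ?_)
  refine lintegral_congr fun s => ?_
  congr 1
  rw [lineDeriv]
  have h : ∀ t, (G ∘ fun s : ℝ => c.foot z + s • c.dir) (s + t)
      = G (c.foot z + s • c.dir + t • c.dir) := fun t => by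
    simp only [Function.comp_apply, add_smul, add_assoc]
  rw [← funext h, deriv_comp_const_add, add_zero]

theorem measurable_lineDeriv_of_lipschitz {G : EuclideanSpace ℝ (Fin d) → ℝ} {K : NNReal}
    (hG : LipschitzWith K G) (v : EuclideanSpace ℝ (Fin d)) :
    Measurable fun y => ‖lineDeriv ℝ G y v‖ₑ :=
  (measurable_lineDeriv hG.continuous).enorm

theorem lintegral_lineDeriv_eq_fderiv {G : EuclideanSpace ℝ (Fin d) → ℝ} {K : NNReal}
    (hG : LipschitzWith K G) (v : EuclideanSpace ℝ (Fin d))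
    (S : Set (EuclideanSpace ℝ (Fin d))) :
    ∫⁻ y in S, ‖lineDeriv ℝ G y v‖ₑ = ∫⁻ y in S, ‖fderiv ℝ G y v‖ₑ := by
  refine lintegral_congr_ae (ae_restrict_of_ae ?_)
  filter_upwards [hG.ae_differentiableAt] with y hy
  rw [hy.lineDeriv_eq_fderiv]

/-- The one-sided trace estimate in a chart. -/
theorem exists_lintegral_foot_le_above : ∃ C : ENNReal, C ≠ ⊤ ∧
    ∀ (G : EuclideanSpace ℝ (Fin d) → ℝ) (K : NNReal), LipschitzWith K G → HasCompactSupport G →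
      ∫⁻ z : c.hyperplane, ‖G (c.foot z)‖ₑ ∂c.area
        ≤ C * ∫⁻ y in {y | 0 < c.height y}, ‖fderiv ℝ G y c.dir‖ₑ := by
  obtain ⟨C, hC0, hCt, hC⟩ := c.exists_lintegral_eq
  refine ⟨C⁻¹, ENNReal.inv_ne_top.2 hC0, fun G K hG hc => ?_⟩
  rw [← lintegral_lineDeriv_eq_fderiv hG,
    show {y | 0 < c.height y} = c.height ⁻¹' Ioi 0 from rfl,
    hC _ measurableSet_Ioi _ (measurable_lineDeriv_of_lipschitz hG _), ← mul_assoc,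
    ENNReal.inv_mul_cancel hC0 hCt, one_mul]
  refine lintegral_mono fun z => ?_
  obtain ⟨R, hR⟩ := hc.isCompact.isBounded.subset_closedBall 0
  -- A height at which the line has left the support of G, so that the value on the graph is the
  -- integral of the derivative above it.
  set R' := max 0 (R + ‖c.foot z‖ + 1)
  have hz : G (c.foot z + R' • c.dir) = 0 := by
    refine image_eq_zero_of_notMem_tsupport fun hmem => ?_
    have h1 := hR hmem
    rw [mem_closedBall_zero_iff] at h1
    have h2 : ‖R' • c.dir‖ ≤ ‖c.foot z + R' • c.dir‖ + ‖c.foot z‖ := by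
      simpa using norm_sub_le (c.foot z + R' • c.dir) (c.foot z)
    rw [norm_smul, c.norm_dir, mul_one, Real.norm_eq_abs] at h2
    have h3 : R + ‖c.foot z‖ + 1 ≤ |R'| := (le_max_right _ _).trans (le_abs_self _)
    linarith
  have h := c.enorm_sub_foot_le hG z (le_max_left 0 (R + ‖c.foot z‖ + 1))
  rw [hz, zero_sub, enorm_neg, zero_smul, add_zero] at h
  exact h.trans (lintegral_mono_set Ioc_subset_Ioi_self)

/-- A Lipschitz cutoff, equal to `1` below height `-ε` and to `0` above the graph. -/
def cutoff (ε : ℝ) (y : EuclideanSpace ℝ (Fin d)) : ℝ := max 0 (min 1 (-(c.height y) / ε))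

theorem cutoff_lipschitz {ε : ℝ} (hε : 0 < ε) : LipschitzWith (c.lip / ε.toNNReal) (c.cutoff ε) := by
  have h : LipschitzWith (c.lip / ε.toNNReal) fun y => -(c.height y) / ε := by
    refine LipschitzWith.of_dist_le_mul fun x y => ?_
    have h1 := c.lipschitz.dist_le_mul x y
    rw [Real.dist_eq] at h1 ⊢
    rw [← sub_div, abs_div, abs_of_pos hε, NNReal.coe_div, Real.coe_toNNReal _ hε.le, div_mul_eq_mul_div]
    gcongr
    rwa [← abs_neg, neg_sub_neg, neg_sub]
  exact (h.const_min 1).const_max 0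

theorem cutoff_nonneg (ε : ℝ) (y : EuclideanSpace ℝ (Fin d)) : 0 ≤ c.cutoff ε y := le_max_left _ _

theorem cutoff_le_one (ε : ℝ) (y : EuclideanSpace ℝ (Fin d)) : c.cutoff ε y ≤ 1 :=
  max_le zero_le_one (min_le_left _ _)

theorem cutoff_of_nonneg {ε : ℝ} (hε : 0 < ε) {y : EuclideanSpace ℝ (Fin d)}
    (h : 0 ≤ c.height y) : c.cutoff ε y = 0 := by
  refine max_eq_left ((min_le_right _ _).trans ?_)
  exact div_nonpos_of_nonpos_of_nonneg (by linarith) hε.le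

theorem cutoff_of_le {ε : ℝ} (hε : 0 < ε) {y : EuclideanSpace ℝ (Fin d)}
    (h : c.height y ≤ -ε) : c.cutoff ε y = 1 := by
  have : 1 ≤ -(c.height y) / ε := by rw [le_div_iff₀ hε]; linarith
  rw [cutoff, min_eq_left this, max_eq_right zero_le_one]

theorem enorm_fderiv_cutoff_le {ε : ℝ} (hε : 0 < ε) (v y : EuclideanSpace ℝ (Fin d)) :
    ‖fderiv ℝ (c.cutoff ε) y v‖ₑ ≤ (c.height ⁻¹' Icc (-ε) 0).indicator
      (fun _ => ENNReal.ofReal (c.lip * ‖v‖ / ε)) y := by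
  by_cases hy : y ∈ c.height ⁻¹' Icc (-ε) 0
  · rw [indicator_of_mem hy, ← ofReal_norm]
    refine ENNReal.ofReal_le_ofReal ((norm_fderiv_apply_le_of_lipschitz
      (c.cutoff_lipschitz hε) y v).trans (le_of_eq ?_))
    rw [NNReal.coe_div, Real.coe_toNNReal _ hε.le]
    ring
  · rw [indicator_of_notMem hy]
    have hcst : ∃ a : ℝ, c.cutoff ε =ᶠ[𝓝 y] fun _ => a := by
      rw [mem_preimage, mem_Icc, not_and_or, not_le, not_le] at hy
      rcases hy with hy | hy
      · refine ⟨1, ?_⟩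
        filter_upwards [c.continuous_height.continuousAt.eventually (Iio_mem_nhds hy)] with x hx
        exact c.cutoff_of_le hε (le_of_lt hx)
      · refine ⟨0, ?_⟩
        filter_upwards [c.continuous_height.continuousAt.eventually (Ioi_mem_nhds hy)] with x hx
        exact c.cutoff_of_nonneg hε (le_of_lt hx)
    obtain ⟨a, ha⟩ := hcst
    rw [ha.fderiv_eq]
    simp

theorem measurableSet_strip (ε : ℝ) : MeasurableSet (c.height ⁻¹' Icc (-ε) 0) :=
  c.continuous_height.measurable measurableSet_Icc

/-- The derivative of G times the cutoff has integral zero, so the derivative is moved onto the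
cutoff, where it is of size 1/ε and lives in the strip of width ε below the graph. -/
theorem enorm_integral_fderiv_mul_cutoff_le {G : EuclideanSpace ℝ (Fin d) → ℝ} {K : NNReal}
    (hG : LipschitzWith K G) (hc : HasCompactSupport G) {ε : ℝ} (hε : 0 < ε)
    (v : EuclideanSpace ℝ (Fin d)) :
    ‖∫ y, fderiv ℝ G y v * c.cutoff ε y‖ₑ
      ≤ ENNReal.ofReal (c.lip * ‖v‖ / ε) * ∫⁻ y in c.height ⁻¹' Icc (-ε) 0, ‖G y‖ₑ := by
  have hb : BddLip G := ⟨⟨K, hG⟩, hG.continuous.bounded_above_of_compact_support hc⟩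
  have hθ : BddLip (c.cutoff ε) := ⟨⟨_, c.cutoff_lipschitz hε⟩, 1, fun y => by
    rw [Real.norm_eq_abs, abs_of_nonneg (c.cutoff_nonneg ε y)]; exact c.cutoff_le_one ε y⟩
  obtain ⟨⟨L, hL⟩, -⟩ := hb.mul hθ
  have h0 := integral_fderiv_eq_zero (ν := volume) hL (hc.mul_right (f' := c.cutoff ε)) v
  have hi1 : Integrable fun y => fderiv ℝ G y v * c.cutoff ε y :=
    (integrable_fderiv_apply hG hc v).mul_bdd (c := 1) hθ.continuous.aestronglyMeasurable
      (Eventually.of_forall hθ.2.choose_spec |>.mono fun y _ => by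
        rw [Real.norm_eq_abs, abs_of_nonneg (c.cutoff_nonneg ε y)]; exact c.cutoff_le_one ε y)
  have hi2 : Integrable fun y => G y * fderiv ℝ (c.cutoff ε) y v := by
    refine (hG.continuous.integrable_of_hasCompactSupport hc).mul_bdd
      (c := (c.lip / ε.toNNReal : NNReal) * ‖v‖)
      (measurable_fderiv_apply_const ℝ (c.cutoff ε) v).aestronglyMeasurable ?_
    exact Eventually.of_forall fun y => norm_fderiv_apply_le_of_lipschitz (c.cutoff_lipschitz hε) y v
  have h1 : ∫ y, fderiv ℝ (fun x => G x * c.cutoff ε x) y v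
      = (∫ y, fderiv ℝ G y v * c.cutoff ε y) + ∫ y, G y * fderiv ℝ (c.cutoff ε) y v := by
    rw [← integral_add hi1 hi2]
    refine integral_congr_ae ?_
    filter_upwards [hG.ae_differentiableAt, (c.cutoff_lipschitz hε).ae_differentiableAt]
      with y h1 h2
    rw [fderiv_fun_mul h1 h2]
    simp only [_root_.add_apply, _root_.smul_apply, smul_eq_mul]
    ring
  have h2 : ∫ y, fderiv ℝ G y v * c.cutoff ε y = -∫ y, G y * fderiv ℝ (c.cutoff ε) y v := by
    linarith [h0.symm.trans h1]
  rw [h2, enorm_neg]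
  refine (enorm_integral_le_lintegral_enorm _).trans ?_
  rw [← lintegral_const_mul' _ _ ENNReal.ofReal_ne_top,
    ← lintegral_indicator (c.measurableSet_strip ε)]
  refine lintegral_mono fun y => ?_
  rw [enorm_mul]
  refine (mul_le_mul_right (c.enorm_fderiv_cutoff_le hε v y) ‖G y‖ₑ).trans (le_of_eq ?_)
  by_cases hy : y ∈ c.height ⁻¹' Icc (-ε) 0
  · rw [indicator_of_mem hy, indicator_of_mem hy, mul_comm]
  · rw [indicator_of_notMem hy, indicator_of_notMem hy, mul_zero]

/-- Green's estimate below a graph. -/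
theorem exists_enorm_integral_fderiv_below_le : ∃ C : ENNReal, C ≠ ⊤ ∧
    ∀ (G : EuclideanSpace ℝ (Fin d) → ℝ) (K : NNReal), LipschitzWith K G → HasCompactSupport G →
      ∀ v, ‖∫ y in {y | c.height y < 0}, fderiv ℝ G y v‖ₑ
        ≤ C * ENNReal.ofReal ‖v‖ * ∫⁻ z : c.hyperplane, ‖G (c.foot z)‖ₑ ∂c.area := by
  obtain ⟨C, hC0, hCt, hC⟩ := c.exists_lintegral_eq
  refine ⟨c.lip * C, ENNReal.mul_ne_top ENNReal.coe_ne_top hCt, fun G K hG hc v => ?_⟩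
  have hGm : Measurable fun y => ‖G y‖ₑ := hG.continuous.measurable.enorm
  -- In the strip |G| is at most its value on the graph plus the derivative integrated over the
  -- strip. The factor ε gained here cancels the 1/ε from the cutoff.
  have hstrip : ∀ ε : ℝ, 0 < ε → ∫⁻ y in c.height ⁻¹' Icc (-ε) 0, ‖G y‖ₑ
      ≤ ENNReal.ofReal ε * (C * ∫⁻ z : c.hyperplane, ‖G (c.foot z)‖ₑ ∂c.area
        + ∫⁻ y in c.height ⁻¹' Icc (-ε) 0, ‖fderiv ℝ G y c.dir‖ₑ) := by
    intro ε hε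
    have hfm : Measurable fun z : c.hyperplane => ‖G (c.foot z)‖ₑ :=
      hGm.comp (c.foot_lipschitz.continuous.comp continuous_subtype_val).measurable
    rw [← lintegral_lineDeriv_eq_fderiv hG, hC _ measurableSet_Icc _ hGm,
      hC _ measurableSet_Icc _ (measurable_lineDeriv_of_lipschitz hG _), ← mul_add,
      mul_left_comm, ← lintegral_add_left hfm, ← lintegral_const_mul' _ _ ENNReal.ofReal_ne_top]
    gcongr with z
    have hpt : ∀ s ∈ Icc (-ε) 0, ‖G (c.foot z + s • c.dir)‖ₑ ≤ ‖G (c.foot z)‖ₑ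
        + ∫⁻ s in Icc (-ε) 0, ‖lineDeriv ℝ G (c.foot z + s • c.dir) c.dir‖ₑ := by
      intro s hs
      have h1 := c.enorm_sub_foot_le hG z hs.2
      rw [zero_smul, add_zero] at h1
      have h2 : G (c.foot z + s • c.dir)
          = G (c.foot z) - (G (c.foot z) - G (c.foot z + s • c.dir)) := by ring
      rw [h2]
      refine (enorm_sub_le).trans ?_
      gcongr
      refine h1.trans (lintegral_mono_set fun t ht => ⟨hs.1.trans ht.1.le, ht.2⟩)
    refine (setLIntegral_mono' measurableSet_Icc hpt).trans (le_of_eq ?_)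
    rw [setLIntegral_const, Real.volume_Icc, sub_neg_eq_add, zero_add, mul_comm]
  set I := ∫⁻ z : c.hyperplane, ‖G (c.foot z)‖ₑ ∂c.area
  let ε : ℕ → ℝ := fun n => 1 / ((n : ℝ) + 1)
  have hε : ∀ n, 0 < ε n := fun n => Nat.one_div_pos_of_nat
  have hε0 : Tendsto ε atTop (𝓝 0) := tendsto_one_div_add_atTop_nhds_zero_nat
  have hbound : ∀ n, ‖∫ y, fderiv ℝ G y v * c.cutoff (ε n) y‖ₑ
      ≤ ENNReal.ofReal (c.lip * ‖v‖) * (C * I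
        + ∫⁻ y in c.height ⁻¹' Icc (-(ε n)) 0, ‖fderiv ℝ G y c.dir‖ₑ) := by
    intro n
    refine (c.enorm_integral_fderiv_mul_cutoff_le hG hc (hε n) v).trans ?_
    refine (mul_le_mul_right (hstrip _ (hε n)) _).trans (le_of_eq ?_)
    rw [← mul_assoc, ← ENNReal.ofReal_mul (by have := hε n; positivity),
      div_mul_cancel₀ _ (hε n).ne']
  have hlim1 : Tendsto (fun n => ‖∫ y, fderiv ℝ G y v * c.cutoff (ε n) y‖ₑ) atTop
      (𝓝 ‖∫ y in {y | c.height y < 0}, fderiv ℝ G y v‖ₑ) := by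
    have hm : MeasurableSet {y | c.height y < 0} :=
      c.continuous_height.measurable measurableSet_Iio
    rw [← integral_indicator hm]
    refine (continuous_enorm.tendsto _).comp ?_
    refine tendsto_integral_of_dominated_convergence (fun y => ‖fderiv ℝ G y v‖) (fun n => ?_)
      (integrable_fderiv_apply hG hc v).norm (fun n => Eventually.of_forall fun y => ?_)
      (Eventually.of_forall fun y => ?_)
    · exact (measurable_fderiv_apply_const ℝ G v).aestronglyMeasurable.mul
        (c.cutoff_lipschitz (hε n)).continuous.aestronglyMeasurable
    · rw [norm_mul]
      refine mul_le_of_le_one_right (norm_nonneg _) ?_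
      rw [Real.norm_eq_abs, abs_of_nonneg (c.cutoff_nonneg _ y)]
      exact c.cutoff_le_one _ y
    · by_cases hy : c.height y < 0
      · rw [indicator_of_mem (by exact hy)]
        refine tendsto_const_nhds.congr' ?_
        filter_upwards [hε0.eventually (gt_mem_nhds (show (0 : ℝ) < -c.height y by linarith))]
          with n hn
        rw [c.cutoff_of_le (hε n) (by linarith), mul_one]
      · rw [indicator_of_notMem (by exact hy)]
        refine tendsto_const_nhds.congr fun n => ?_
        rw [c.cutoff_of_nonneg (hε n) (not_lt.1 hy), mul_zero]
  -- The strips shrink to the graph, which has volume zero, so the derivative contributes nothing in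
  -- the limit.
  have hlim2 : Tendsto (fun n => ∫⁻ y in c.height ⁻¹' Icc (-(ε n)) 0, ‖fderiv ℝ G y c.dir‖ₑ) atTop
      (𝓝 0) := by
    have h0 : (0 : ENNReal) = ∫⁻ y : EuclideanSpace ℝ (Fin d), 0 := by simp
    rw [h0]
    simp_rw [← lintegral_indicator (c.measurableSet_strip _)]
    have hmeas : Measurable fun y => ‖fderiv ℝ G y c.dir‖ₑ :=
      (measurable_fderiv_apply_const ℝ G c.dir).enorm
    refine tendsto_lintegral_of_dominated_convergence (fun y => ‖fderiv ℝ G y c.dir‖ₑ)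
      (fun n => hmeas.indicator (c.measurableSet_strip _))
      (fun n => Eventually.of_forall fun y => indicator_le_self _ _ _)
      (integrable_fderiv_apply hG hc c.dir).2.ne ?_
    have hne : ∀ᵐ y, c.height y ≠ 0 := by
      rw [ae_iff]
      simpa using c.volume_height_zero
    filter_upwards [hne] with y hy
    refine tendsto_const_nhds.congr' ?_
    filter_upwards [hε0.eventually (gt_mem_nhds (abs_pos.2 hy))] with n hn
    rw [indicator_of_notMem]
    rintro ⟨h1, h2⟩
    rw [abs_of_nonpos h2] at hn
    linarith
  have hlim3 : Tendsto (fun n => ENNReal.ofReal (c.lip * ‖v‖) * (C * I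
      + ∫⁻ y in c.height ⁻¹' Icc (-(ε n)) 0, ‖fderiv ℝ G y c.dir‖ₑ)) atTop
      (𝓝 (ENNReal.ofReal (c.lip * ‖v‖) * (C * I + 0))) :=
    ENNReal.Tendsto.const_mul (tendsto_const_nhds.add hlim2) (Or.inr ENNReal.ofReal_ne_top)
  refine (le_of_tendsto_of_tendsto' hlim1 hlim3 hbound).trans (le_of_eq ?_)
  rw [add_zero, ENNReal.ofReal_mul (NNReal.coe_nonneg _), ENNReal.ofReal_coe_nnreal]
  ring

end GraphChart

/-! ### The unit cell and the torus -/

section Cell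

variable {d : ℕ}

theorem isOpen_cell : IsOpen (cell d) := by
  have : cell d = ⋂ i, {y : EuclideanSpace ℝ (Fin d) | -(1 / 2 : ℝ) < y i ∧ y i < 1 / 2} := by
    ext y; simp [cell]
  rw [this]
  refine isOpen_iInter_of_finite fun i => ?_
  have hc : Continuous fun y : EuclideanSpace ℝ (Fin d) => y i := by fun_prop
  exact isOpen_Ioo.preimage hc

theorem measurableSet_cell : MeasurableSet (cell d) := isOpen_cell.measurableSet

theorem cell_subset_closedCell :
    cell d ⊆ {y : EuclideanSpace ℝ (Fin d) | ∀ i, y i ∈ Icc (-(1 / 2 : ℝ)) (1 / 2)} :=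
  fun _ hy i => ⟨(hy i).1.le, (hy i).2.le⟩

theorem isBounded_cell : Bornology.IsBounded (cell d) :=
  (isCompact_closedCell d).isBounded.subset cell_subset_closedCell

theorem convex_cell : Convex ℝ (cell d) := by
  intro x hx y hy a b ha hb hab i
  have h1 := hx i
  have h2 := hy i
  simp only [PiLp.add_apply, PiLp.smul_apply, smul_eq_mul]
  have h := (convex_Ioo (-(1 / 2 : ℝ)) (1 / 2)) h1 h2 ha hb hab
  exact h

theorem zero_mem_cell : (0 : EuclideanSpace ℝ (Fin d)) ∈ cell d := fun i => by simp

instance : IsFiniteMeasure ((volume : Measure (EuclideanSpace ℝ (Fin d))).restrict (cell d)) :=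
  ⟨by rw [Measure.restrict_apply_univ]; exact isBounded_cell.measure_lt_top⟩

-- The cell as a fundamental domain of the torus, translation invariance and Fourier uniqueness.

attribute [local instance] instMeasureSpaceUnitAddCircle

local instance : (volume : Measure UnitAddCircle).IsAddHaarMeasure :=
  inferInstanceAs (AddCircle.haarAddCircle (T := 1)).IsAddHaarMeasure

/-- The covering map of the torus. -/
def toTorus (y : EuclideanSpace ℝ (Fin d)) : UnitAddTorus (Fin d) := fun i => (y i : UnitAddCircle)

/-- The representative in the (half-closed) unit cell of a point of the torus. -/
def ofTorus (x : UnitAddTorus (Fin d)) : EuclideanSpace ℝ (Fin d) :=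
  WithLp.toLp 2 fun i => (AddCircle.equivIoc 1 (-(1 / 2 : ℝ)) (x i) : ℝ)

theorem measurable_ofTorus : Measurable (ofTorus (d := d)) := by
  refine (PiLp.continuous_toLp 2 _).measurable.comp (measurable_pi_lambda _ fun i => ?_)
  exact measurable_subtype_coe.comp
    ((AddCircle.measurableEquivIoc 1 (-(1 / 2 : ℝ))).measurable.comp (measurable_pi_apply i))

theorem ofTorus_toTorus {y : EuclideanSpace ℝ (Fin d)} (hy : y ∈ cell d) :
    ofTorus (toTorus y) = y := by
  ext i
  have hi : y i ∈ Ioc (-(1 / 2 : ℝ)) (-(1 / 2) + 1) := ⟨(hy i).1, by linarith [(hy i).2]⟩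
  exact AddCircle.equivIoc_coe_of_mem hi

theorem IsPeriodic.apply_ofTorus_toTorus {F : Type*} {f : EuclideanSpace ℝ (Fin d) → F}
    (hf : IsPeriodic f) (y : EuclideanSpace ℝ (Fin d)) : f (ofTorus (toTorus y)) = f y := by
  have h : ∀ i, ∃ n : ℤ, ofTorus (toTorus y) i = y i + n := by
    intro i
    have h1 : ((ofTorus (toTorus y) i : ℝ) : UnitAddCircle) = (y i : UnitAddCircle) :=
      (AddCircle.equivIoc 1 (-(1 / 2 : ℝ))).symm_apply_apply (toTorus y i)
    rw [← sub_eq_zero, ← AddCircle.coe_sub, AddCircle.coe_eq_zero_iff] at h1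
    obtain ⟨n, hn⟩ := h1
    refine ⟨n, ?_⟩
    rw [zsmul_eq_mul, mul_one] at hn
    linarith
  choose n hn using h
  have h2 : ofTorus (toTorus y) = y + latticeVec n := by
    ext i
    simpa [latticeVec] using hn i
  rw [h2, hf]

theorem cell_ae_eq : (WithLp.ofLp : EuclideanSpace ℝ (Fin d) → Fin d → ℝ) ⁻¹'
    {x : Fin d → ℝ | ∀ i, x i ∈ Ioc (-(1 / 2 : ℝ)) (-(1 / 2) + 1)} =ᵐ[volume] cell d := by
  have h1 : (univ.pi fun _ : Fin d => Ioc (-(1 / 2 : ℝ)) (-(1 / 2) + 1)) =ᵐ[volume]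
      (univ.pi fun _ : Fin d => Ioo (-(1 / 2 : ℝ)) (-(1 / 2) + 1)) :=
    Measure.univ_pi_Ioc_ae_eq_Icc.trans Measure.univ_pi_Ioo_ae_eq_Icc.symm
  have h2 := (PiLp.volume_preserving_ofLp (Fin d)).quasiMeasurePreserving.preimage_ae_eq h1
  have e1 : {x : Fin d → ℝ | ∀ i, x i ∈ Ioc (-(1 / 2 : ℝ)) (-(1 / 2) + 1)}
      = univ.pi fun _ : Fin d => Ioc (-(1 / 2 : ℝ)) (-(1 / 2) + 1) := by
    ext x; simp only [mem_ofPred_eq, mem_univ_pi]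
  have e2 : cell d = (WithLp.ofLp : EuclideanSpace ℝ (Fin d) → Fin d → ℝ) ⁻¹'
      (univ.pi fun _ : Fin d => Ioo (-(1 / 2 : ℝ)) (-(1 / 2) + 1)) := by
    ext y
    have : (-(1 / 2) + 1 : ℝ) = 1 / 2 := by norm_num
    simp only [cell, mem_preimage, mem_univ_pi, this, mem_Ioo, mem_ofPred_eq]
  rw [e1, e2]
  exact h2

theorem integral_torus {F : Type*} [NormedAddCommGroup F] [NormedSpace ℝ F]
    (f : UnitAddTorus (Fin d) → F) : ∫ x, f x = ∫ y in cell d, f (toTorus y) := by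
  rw [UnitAddTorus.integral_preimage f (fun _ => -(1 / 2 : ℝ)), ← setIntegral_congr_set cell_ae_eq]
  exact ((PiLp.volume_preserving_ofLp (Fin d)).setIntegral_preimage_emb
    (MeasurableEquiv.toLp 2 (Fin d → ℝ)).symm.measurableEmbedding _ _).symm

theorem lintegral_torus (f : UnitAddTorus (Fin d) → ENNReal) :
    ∫⁻ x, f x = ∫⁻ y in cell d, f (toTorus y) := by
  rw [UnitAddTorus.lintegral_preimage f (fun _ => -(1 / 2 : ℝ)),
    ← setLIntegral_congr cell_ae_eq]
  exact ((PiLp.volume_preserving_ofLp (Fin d)).setLIntegral_comp_preimage_emb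
    (MeasurableEquiv.toLp 2 (Fin d → ℝ)).symm.measurableEmbedding _ _).symm

/-- Transferred to the torus, this is the invariance of Haar measure under translation. -/
theorem IsPeriodic.integral_cell_add {F : Type*} [NormedAddCommGroup F] [NormedSpace ℝ F]
    {f : EuclideanSpace ℝ (Fin d) → F} (hf : IsPeriodic f) (w : EuclideanSpace ℝ (Fin d)) :
    ∫ y in cell d, f (y + w) = ∫ y in cell d, f y := by
  have h1 : ∀ y, f (y + w) = f (ofTorus (toTorus y + toTorus w)) := fun y => by
    rw [← hf.apply_ofTorus_toTorus (y + w)]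
    rfl
  have h2 : ∀ y, f y = f (ofTorus (toTorus y)) := fun y => (hf.apply_ofTorus_toTorus y).symm
  simp_rw [h1]
  rw [← integral_torus fun x => f (ofTorus (x + toTorus w))]
  rw [integral_congr_ae (Eventually.of_forall h2)]
  rw [← integral_torus fun x => f (ofTorus x)]
  exact integral_add_right_eq_self (fun x => f (ofTorus x)) _

/-- Translation invariance makes every difference quotient integrate to zero; the Lipschitz bound
dominates the quotients and Rademacher's theorem identifies their limit. -/
theorem IsPeriodic.integral_fderiv_eq_zero {f : EuclideanSpace ℝ (Fin d) → ℝ} (hf : IsPeriodic f)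
    (hL : BddLip f) (v : EuclideanSpace ℝ (Fin d)) : ∫ y in cell d, fderiv ℝ f y v = 0 := by
  obtain ⟨⟨K, hK⟩, C, hC⟩ := hL
  have hint : ∀ w, Integrable (fun y => f (y + w)) (volume.restrict (cell d)) := fun w =>
    Integrable.of_bound (hK.continuous.comp (continuous_id.add continuous_const)).aestronglyMeasurable
      C (Eventually.of_forall fun y => hC _)
  let ε : ℕ → ℝ := fun n => 1 / ((n : ℝ) + 1)
  have hε : ∀ n, 0 < ε n := fun n => Nat.one_div_pos_of_nat
  have hε0 : Tendsto ε atTop (𝓝[≠] 0) := tendsto_nhdsWithin_iff.2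
    ⟨tendsto_one_div_add_atTop_nhds_zero_nat, Eventually.of_forall fun n => (hε n).ne'⟩
  have hzero : ∀ n, ∫ y in cell d, (ε n)⁻¹ • (f (y + ε n • v) - f y) = 0 := fun n => by
    rw [integral_smul, integral_sub (hint _) (by simpa using hint 0), hf.integral_cell_add, sub_self,
      smul_zero]
  have hlim : Tendsto (fun n => ∫ y in cell d, (ε n)⁻¹ • (f (y + ε n • v) - f y)) atTop
      (𝓝 (∫ y in cell d, fderiv ℝ f y v)) := by
    refine tendsto_integral_of_dominated_convergence (fun _ => K * ‖v‖) (fun n => ?_)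
      (integrable_const _) (fun n => Eventually.of_forall fun y => ?_) ?_
    · have := hK.continuous
      exact Continuous.aestronglyMeasurable (by fun_prop)
    · rw [norm_smul, norm_inv, Real.norm_eq_abs, abs_of_pos (hε n), inv_mul_le_iff₀ (hε n)]
      have h1 := hK.dist_le_mul (y + ε n • v) y
      rw [dist_eq_norm, dist_eq_norm, add_sub_cancel_left, norm_smul, Real.norm_eq_abs (ε n),
        abs_of_pos (hε n)] at h1
      linarith
    · filter_upwards [ae_restrict_of_ae hK.ae_differentiableAt] with y hy
      exact (hy.hasFDerivAt.hasLineDerivAt v).tendsto_slope_zero.comp hε0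
  simp_rw [hzero] at hlim
  exact tendsto_nhds_unique hlim tendsto_const_nhds

theorem IsPeriodic.exists_bound {F : Type*} [NormedAddCommGroup F]
    {f : EuclideanSpace ℝ (Fin d) → F} (hf : IsPeriodic f) (hc : Continuous f) :
    ∃ C : ℝ, ∀ y, ‖f y‖ ≤ C := by
  obtain ⟨C, hC⟩ := (isCompact_closedCell d).exists_bound_of_continuousOn hc.continuousOn
  refine ⟨C, fun y => ?_⟩
  rw [← hf.apply_ofTorus_toTorus y]
  refine hC _ fun i => ?_
  have := (AddCircle.equivIoc 1 (-(1 / 2 : ℝ)) (toTorus y i)).2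
  exact ⟨this.1.le, this.2.trans (by norm_num)⟩

theorem IsPeriodic.fderiv {F : Type*} [NormedAddCommGroup F] [NormedSpace ℝ F]
    {f : EuclideanSpace ℝ (Fin d) → F} (hf : IsPeriodic f) : IsPeriodic (fderiv ℝ f) := by
  intro y n
  have h : (fun x => f (x + latticeVec n)) = f := funext fun x => hf x n
  rw [← fderiv_comp_add_right, h]

theorem IsPeriodic.pderiv {F : Type*} [NormedAddCommGroup F] [NormedSpace ℝ F]
    {f : EuclideanSpace ℝ (Fin d) → F} (hf : IsPeriodic f) (i : Fin d) :
    IsPeriodic (PeriodicLayer.pderiv f i) := fun y n => by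
  rw [PeriodicLayer.pderiv, PeriodicLayer.pderiv, hf.fderiv y n]

theorem IsPeriodic.bddLip {F : Type*} [NormedAddCommGroup F] [NormedSpace ℝ F]
    {f : EuclideanSpace ℝ (Fin d) → F} (hf : IsPeriodic f) (hc : ContDiff ℝ (⊤ : ℕ∞) f) :
    BddLip f := by
  refine ⟨?_, hf.exists_bound hc.continuous⟩
  obtain ⟨C, hC⟩ := hf.fderiv.exists_bound (hc.continuous_fderiv (by simp))
  refine ⟨C.toNNReal, lipschitzWith_of_nnnorm_fderiv_le (hc.differentiable (by simp)) fun y => ?_⟩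
  rw [← NNReal.coe_le_coe, coe_nnnorm]
  exact (hC y).trans (Real.le_coe_toNNReal C)

/-- The exponentials form a Hilbert basis of L^2 of the torus. The function is pulled back by the
cell representative, and its complex coefficients are assembled from the cosine and sine integrals.
-/
theorem ae_eq_zero_of_fourier_eq_zero {u : EuclideanSpace ℝ (Fin d) → ℝ} (hu : Measurable u)
    (hu2 : MemLp u 2 (volume.restrict (cell d)))
    (hcos : ∀ n : Fin d → ℤ, ∫ y in cell d, u y * Real.cos (2 * Real.pi * ∑ i, n i * y i) = 0)
    (hsin : ∀ n : Fin d → ℤ, ∫ y in cell d, u y * Real.sin (2 * Real.pi * ∑ i, n i * y i) = 0) :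
    ∀ᵐ y ∂volume.restrict (cell d), u y = 0 := by
  let g : UnitAddTorus (Fin d) → ℂ := fun x => (u (ofTorus x) : ℂ)
  have hgm : Measurable g := Complex.measurable_ofReal.comp (hu.comp measurable_ofTorus)
  have hge : ∀ y ∈ cell d, g (toTorus y) = u y := fun y hy => by
    simp only [g, ofTorus_toTorus hy]
  have hg2 : MemLp g 2 volume := by
    refine ⟨hgm.aestronglyMeasurable, ?_⟩
    rw [eLpNorm_lt_top_iff_lintegral_rpow_enorm_lt_top (by norm_num) (by norm_num),
      lintegral_torus]
    have := (eLpNorm_lt_top_iff_lintegral_rpow_enorm_lt_top (by norm_num) (by norm_num)).1 hu2.2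
    refine lt_of_eq_of_lt (setLIntegral_congr_fun measurableSet_cell fun y hy => ?_) this
    simp only [hge y hy]
    congr 1
    rw [← ofReal_norm, ← ofReal_norm, Complex.norm_real]
  have hcoef : ∀ n, UnitAddTorus.mFourierCoeff g n = 0 := by
    intro n
    rw [UnitAddTorus.mFourierCoeff, integral_torus]
    have hexp : ∀ y ∈ cell d, UnitAddTorus.mFourier (-n) (toTorus y) • g (toTorus y)
        = ((u y * Real.cos (2 * Real.pi * ∑ i, n i * y i) : ℝ) : ℂ)
          - ((u y * Real.sin (2 * Real.pi * ∑ i, n i * y i) : ℝ) : ℂ) * Complex.I := by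
      intro y hy
      have h1 : UnitAddTorus.mFourier (-n) (toTorus y)
          = Complex.exp (((-(2 * Real.pi * ∑ i, n i * y i) : ℝ) : ℂ) * Complex.I) := by
        simp only [UnitAddTorus.mFourier, ContinuousMap.coe_mk, toTorus, fourier_coe_apply]
        rw [← Complex.exp_sum]
        congr 1
        push_cast
        rw [Finset.mul_sum, ← Finset.sum_neg_distrib, Finset.sum_mul]
        refine Finset.sum_congr rfl fun i _ => ?_
        simp only [Pi.neg_apply, Int.cast_neg]
        ring
      rw [hge y hy, h1, Complex.exp_mul_I, ← Complex.ofReal_cos, ← Complex.ofReal_sin, Real.cos_neg,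
        Real.sin_neg, smul_eq_mul]
      push_cast
      ring
    rw [setIntegral_congr_fun measurableSet_cell hexp]
    have hui : Integrable u (volume.restrict (cell d)) := hu2.integrable (by norm_num)
    have hi : ∀ k : ℝ → ℝ, Continuous k → (∀ t, |k t| ≤ 1) →
        Integrable (fun y => u y * k (2 * Real.pi * ∑ i, n i * y i)) (volume.restrict (cell d)) := by
      intro k hk hk1
      refine hui.mul_bdd (c := 1) (Continuous.aestronglyMeasurable ?_)
        (Eventually.of_forall fun y => hk1 _)
      exact hk.comp (by fun_prop)
    rw [integral_sub (hi _ Real.continuous_cos Real.abs_cos_le_one).ofReal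
      ((hi _ Real.continuous_sin Real.abs_sin_le_one).ofReal.mul_const _), integral_mul_const,
      integral_complex_ofReal, integral_complex_ofReal, hcos n, hsin n]
    simp
  have hrepr : UnitAddTorus.mFourierBasis.repr (hg2.toLp g) = 0 := by
    ext n
    rw [UnitAddTorus.mFourierBasis_repr]
    have : UnitAddTorus.mFourierCoeff (hg2.toLp g) n = UnitAddTorus.mFourierCoeff g n := by
      rw [UnitAddTorus.mFourierCoeff, UnitAddTorus.mFourierCoeff]
      refine integral_congr_ae ?_
      filter_upwards [hg2.coeFn_toLp] with x hx
      rw [hx]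
    rw [this, hcoef n]
    rfl
  have hzero : hg2.toLp g = 0 := by
    simpa using hrepr
  have hae : g =ᵐ[volume] 0 := by
    have h1 := hg2.coeFn_toLp
    rw [hzero] at h1
    exact h1.symm.trans (Lp.coeFn_zero _ _ _)
  have hl : ∫⁻ x, ‖g x‖ₑ = 0 := (lintegral_eq_zero_iff hgm.enorm).2 (by
    filter_upwards [hae] with x hx
    simp [hx])
  rw [lintegral_torus] at hl
  have hl2 : ∫⁻ y in cell d, ‖u y‖ₑ = 0 := by
    rw [← hl]
    refine setLIntegral_congr_fun measurableSet_cell fun y hy => ?_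
    simp only [hge y hy]
    rw [← ofReal_norm, ← ofReal_norm, Complex.norm_real]
  filter_upwards [(lintegral_eq_zero_iff hu.enorm).1 hl2] with y hy
  simpa using hy

end Cell

/-! ### The Sobolev space as a Hilbert space -/

theorem eLpNorm_two_sq {X F : Type*} [MeasurableSpace X] [NormedAddCommGroup F] (f : X → F)
    (μ : Measure X) : eLpNorm f 2 μ ^ 2 = ∫⁻ x, ‖f x‖ₑ ^ 2 ∂μ := by
  have h := eLpNorm_nnreal_pow_eq_lintegral (f := f) (μ := μ) (p := 2) (by norm_num)
  rw [show ((2 : NNReal) : ℝ) = ((2 : ℕ) : ℝ) by norm_num, show ((2 : NNReal) : ENNReal) = 2 from rfl]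
    at h
  simp only [ENNReal.rpow_natCast] at h
  exact h

section Sobolev

variable {d m : ℕ}

theorem memLp_cell_of_continuous {F : Type*} [NormedAddCommGroup F] [SecondCountableTopology F]
    {f : EuclideanSpace ℝ (Fin d) → F} (hf : Continuous f) (p : ENNReal) :
    MemLp f p (volume.restrict (cell d)) := by
  obtain ⟨C, hC⟩ := (isCompact_closedCell d).exists_bound_of_continuousOn hf.continuousOn
  refine MemLp.of_bound hf.aestronglyMeasurable C ?_
  exact (ae_restrict_iff' measurableSet_cell).2
    (Eventually.of_forall fun y hy => hC y (cell_subset_closedCell hy))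

theorem memLp_cell_of_bound {F : Type*} [NormedAddCommGroup F]
    {f : EuclideanSpace ℝ (Fin d) → F} (hf : AEStronglyMeasurable f) {C : ℝ}
    (hC : ∀ y, ‖f y‖ ≤ C) (p : ENNReal) : MemLp f p (volume.restrict (cell d)) :=
  MemLp.of_bound hf.restrict C (Eventually.of_forall hC)

/-- Pairing with k times a coordinate vector is an L^2 inner product, hence continuous; this lets
integral identities pass to limits. -/
theorem exists_clm_coord {ι : Type*} [Fintype ι] [DecidableEq ι] (a : ι)
    {k : EuclideanSpace ℝ (Fin d) → ℝ} (hk : MemLp k 2 (volume.restrict (cell d))) :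
    ∃ L : Lp (EuclideanSpace ℝ ι) 2
        ((volume : Measure (EuclideanSpace ℝ (Fin d))).restrict (cell d)) →L[ℝ] ℝ,
      ∀ u, L u = ∫ y in cell d, u y a * k y := by
  have hk2 : MemLp (fun y => k y • EuclideanSpace.single a (1 : ℝ)) 2 (volume.restrict (cell d)) := by
    have h := (ContinuousLinearMap.toSpanSingleton ℝ
      (EuclideanSpace.single a (1 : ℝ) : EuclideanSpace ℝ ι)).comp_memLp' hk
    exact h
  refine ⟨innerSL ℝ (hk2.toLp _), fun u => ?_⟩
  rw [innerSL_apply_apply, L2.inner_def]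
  refine integral_congr_ae ?_
  filter_upwards [hk2.coeFn_toLp] with y hy
  rw [hy, inner_smul_left, EuclideanSpace.inner_single_left]
  simp [mul_comm]

theorem isClosed_H1 : IsClosed (H1 d m : Set (WithLp 2 (L2Val d m × L2Grad d m))) := by
  have h : (H1 d m : Set (WithLp 2 (L2Val d m × L2Grad d m))) = ⋂ (η : EuclideanSpace ℝ (Fin d) → ℝ)
      (_ : ContDiff ℝ (⊤ : ℕ∞) η) (_ : IsPeriodic η) (i : Fin d) (α : Fin m),
      {p | ∫ y in cell d, p.fst y α * pderiv η i y = - ∫ y in cell d, p.snd y (i, α) * η y} := by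
    ext p
    simp only [mem_iInter]
    rfl
  rw [h]
  refine isClosed_iInter fun η => isClosed_iInter fun hη => isClosed_iInter fun _ =>
    isClosed_iInter fun i => isClosed_iInter fun α => ?_
  obtain ⟨L, hL⟩ := exists_clm_coord α (memLp_cell_of_continuous (continuous_pderiv hη i) 2)
  obtain ⟨M, hM⟩ := exists_clm_coord (i, α) (memLp_cell_of_continuous hη.continuous 2)
  simp_rw [← hL, ← hM]
  exact isClosed_eq
    (L.continuous.comp (WithLp.prod_continuous_ofLp 2 _ _).fst)
    (M.continuous.comp (WithLp.prod_continuous_ofLp 2 _ _).snd).neg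

instance : CompleteSpace (H1 d m) := isClosed_H1.completeSpace_coe

/-- The gradient as a bounded operator on `H^1`. -/
def gradCLM (d m : ℕ) : H1 d m →L[ℝ] L2Grad d m :=
  (WithLp.sndL 2 ℝ (L2Val d m) (L2Grad d m)).comp (H1 d m).subtypeL

/-- The inclusion of `H^1` in `L^2`. -/
def valCLM (d m : ℕ) : H1 d m →L[ℝ] L2Val d m :=
  (WithLp.fstL 2 ℝ (L2Val d m) (L2Grad d m)).comp (H1 d m).subtypeL

theorem norm_sq_H1 (v : H1 d m) : ‖v‖ ^ 2 = ‖sobVal v‖ ^ 2 + ‖sobGrad v‖ ^ 2 :=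
  WithLp.prod_norm_sq_eq_of_L2 (v : WithLp 2 (L2Val d m × L2Grad d m))

theorem inner_H1 (v w : H1 d m) :
    ⟪v, w⟫_ℝ = ⟪sobVal v, sobVal w⟫_ℝ + ⟪sobGrad v, sobGrad w⟫_ℝ :=
  WithLp.prod_inner_apply (v : WithLp 2 (L2Val d m × L2Grad d m)) w

theorem enorm_sq_eq_lintegral {X F : Type*} [MeasurableSpace X] [NormedAddCommGroup F]
    {μ : Measure X} (u : Lp F 2 μ) : ‖u‖ₑ ^ 2 = ∫⁻ x, ‖u x‖ₑ ^ 2 ∂μ := by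
  rw [← eLpNorm_two_sq, Lp.enorm_def]

theorem enorm_sq_H1 (v : H1 d m) : ‖v‖ₑ ^ 2
    = (∫⁻ y in cell d, ‖sobVal v y‖ₑ ^ 2) + ∫⁻ y in cell d, ‖sobGrad v y‖ₑ ^ 2 := by
  rw [← enorm_sq_eq_lintegral, ← enorm_sq_eq_lintegral, ← ofReal_norm, ← ofReal_norm,
    ← ofReal_norm, ← ENNReal.ofReal_pow (norm_nonneg _), ← ENNReal.ofReal_pow (norm_nonneg _),
    ← ENNReal.ofReal_pow (norm_nonneg _), ← ENNReal.ofReal_add (by positivity) (by positivity),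
    norm_sq_H1]

/-- The class of `f` is the element `v` of `H^1`. -/
def Represents (v : H1 d m) (f : EuclideanSpace ℝ (Fin d) → EuclideanSpace ℝ (Fin m)) : Prop :=
  sobVal v =ᵐ[volume.restrict (cell d)] f ∧
    sobGrad v =ᵐ[volume.restrict (cell d)] classicalGrad f

theorem Represents.enorm_sq {v : H1 d m}
    {f : EuclideanSpace ℝ (Fin d) → EuclideanSpace ℝ (Fin m)} (h : Represents v f) : ‖v‖ₑ ^ 2
    = (∫⁻ y in cell d, ‖f y‖ₑ ^ 2) + ∫⁻ y in cell d, ‖classicalGrad f y‖ₑ ^ 2 := by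
  rw [enorm_sq_H1]
  congr 1
  · refine lintegral_congr_ae ?_
    filter_upwards [h.1] with y hy
    rw [hy]
  · refine lintegral_congr_ae ?_
    filter_upwards [h.2] with y hy
    rw [hy]

theorem classicalGrad_add {f g : EuclideanSpace ℝ (Fin d) → EuclideanSpace ℝ (Fin m)}
    {y : EuclideanSpace ℝ (Fin d)} (hf : DifferentiableAt ℝ f y) (hg : DifferentiableAt ℝ g y) :
    classicalGrad (fun x => f x + g x) y = classicalGrad f y + classicalGrad g y := by
  ext r
  simp [classicalGrad, pderiv, fderiv_fun_add hf hg]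

theorem classicalGrad_const_smul {f : EuclideanSpace ℝ (Fin d) → EuclideanSpace ℝ (Fin m)}
    {y : EuclideanSpace ℝ (Fin d)} (t : ℝ) (hf : DifferentiableAt ℝ f y) :
    classicalGrad (fun x => t • f x) y = t • classicalGrad f y := by
  ext r
  simp [classicalGrad, pderiv, fderiv_fun_const_smul hf]

theorem classicalGrad_const (a : EuclideanSpace ℝ (Fin m)) (y : EuclideanSpace ℝ (Fin d)) :
    classicalGrad (fun _ : EuclideanSpace ℝ (Fin d) => a) y = 0 := by
  ext p; simp [classicalGrad, pderiv]

theorem Represents.add {v w : H1 d m}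
    {f g : EuclideanSpace ℝ (Fin d) → EuclideanSpace ℝ (Fin m)} (hv : Represents v f)
    (hw : Represents w g) (hf : BddLip f) (hg : BddLip g) :
    Represents (v + w) fun y => f y + g y := by
  obtain ⟨⟨K, hK⟩, -⟩ := hf
  obtain ⟨⟨L, hL⟩, -⟩ := hg
  constructor
  · filter_upwards [Lp.coeFn_add (sobVal v) (sobVal w), hv.1, hw.1] with y h1 h2 h3
    have : sobVal (v + w) y = (sobVal v) y + (sobVal w) y := h1
    rw [this, h2, h3]
  · filter_upwards [Lp.coeFn_add (sobGrad v) (sobGrad w), hv.2, hw.2,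
      ae_restrict_of_ae hK.ae_differentiableAt, ae_restrict_of_ae hL.ae_differentiableAt]
      with y h1 h2 h3 h4 h5
    have : sobGrad (v + w) y = (sobGrad v) y + (sobGrad w) y := h1
    rw [this, h2, h3, classicalGrad_add h4 h5]

theorem Represents.smul {v : H1 d m}
    {f : EuclideanSpace ℝ (Fin d) → EuclideanSpace ℝ (Fin m)} (hv : Represents v f)
    (hf : BddLip f) (t : ℝ) : Represents (t • v) fun y => t • f y := by
  obtain ⟨⟨K, hK⟩, -⟩ := hf
  constructor
  · filter_upwards [Lp.coeFn_smul t (sobVal v), hv.1] with y h1 h2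
    have : sobVal (t • v) y = t • (sobVal v) y := h1
    rw [this, h2]
  · filter_upwards [Lp.coeFn_smul t (sobGrad v), hv.2,
      ae_restrict_of_ae hK.ae_differentiableAt] with y h1 h2 h4
    have : sobGrad (t • v) y = t • (sobGrad v) y := h1
    rw [this, h2, classicalGrad_const_smul t h4]

theorem Represents.sub {v w : H1 d m}
    {f g : EuclideanSpace ℝ (Fin d) → EuclideanSpace ℝ (Fin m)} (hv : Represents v f)
    (hw : Represents w g) (hf : BddLip f) (hg : BddLip g) :
    Represents (v - w) fun y => f y - g y := by
  have h := hv.add (hw.smul hg (-1)) hf ((bddLip_const (-1)).smul hg)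
  simpa [sub_eq_add_neg] using h

theorem norm_classicalGrad_le_of_lipschitz
    {f : EuclideanSpace ℝ (Fin d) → EuclideanSpace ℝ (Fin m)} {K : NNReal} (hf : LipschitzWith K f)
    (y : EuclideanSpace ℝ (Fin d)) : ‖classicalGrad f y‖ ≤ Real.sqrt (d * K ^ 2) := by
  refine Real.le_sqrt_of_sq_le ((norm_classicalGrad_le f y).trans ?_)
  gcongr
  exact norm_fderiv_le_of_lipschitz ℝ hf

theorem measurable_classicalGrad (f : EuclideanSpace ℝ (Fin d) → EuclideanSpace ℝ (Fin m)) :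
    Measurable (classicalGrad f) := by
  refine (PiLp.continuous_toLp 2 _).measurable.comp (measurable_pi_lambda _ fun p => ?_)
  exact (EuclideanSpace.proj p.2 : EuclideanSpace ℝ (Fin m) →L[ℝ] ℝ).continuous.measurable.comp
    (measurable_fderiv_apply_const ℝ f _)

/-- By the product rule almost everywhere, the classical gradient is the weak one as soon as
derivatives of fη have no boundary contribution. Periodicity of f, or support inside the cell, is
used afterwards to guarantee this. -/
theorem exists_represents {f : EuclideanSpace ℝ (Fin d) → EuclideanSpace ℝ (Fin m)}
    (hf : BddLip f)
    (h : ∀ η : EuclideanSpace ℝ (Fin d) → ℝ, ContDiff ℝ (⊤ : ℕ∞) η → IsPeriodic η →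
      ∀ (i : Fin d) (α : Fin m), ∫ y in cell d, pderiv (fun x => f x α * η x) i y = 0) :
    ∃ v : H1 d m, Represents v f := by
  obtain ⟨⟨K, hK⟩, C, hC⟩ := id hf
  have h1 : MemLp f 2 (volume.restrict (cell d)) :=
    memLp_cell_of_bound hK.continuous.aestronglyMeasurable hC 2
  have h2 : MemLp (classicalGrad f) 2 (volume.restrict (cell d)) :=
    memLp_cell_of_bound (measurable_classicalGrad f).aestronglyMeasurable
      (norm_classicalGrad_le_of_lipschitz hK) 2
  refine ⟨⟨WithLp.toLp 2 (h1.toLp f, h2.toLp _), ?_⟩, h1.coeFn_toLp, h2.coeFn_toLp⟩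
  intro η hη hper i α
  change ∫ y in cell d, (h1.toLp f) y α * pderiv η i y
    = -∫ y in cell d, (h2.toLp _) y (i, α) * η y
  rw [eq_neg_iff_add_eq_zero, ← integral_add (integrable_coord_mul _ _ (continuous_pderiv hη i))
    (integrable_coord_mul _ _ hη.continuous), ← h η hη hper i α]
  refine integral_congr_ae ?_
  filter_upwards [h1.coeFn_toLp, h2.coeFn_toLp, ae_restrict_of_ae hK.ae_differentiableAt]
    with y e1 e2 e3
  rw [e1, e2]
  have hp : HasFDerivAt (fun x => f x α)
      ((EuclideanSpace.proj α : EuclideanSpace ℝ (Fin m) →L[ℝ] ℝ).comp (fderiv ℝ f y)) y :=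
    (EuclideanSpace.proj α : EuclideanSpace ℝ (Fin m) →L[ℝ] ℝ).hasFDerivAt.comp y e3.hasFDerivAt
  have hη' : HasFDerivAt η (fderiv ℝ η y) y := (hη.differentiable (by simp) y).hasFDerivAt
  rw [pderiv, pderiv, (hp.fun_mul hη').fderiv]
  simp [classicalGrad, pderiv, mul_comm]

theorem bddLip_coord_mul {f : EuclideanSpace ℝ (Fin d) → EuclideanSpace ℝ (Fin m)}
    (hf : BddLip f) {η : EuclideanSpace ℝ (Fin d) → ℝ} (hη : BddLip η) (α : Fin m) :
    BddLip fun x => f x α * η x :=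
  (hf.clm (EuclideanSpace.proj α : EuclideanSpace ℝ (Fin m) →L[ℝ] ℝ)).mul hη

theorem exists_represents_of_periodic
    {f : EuclideanSpace ℝ (Fin d) → EuclideanSpace ℝ (Fin m)} (hf : ContDiff ℝ (⊤ : ℕ∞) f)
    (hper : IsPeriodic f) : ∃ v : H1 d m, Represents v f := by
  refine exists_represents (hper.bddLip hf) fun η hη hηp i α => ?_
  have hp : IsPeriodic fun x => f x α * η x := fun y n => by simp only [hper y n, hηp y n]
  exact hp.integral_fderiv_eq_zero (bddLip_coord_mul (hper.bddLip hf) (hηp.bddLip hη) α) _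

/-- Here f itself is not periodic; the products fη are compactly supported inside the cell, so their
derivatives integrate to zero over it. -/
theorem exists_represents_of_tsupport_subset
    {f : EuclideanSpace ℝ (Fin d) → EuclideanSpace ℝ (Fin m)} (hf : BddLip f)
    (hs : tsupport f ⊆ cell d) : ∃ v : H1 d m, Represents v f := by
  refine exists_represents hf fun η hη hηp i α => ?_
  obtain ⟨⟨K, hK⟩, -⟩ := bddLip_coord_mul hf (hηp.bddLip hη) α
  have hsub : tsupport (fun x => f x α * η x) ⊆ tsupport f := by
    refine closure_mono fun x hx => ?_
    rw [Function.mem_support] at hx ⊢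
    intro h0
    simp [h0] at hx
  have hc : HasCompactSupport fun x => f x α * η x :=
    (Metric.isCompact_of_isClosed_isBounded (isClosed_tsupport _)
      (isBounded_cell.subset (hsub.trans hs)))
  rw [← integral_fderiv_eq_zero (ν := volume) hK hc (EuclideanSpace.single i 1)]
  refine setIntegral_eq_integral_of_forall_compl_eq_zero fun y hy => ?_
  have : y ∉ tsupport fun x => f x α * η x := fun hmem => hy (hs (hsub hmem))
  rw [pderiv, fderiv_of_notMem_tsupport ℝ this]
  rfl

end Sobolev

/-! ### Density of smooth functions -/

section Density

variable {d m : ℕ}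

theorem contDiff_pderiv {η : EuclideanSpace ℝ (Fin d) → ℝ} (h : ContDiff ℝ (⊤ : ℕ∞) η)
    (i : Fin d) : ContDiff ℝ (⊤ : ℕ∞) (pderiv η i) :=
  ((contDiff_infty_iff_fderiv.1 h).2).clm_apply contDiff_const

/-- Testing the weak gradient of v with ∂_i φ gives a second derivative of φ, which is a multiple of
φ. The H^1 product with a Fourier mode is thus a positive multiple of a Fourier coefficient of v
when the eigenvalues are nonnegative. -/
theorem inner_represents_scalar (v : H1 d m) {φ : EuclideanSpace ℝ (Fin d) → ℝ}
    (hφ : ContDiff ℝ (⊤ : ℕ∞) φ) (hp : IsPeriodic φ) (α : Fin m) {w : H1 d m}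
    (hw : Represents w fun y => φ y • EuclideanSpace.single α 1) {lam : Fin d → ℝ}
    (hlam : ∀ i y, pderiv (pderiv φ i) i y = -(lam i) * φ y) :
    ⟪v, w⟫_ℝ = (1 + ∑ i, lam i) * ∫ y in cell d, sobVal v y α * φ y := by
  have h1 : ⟪sobVal v, sobVal w⟫_ℝ = ∫ y in cell d, sobVal v y α * φ y := by
    rw [L2.inner_def]
    refine integral_congr_ae ?_
    filter_upwards [hw.1] with y hy
    rw [hy, inner_smul_right, EuclideanSpace.inner_single_right]
    simp [mul_comm]
  have h2 : ⟪sobGrad v, sobGrad w⟫_ℝ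
      = ∑ i, ∫ y in cell d, sobGrad v y (i, α) * pderiv φ i y := by
    rw [L2.inner_def, ← integral_finsetSum Finset.univ fun i _ =>
      integrable_coord_mul (sobGrad v) (i, α) (continuous_pderiv hφ i)]
    refine integral_congr_ae ?_
    filter_upwards [hw.2] with y hy
    have hg : ∀ i β, classicalGrad
        (fun y => φ y • (EuclideanSpace.single α 1 : EuclideanSpace ℝ (Fin m))) y (i, β)
        = if β = α then pderiv φ i y else 0 := by
      intro i β
      have hd := hφ.differentiable (by simp) y
      simp only [classicalGrad, pderiv]
      rw [fderiv_fun_smul hd (differentiableAt_const _)]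
      simp
    rw [hy, PiLp.inner_apply, Fintype.sum_prod_type]
    refine Finset.sum_congr rfl fun i _ => ?_
    simp only [hg]
    rw [Finset.sum_eq_single α (fun β _ hβ => by simp [hβ]) (by simp)]
    simp [mul_comm]
  have h3 : ∀ i, ∫ y in cell d, sobGrad v y (i, α) * pderiv φ i y
      = lam i * ∫ y in cell d, sobVal v y α * φ y := by
    intro i
    have h := v.2 (pderiv φ i) (contDiff_pderiv hφ i) (hp.pderiv i) i α
    simp_rw [hlam] at h
    rw [← integral_const_mul]
    have h' : ∫ y in cell d, sobVal v y α * (-(lam i) * φ y)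
        = -∫ y in cell d, sobGrad v y (i, α) * pderiv φ i y := h
    rw [← neg_eq_iff_eq_neg] at h'
    rw [← h', ← integral_neg]
    congr 1
    ext y
    ring
  rw [inner_H1, h1, h2, Finset.sum_congr rfl fun i _ => h3 i, ← Finset.sum_mul]
  ring

/-- The phase of the Fourier mode with frequency `n`. -/
def phase (n : Fin d → ℤ) : EuclideanSpace ℝ (Fin d) →L[ℝ] ℝ :=
  (2 * Real.pi) • ∑ i, (n i : ℝ) • (EuclideanSpace.proj i : EuclideanSpace ℝ (Fin d) →L[ℝ] ℝ)

theorem phase_apply (n : Fin d → ℤ) (y : EuclideanSpace ℝ (Fin d)) :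
    phase n y = 2 * Real.pi * ∑ i, n i * y i := by
  simp [phase]

theorem phase_single (n : Fin d → ℤ) (i : Fin d) :
    phase n (EuclideanSpace.single i 1) = 2 * Real.pi * n i := by
  simp [phase_apply]

theorem phase_add_latticeVec (n k : Fin d → ℤ) (y : EuclideanSpace ℝ (Fin d)) :
    phase n (y + latticeVec k) = phase n y + ((∑ i, n i * k i : ℤ) : ℝ) * (2 * Real.pi) := by
  rw [map_add, phase_apply n (latticeVec k)]
  simp only [latticeVec]
  push_cast
  ring

theorem isPeriodic_cos_phase (n : Fin d → ℤ) : IsPeriodic fun y => Real.cos (phase n y) :=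
  fun y k => by simp only [phase_add_latticeVec, Real.cos_add_int_mul_two_pi]

theorem isPeriodic_sin_phase (n : Fin d → ℤ) : IsPeriodic fun y => Real.sin (phase n y) :=
  fun y k => by simp only [phase_add_latticeVec, Real.sin_add_int_mul_two_pi]

theorem contDiff_cos_phase (n : Fin d → ℤ) :
    ContDiff ℝ (⊤ : ℕ∞) fun y => Real.cos (phase n y) :=
  Real.contDiff_cos.comp (phase n).contDiff

theorem contDiff_sin_phase (n : Fin d → ℤ) :
    ContDiff ℝ (⊤ : ℕ∞) fun y => Real.sin (phase n y) :=
  Real.contDiff_sin.comp (phase n).contDiff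

theorem pderiv_cos_phase (n : Fin d → ℤ) (i : Fin d) :
    pderiv (fun y => Real.cos (phase n y)) i
      = fun y => (-(2 * Real.pi * n i)) * Real.sin (phase n y) := by
  ext y
  rw [pderiv, ((phase n).hasFDerivAt (x := y)).cos.fderiv]
  simp only [_root_.smul_apply, smul_eq_mul, phase_single]
  ring

theorem pderiv_sin_phase (n : Fin d → ℤ) (i : Fin d) :
    pderiv (fun y => Real.sin (phase n y)) i
      = fun y => (2 * Real.pi * n i) * Real.cos (phase n y) := by
  ext y
  rw [pderiv, ((phase n).hasFDerivAt (x := y)).sin.fderiv]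
  simp only [_root_.smul_apply, smul_eq_mul, phase_single]
  ring

theorem pderiv_const_mul (t : ℝ) {φ : EuclideanSpace ℝ (Fin d) → ℝ} (hφ : ContDiff ℝ (⊤ : ℕ∞) φ)
    (i : Fin d) : pderiv (fun y => t * φ y) i = fun y => t * pderiv φ i y := by
  ext y
  rw [pderiv, fderiv_const_mul (hφ.differentiable (by simp) y)]
  rfl

theorem pderiv_pderiv_cos_phase (n : Fin d → ℤ) (i : Fin d) (y : EuclideanSpace ℝ (Fin d)) :
    pderiv (pderiv (fun y => Real.cos (phase n y)) i) i y
      = -((2 * Real.pi * n i) ^ 2) * Real.cos (phase n y) := by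
  rw [pderiv_cos_phase, pderiv_const_mul _ (contDiff_sin_phase n), pderiv_sin_phase]
  ring

theorem pderiv_pderiv_sin_phase (n : Fin d → ℤ) (i : Fin d) (y : EuclideanSpace ℝ (Fin d)) :
    pderiv (pderiv (fun y => Real.sin (phase n y)) i) i y
      = -((2 * Real.pi * n i) ^ 2) * Real.sin (phase n y) := by
  rw [pderiv_sin_phase, pderiv_const_mul _ (contDiff_cos_phase n), pderiv_cos_phase]
  ring

/-- The elements of `H^1` represented by smooth periodic functions. -/
def smoothH1 (d m : ℕ) : Submodule ℝ (H1 d m) where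
  carrier := {v | ∃ f, ContDiff ℝ (⊤ : ℕ∞) f ∧ IsPeriodic f ∧ Represents v f}
  zero_mem' := by
    obtain ⟨v, hv⟩ := exists_represents_of_periodic (d := d) (m := m)
      (f := fun _ => 0) contDiff_const fun _ _ => rfl
    refine ⟨fun _ => 0, contDiff_const, fun _ _ => rfl, ?_⟩
    simpa using hv.smul (bddLip_const 0) 0
  add_mem' := by
    rintro v w ⟨f, hf, hfp, hv⟩ ⟨g, hg, hgp, hw⟩
    exact ⟨fun y => f y + g y, hf.add hg, fun y n => by simp only [hfp y n, hgp y n],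
      hv.add hw (hfp.bddLip hf) (hgp.bddLip hg)⟩
  smul_mem' := by
    rintro t v ⟨f, hf, hfp, hv⟩
    exact ⟨fun y => t • f y, hf.const_smul t, fun y n => by simp only [hfp y n],
      hv.smul (hfp.bddLip hf) t⟩

theorem eq_zero_of_forall_fourier {ι : Type*} [Fintype ι]
    (u : Lp (EuclideanSpace ℝ ι) 2
      ((volume : Measure (EuclideanSpace ℝ (Fin d))).restrict (cell d)))
    (hcos : ∀ a (n : Fin d → ℤ), ∫ y in cell d, u y a * Real.cos (phase n y) = 0)
    (hsin : ∀ a (n : Fin d → ℤ), ∫ y in cell d, u y a * Real.sin (phase n y) = 0) : u = 0 := by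
  have h : ∀ a, ∀ᵐ y ∂volume.restrict (cell d), u y a = 0 := by
    intro a
    have hm : Measurable fun y => u y a :=
      (EuclideanSpace.proj a : EuclideanSpace ℝ ι →L[ℝ] ℝ).continuous.measurable.comp
        (Lp.stronglyMeasurable u).measurable
    refine ae_eq_zero_of_fourier_eq_zero hm ?_ (fun n => ?_) fun n => ?_
    · exact (EuclideanSpace.proj a : EuclideanSpace ℝ ι →L[ℝ] ℝ).comp_memLp' (Lp.memLp u)
    · simpa only [phase_apply] using hcos a n
    · simpa only [phase_apply] using hsin a n
  refine Lp.ext ?_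
  filter_upwards [ae_all_iff.2 h, Lp.coeFn_zero (EuclideanSpace ℝ ι) 2
    ((volume : Measure (EuclideanSpace ℝ (Fin d))).restrict (cell d))] with y h1 h2
  rw [h2]
  ext a
  simpa using h1 a

/-- An element orthogonal to all smooth functions is orthogonal to all Fourier modes, so its
coefficients vanish by `inner_represents_scalar`. The weak gradient identity then kills the Fourier
coefficients of its gradient. No mollification is needed. -/
theorem dense_smoothH1 : Dense (smoothH1 d m : Set (H1 d m)) := by
  rw [Submodule.dense_iff_topologicalClosure_eq_top, Submodule.topologicalClosure_eq_top_iff,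
    Submodule.eq_bot_iff]
  intro v hv
  have key : ∀ φ : EuclideanSpace ℝ (Fin d) → ℝ, ContDiff ℝ (⊤ : ℕ∞) φ → IsPeriodic φ →
      ∀ lam : Fin d → ℝ, (∀ i, 0 ≤ lam i) →
      (∀ i y, pderiv (pderiv φ i) i y = -(lam i) * φ y) →
      ∀ α, ∫ y in cell d, sobVal v y α * φ y = 0 := by
    intro φ hφ hp lam hlam0 hlam α
    have hs : ContDiff ℝ (⊤ : ℕ∞) fun y => φ y • (EuclideanSpace.single α 1 : EuclideanSpace ℝ (Fin m)) :=
      hφ.smul contDiff_const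
    have hsp : IsPeriodic fun y => φ y • (EuclideanSpace.single α 1 : EuclideanSpace ℝ (Fin m)) :=
      fun y n => by simp only [hp y n]
    obtain ⟨w, hw⟩ := exists_represents_of_periodic hs hsp
    have h0 : ⟪v, w⟫_ℝ = 0 := Submodule.inner_left_of_mem_orthogonal (K := smoothH1 d m) ⟨_, hs, hsp, hw⟩ hv
    rw [inner_represents_scalar v hφ hp α hw hlam] at h0
    have hpos : 0 < 1 + ∑ i, lam i := by
      have := Finset.sum_nonneg fun i (_ : i ∈ Finset.univ) => hlam0 i
      linarith
    exact (mul_eq_zero.1 h0).resolve_left hpos.ne'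
  have hval : sobVal v = 0 := eq_zero_of_forall_fourier _
    (fun a n => key _ (contDiff_cos_phase n) (isPeriodic_cos_phase n)
      (fun i => (2 * Real.pi * n i) ^ 2) (fun i => sq_nonneg _) (pderiv_pderiv_cos_phase n) a)
    (fun a n => key _ (contDiff_sin_phase n) (isPeriodic_sin_phase n)
      (fun i => (2 * Real.pi * n i) ^ 2) (fun i => sq_nonneg _) (pderiv_pderiv_sin_phase n) a)
  have key2 : ∀ φ : EuclideanSpace ℝ (Fin d) → ℝ, ContDiff ℝ (⊤ : ℕ∞) φ → IsPeriodic φ →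
      ∀ a : Fin d × Fin m, ∫ y in cell d, sobGrad v y a * φ y = 0 := by
    intro φ hφ hp a
    have h1 : ∫ y in cell d, sobVal v y a.2 * pderiv φ a.1 y
        = -∫ y in cell d, sobGrad v y (a.1, a.2) * φ y := v.2 φ hφ hp a.1 a.2
    have h2 : ∫ y in cell d, sobVal v y a.2 * pderiv φ a.1 y = 0 := by
      rw [hval]
      refine integral_eq_zero_of_ae ?_
      filter_upwards [Lp.coeFn_zero (EuclideanSpace ℝ (Fin m)) 2
        ((volume : Measure (EuclideanSpace ℝ (Fin d))).restrict (cell d))] with y hy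
      rw [hy]
      simp
    rw [h2] at h1
    linarith
  have hgrad : sobGrad v = 0 := eq_zero_of_forall_fourier _
    (fun a n => key2 _ (contDiff_cos_phase n) (isPeriodic_cos_phase n) a)
    (fun a n => key2 _ (contDiff_sin_phase n) (isPeriodic_sin_phase n) a)
  rw [← norm_eq_zero, ← sq_eq_zero_iff, norm_sq_H1, hval, hgrad]
  simp

theorem exists_smooth_tendsto (v : H1 d m) :
    ∃ (f : ℕ → EuclideanSpace ℝ (Fin d) → EuclideanSpace ℝ (Fin m)) (w : ℕ → H1 d m),
      (∀ n, ContDiff ℝ (⊤ : ℕ∞) (f n) ∧ IsPeriodic (f n)) ∧ (∀ n, Represents (w n) (f n)) ∧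
      Tendsto w atTop (𝓝 v) := by
  obtain ⟨w, hw, hlim⟩ := mem_closure_iff_seq_limit.1 (dense_smoothH1 v)
  choose f hf using hw
  exact ⟨f, w, fun n => ⟨(hf n).1, (hf n).2.1⟩, fun n => (hf n).2.2, hlim⟩

end Density

/-! ### Charts at the boundary of an inclusion -/

section Boundary

variable {d : ℕ}

/-- In the ball with center `x` and radius `ρ`, the set `ω` is the region below the graph. -/
structure GraphChart.Fits (c : GraphChart d) (ω : Set (EuclideanSpace ℝ (Fin d)))
    (x : EuclideanSpace ℝ (Fin d)) (ρ : ℝ) : Prop where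
  pos : 0 < ρ
  ball_subset : Metric.ball x ρ ⊆ cell d
  mem_iff : ∀ y ∈ Metric.ball x ρ, y ∈ ω ↔ c.height y < 0

/-- A point of the graph is a limit of points of ω obtained by moving down along the chart
direction; points above the graph have a neighbourhood free of ω. -/
theorem GraphChart.Fits.mem_closure_iff {c : GraphChart d} {ω : Set (EuclideanSpace ℝ (Fin d))}
    {x : EuclideanSpace ℝ (Fin d)} {ρ : ℝ} (h : c.Fits ω x ρ) {y : EuclideanSpace ℝ (Fin d)}
    (hy : y ∈ Metric.ball x ρ) : y ∈ closure ω ↔ c.height y ≤ 0 := by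
  constructor
  · intro hyc
    by_contra hpos
    rw [not_le] at hpos
    have hn : Metric.ball x ρ ∩ {z | 0 < c.height z} ∈ 𝓝 y :=
      inter_mem (Metric.isOpen_ball.mem_nhds hy)
        (c.continuous_height.continuousAt.eventually (Ioi_mem_nhds hpos))
    obtain ⟨z, ⟨hzb, hz : 0 < c.height z⟩, hzω⟩ := mem_closure_iff_nhds.1 hyc _ hn
    exact absurd ((h.mem_iff z hzb).1 hzω) (not_lt.2 hz.le)
  · intro hle
    have hlim : Tendsto (fun s : ℝ => y + s • c.dir) (𝓝[<] 0) (𝓝 y) := by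
      have : Continuous fun s : ℝ => y + s • c.dir := by fun_prop
      have h0 := this.tendsto 0
      rw [zero_smul, add_zero] at h0
      exact h0.mono_left nhdsWithin_le_nhds
    refine mem_closure_of_tendsto hlim ?_
    filter_upwards [hlim.eventually (Metric.isOpen_ball.mem_nhds hy), self_mem_nhdsWithin]
      with s hs (hs0 : s < 0)
    rw [h.mem_iff _ hs, c.height_add]
    linarith

theorem GraphChart.Fits.mem_frontier_iff {c : GraphChart d} {ω : Set (EuclideanSpace ℝ (Fin d))}
    {x : EuclideanSpace ℝ (Fin d)} {ρ : ℝ} (h : c.Fits ω x ρ) (ho : IsOpen ω)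
    {y : EuclideanSpace ℝ (Fin d)} (hy : y ∈ Metric.ball x ρ) :
    y ∈ frontier ω ↔ c.height y = 0 := by
  rw [ho.frontier_eq, Set.mem_sdiff, h.mem_closure_iff hy, h.mem_iff y hy, not_lt]
  exact ⟨fun h => le_antisymm h.1 h.2, fun h => ⟨h.le, h.ge⟩⟩

theorem IsInclusion.exists_fits {ω : Set (EuclideanSpace ℝ (Fin d))} (hω : IsInclusion ω)
    {x : EuclideanSpace ℝ (Fin d)} (hx : x ∈ frontier ω) :
    ∃ (c : GraphChart d) (ρ : ℝ), c.Fits ω x ρ := by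
  obtain ⟨e, he, L, γ, hγ, ρ, hρ, hmem⟩ := hω.lipschitz x hx
  obtain ⟨r, hr, hball⟩ := Metric.isOpen_iff.1 isOpen_cell x
    (hω.closure_subset (frontier_subset_closure hx))
  have hinner : LipschitzWith 1 fun y : EuclideanSpace ℝ (Fin d) => ⟪e, y⟫_ℝ := by
    refine LipschitzWith.of_dist_le_mul fun y z => ?_
    rw [Real.dist_eq, ← inner_sub_right, NNReal.coe_one, dist_eq_norm]
    exact (abs_real_inner_le_norm _ _).trans (by rw [he])
  have hproj : LipschitzWith (1 + 1) fun y : EuclideanSpace ℝ (Fin d) => y - ⟪e, y⟫_ℝ • e := by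
    have h : LipschitzWith 1 fun y : EuclideanSpace ℝ (Fin d) => ⟪e, y⟫_ℝ • e := by
      refine LipschitzWith.of_dist_le_mul fun y z => ?_
      rw [dist_eq_norm, ← sub_smul, norm_smul, he, mul_one, ← dist_eq_norm]
      exact hinner.dist_le_mul y z
    exact LipschitzWith.id.sub h
  have hee : ⟪e, e⟫_ℝ = 1 := by rw [real_inner_self_eq_norm_sq, he, one_pow]
  -- The height is the vertical coordinate minus the graph function at the horizontal projection.
  -- The radius also keeps the ball inside the cell.
  refine ⟨⟨e, fun y => ⟪e, y⟫_ℝ - γ (y - ⟪e, y⟫_ℝ • e), 1 + L * (1 + 1), he,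
    hinner.sub (hγ.comp hproj), fun y s => ?_⟩, min ρ r, lt_min hρ hr, ?_, fun y hy => ?_⟩
  · have h1 : ⟪e, y + s • e⟫_ℝ = ⟪e, y⟫_ℝ + s := by
      rw [inner_add_right, inner_smul_right, hee, mul_one]
    have h2 : y + s • e - (⟪e, y⟫_ℝ + s) • e = y - ⟪e, y⟫_ℝ • e := by
      rw [add_smul]; abel
    rw [h1, h2]
    ring
  · exact (Metric.ball_subset_ball (min_le_right _ _)).trans hball
  · rw [hmem y (Metric.ball_subset_ball (min_le_left _ _) hy)]
    simp only
    constructor <;> intro h <;> linarith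

/-- A finite family of charts covering the boundary of `ω`, with a subordinate partition of
unity of the closure of `ω`. -/
structure BoundaryCover (ω : Set (EuclideanSpace ℝ (Fin d))) where
  ι : Type
  [fintype : Fintype ι]
  chart : ι → GraphChart d
  center : ι → EuclideanSpace ℝ (Fin d)
  radius : ι → ℝ
  fits : ∀ k, (chart k).Fits ω (center k) (radius k)
  height_center : ∀ k, (chart k).height (center k) = 0
  bump : ι → EuclideanSpace ℝ (Fin d) → ℝ
  inner : EuclideanSpace ℝ (Fin d) → ℝ
  contDiff_bump : ∀ k, ContDiff ℝ (⊤ : ℕ∞) (bump k)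
  contDiff_inner : ContDiff ℝ (⊤ : ℕ∞) inner
  bump_nonneg : ∀ k y, 0 ≤ bump k y
  bump_le_one : ∀ k y, bump k y ≤ 1
  tsupport_bump : ∀ k, tsupport (bump k) ⊆
    Metric.ball (center k) (radius k / (2 * (1 + 2 * (chart k).lip)))
  tsupport_inner : tsupport inner ⊆ ω
  sum_eq_one : ∀ y ∈ closure ω, inner y + ∑ k, bump k y = 1

attribute [instance] BoundaryCover.fintype

theorem IsInclusion.isCompact_closure {ω : Set (EuclideanSpace ℝ (Fin d))} (hω : IsInclusion ω) :
    IsCompact (closure ω) :=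
  (isBounded_cell.subset (subset_closure.trans hω.closure_subset)).isCompact_closure

/-- Compactness of the boundary and a smooth partition of unity, with ω itself as the extra member
of the cover. The bump radii are divided by 2(1 + 2 lip) so that, by `mem_closedBall_of_fold_mem`, a
folded bump is still supported in half of the chart ball. -/
theorem IsInclusion.nonempty_boundaryCover {ω : Set (EuclideanSpace ℝ (Fin d))}
    (hω : IsInclusion ω) : Nonempty (BoundaryCover ω) := by
  choose c ρ hfit using fun x : frontier ω => hω.exists_fits x.2
  have hr : ∀ x, 0 < ρ x / (2 * (1 + 2 * ((c x).lip : ℝ))) := fun x => by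
    have := (hfit x).pos
    positivity
  have hcomp : IsCompact (frontier ω) :=
    hω.isCompact_closure.of_isClosed_subset isClosed_frontier frontier_subset_closure
  obtain ⟨t, ht⟩ := hcomp.elim_finite_subcover
    (fun x : frontier ω => Metric.ball (x : EuclideanSpace ℝ (Fin d))
      (ρ x / (2 * (1 + 2 * ((c x).lip : ℝ)))))
    (fun x => Metric.isOpen_ball)
    (fun x hx => mem_iUnion.2 ⟨⟨x, hx⟩, Metric.mem_ball_self (hr _)⟩)
  let U : Option t → Set (EuclideanSpace ℝ (Fin d)) := fun k => k.elim ω fun x =>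
    Metric.ball (x.1 : EuclideanSpace ℝ (Fin d)) (ρ x / (2 * (1 + 2 * ((c x).lip : ℝ))))
  have hUo : ∀ k, IsOpen (U k) := by
    rintro (_ | x)
    · exact hω.isOpen
    · exact Metric.isOpen_ball
  have hUc : closure ω ⊆ ⋃ k, U k := by
    intro y hy
    by_cases hyω : y ∈ ω
    · exact mem_iUnion.2 ⟨none, hyω⟩
    · have : y ∈ frontier ω := by rw [hω.isOpen.frontier_eq]; exact ⟨hy, hyω⟩
      obtain ⟨x, hx⟩ := mem_iUnion.1 (ht this)
      obtain ⟨hxt, hyx⟩ := mem_iUnion.1 hx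
      exact mem_iUnion.2 ⟨some ⟨x, hxt⟩, hyx⟩
  obtain ⟨f, hf⟩ := SmoothPartitionOfUnity.exists_isSubordinate
    (modelWithCornersSelf ℝ (EuclideanSpace ℝ (Fin d))) isClosed_closure U hUo hUc
  exact ⟨{
    ι := t
    chart := fun x => c x
    center := fun x => x.1
    radius := fun x => ρ x
    fits := fun x => hfit x
    height_center := fun x => ((hfit x).mem_frontier_iff hω.isOpen
      (Metric.mem_ball_self (hfit x).pos)).1 x.1.2
    bump := fun x => f (some x)
    inner := f none
    contDiff_bump := fun x => (f (some x)).contMDiff.contDiff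
    contDiff_inner := (f none).contMDiff.contDiff
    bump_nonneg := fun x y => f.nonneg _ _
    bump_le_one := fun x y => f.le_one _ _
    tsupport_bump := fun x => hf (some x)
    tsupport_inner := hf none
    sum_eq_one := fun y hy => by
      have h := f.sum_eq_one hy
      rw [finsum_eq_sum_of_fintype, Fintype.sum_option] at h
      exact h }⟩

namespace BoundaryCover

variable {ω : Set (EuclideanSpace ℝ (Fin d))} (B : BoundaryCover ω)

theorem tsupport_bump_subset_ball (k : B.ι) :
    tsupport (B.bump k) ⊆ Metric.ball (B.center k) (B.radius k) := by
  refine (B.tsupport_bump k).trans (Metric.ball_subset_ball ?_)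
  refine div_le_self (B.fits k).pos.le ?_
  have : (0 : ℝ) ≤ (B.chart k).lip := NNReal.coe_nonneg _
  linarith

theorem hasCompactSupport_bump (k : B.ι) : HasCompactSupport (B.bump k) :=
  Metric.isCompact_of_isClosed_isBounded (isClosed_tsupport _)
    (Metric.isBounded_ball.subset (B.tsupport_bump_subset_ball k))

theorem bddLip_bump (k : B.ι) : BddLip (B.bump k) :=
  BddLip.of_contDiff (B.contDiff_bump k) (B.hasCompactSupport_bump k)

theorem mem_ball_of_bump_ne_zero {k : B.ι} {y : EuclideanSpace ℝ (Fin d)} (h : B.bump k y ≠ 0) :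
    y ∈ Metric.ball (B.center k) (B.radius k) :=
  B.tsupport_bump_subset_ball k (subset_tsupport _ h)

theorem sum_bump_eq_one (ho : IsOpen ω) {y : EuclideanSpace ℝ (Fin d)} (hy : y ∈ frontier ω) :
    ∑ k, B.bump k y = 1 := by
  have h := B.sum_eq_one y (frontier_subset_closure hy)
  have h0 : B.inner y = 0 := image_eq_zero_of_notMem_tsupport fun hmem => by
    rw [ho.frontier_eq] at hy
    exact hy.2 (B.tsupport_inner hmem)
  rwa [h0, zero_add] at h

/-- On functions supported in a chart ball, the boundary of `ω` is the graph. -/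
theorem lintegral_frontier_eq (ho : IsOpen ω) (k : B.ι) (μ : Measure (EuclideanSpace ℝ (Fin d)))
    {h : EuclideanSpace ℝ (Fin d) → ENNReal}
    (hs : ∀ y, y ∉ Metric.ball (B.center k) (B.radius k) → h y = 0) :
    ∫⁻ y in frontier ω, h y ∂μ = ∫⁻ y in {y | (B.chart k).height y = 0}, h y ∂μ := by
  have hm : MeasurableSet {y | (B.chart k).height y = 0} :=
    (B.chart k).continuous_height.measurable (measurableSet_singleton 0)
  rw [← lintegral_indicator isClosed_frontier.measurableSet, ← lintegral_indicator hm]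
  refine lintegral_congr fun y => ?_
  by_cases hy : y ∈ Metric.ball (B.center k) (B.radius k)
  · have := (B.fits k).mem_frontier_iff ho hy
    by_cases hyf : y ∈ frontier ω
    · rw [indicator_of_mem hyf, indicator_of_mem (by exact this.1 hyf)]
    · rw [indicator_of_notMem hyf, indicator_of_notMem (by exact fun h0 => hyf (this.2 h0))]
  · have := hs y hy
    simp only [indicator]
    split_ifs <;> simp [this]

end BoundaryCover

end Boundary

/-! ### The trace estimate and Green's estimate -/

section TraceEstimate

variable {d m : ℕ} {ω : Set (EuclideanSpace ℝ (Fin d))}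

theorem enorm_sq_eq_ofReal {F : Type*} [NormedAddCommGroup F] (x : F) :
    ‖x‖ₑ ^ 2 = ENNReal.ofReal (‖x‖ ^ 2) := by
  rw [← ofReal_norm, ENNReal.ofReal_pow (norm_nonneg _)]

/-- The product rule gives terms of type |f||∇f| and |f|², and the mixed one is absorbed by the
squares. Differentiating |f|² turns the L^1 trace estimate into an L^2 one. -/
theorem norm_fderiv_mul_normSq_le {χ : EuclideanSpace ℝ (Fin d) → ℝ}
    {f : EuclideanSpace ℝ (Fin d) → EuclideanSpace ℝ (Fin m)} {y v : EuclideanSpace ℝ (Fin d)}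
    (hχ : DifferentiableAt ℝ χ y) (hf : DifferentiableAt ℝ f y) {M : ℝ} (hM0 : |χ y| ≤ M)
    (hM1 : ‖fderiv ℝ χ y‖ ≤ M) :
    ‖fderiv ℝ (fun x => χ x * ‖f x‖ ^ 2) y v‖
      ≤ 2 * M * ‖v‖ * (‖f y‖ ^ 2 + ‖classicalGrad f y‖ ^ 2) := by
  have h1 := (hχ.hasFDerivAt.fun_mul hf.hasFDerivAt.norm_sq).fderiv
  have hle : ‖fderiv ℝ f y v‖ ≤ ‖classicalGrad f y‖ * ‖v‖ :=
    (ContinuousLinearMap.le_opNorm _ _).trans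
      (mul_le_mul_of_nonneg_right (norm_fderiv_le_classicalGrad f y) (norm_nonneg _))
  have hM : 0 ≤ M := (abs_nonneg _).trans hM0
  have h2 : fderiv ℝ (fun x => χ x * ‖f x‖ ^ 2) y v
      = χ y * (2 * ⟪f y, fderiv ℝ f y v⟫_ℝ) + ‖f y‖ ^ 2 * fderiv ℝ χ y v := by
    rw [h1]
    simp
  rw [h2]
  have e1 : ‖χ y * (2 * ⟪f y, fderiv ℝ f y v⟫_ℝ)‖
      ≤ M * (2 * (‖f y‖ * (‖classicalGrad f y‖ * ‖v‖))) := by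
    rw [norm_mul, norm_mul, Real.norm_eq_abs, Real.norm_two]
    gcongr
    exact (norm_inner_le_norm _ _).trans (mul_le_mul_of_nonneg_left hle (norm_nonneg _))
  have e2 : ‖‖f y‖ ^ 2 * fderiv ℝ χ y v‖ ≤ ‖f y‖ ^ 2 * (M * ‖v‖) := by
    rw [norm_mul, Real.norm_eq_abs, abs_of_nonneg (sq_nonneg _)]
    gcongr
    exact (ContinuousLinearMap.le_opNorm _ _).trans
      (mul_le_mul_of_nonneg_right hM1 (norm_nonneg _))
  refine (norm_add_le _ _).trans ((add_le_add e1 e2).trans ?_)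
  have h3 : 0 ≤ M * ‖v‖ * (‖f y‖ - ‖classicalGrad f y‖) ^ 2 := by positivity
  have h4 : 0 ≤ M * ‖v‖ * ‖classicalGrad f y‖ ^ 2 := by positivity
  nlinarith [h3, h4]

/-- The graph estimates apply to G = bump · |f|². Where the bump lives, the region above the graph
lies in the cell outside ω, so only exterior values of f enter. -/
theorem BoundaryCover.exists_lintegral_bump_le (B : BoundaryCover ω) (ho : IsOpen ω) (k : B.ι)
    (m : ℕ) : ∃ C : ENNReal, C ≠ ⊤ ∧
      ∀ f : EuclideanSpace ℝ (Fin d) → EuclideanSpace ℝ (Fin m), BddLip f →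
        ∫⁻ y in frontier ω, ‖B.bump k y * ‖f y‖ ^ 2‖ₑ ∂Measure.hausdorffMeasure ((d : ℝ) - 1)
          ≤ C * ∫⁻ y in cell d \ ω, (‖f y‖ₑ ^ 2 + ‖classicalGrad f y‖ₑ ^ 2) := by
  obtain ⟨C1, hC1, h1⟩ := (B.chart k).exists_lintegral_surface_le
  obtain ⟨C2, hC2, h2⟩ := (B.chart k).exists_lintegral_foot_le_above
  obtain ⟨⟨M, hM⟩, -⟩ := B.bddLip_bump k
  refine ⟨C1 * (C2 * ENNReal.ofReal (2 * max 1 (M : ℝ))),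
    ENNReal.mul_ne_top hC1 (ENNReal.mul_ne_top hC2 ENNReal.ofReal_ne_top), fun f hf => ?_⟩
  set G : EuclideanSpace ℝ (Fin d) → ℝ := fun y => B.bump k y * ‖f y‖ ^ 2 with hGdef
  have hGb : BddLip G := (B.bddLip_bump k).mul hf.normSq
  obtain ⟨⟨L, hL⟩, -⟩ := id hGb
  obtain ⟨⟨N, hN⟩, -⟩ := id hf
  have hGs : ∀ y, y ∉ Metric.ball (B.center k) (B.radius k) → G y = 0 := fun y hy => by
    have : B.bump k y = 0 := by
      by_contra h0
      exact hy (B.mem_ball_of_bump_ne_zero h0)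
    simp [hGdef, this]
  have hGc : HasCompactSupport G := (B.hasCompactSupport_bump k).mul_right
  have hcm : MeasurableSet (cell d \ ω) := measurableSet_cell.diff ho.measurableSet
  have ham : MeasurableSet {y | 0 < (B.chart k).height y} :=
    (B.chart k).continuous_height.measurable measurableSet_Ioi
  rw [B.lintegral_frontier_eq ho k _ fun y hy => enorm_eq_zero.2 (hGs y hy), mul_assoc]
  refine (h1 _ hGb.continuous.measurable.enorm).trans (mul_le_mul_right ?_ _)
  rw [mul_assoc]
  refine (h2 G L hL hGc).trans (mul_le_mul_right ?_ _)
  rw [← lintegral_const_mul' _ _ ENNReal.ofReal_ne_top, ← lintegral_indicator hcm,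
    ← lintegral_indicator ham]
  refine lintegral_mono_ae ?_
  filter_upwards [hN.ae_differentiableAt] with y hy
  by_cases hyb : y ∈ tsupport (B.bump k)
  · have hball := B.tsupport_bump_subset_ball k hyb
    by_cases hpos : 0 < (B.chart k).height y
    · have hmem : y ∈ cell d \ ω := ⟨(B.fits k).ball_subset hball, fun h0 =>
        absurd (((B.fits k).mem_iff y hball).1 h0) (not_lt.2 hpos.le)⟩
      rw [indicator_of_mem hmem, indicator_of_mem (by exact hpos), enorm_sq_eq_ofReal,
        enorm_sq_eq_ofReal, ← ENNReal.ofReal_add (by positivity) (by positivity),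
        ← ENNReal.ofReal_mul (by positivity), ← ofReal_norm]
      refine ENNReal.ofReal_le_ofReal ?_
      have h := norm_fderiv_mul_normSq_le (v := (B.chart k).dir)
        ((B.contDiff_bump k).differentiable (by simp) y) hy (M := max 1 (M : ℝ))
        (by rw [abs_of_nonneg (B.bump_nonneg k y)]
            exact (B.bump_le_one k y).trans (le_max_left _ _))
        ((norm_fderiv_le_of_lipschitz ℝ hM).trans (le_max_right _ _))
      rwa [(B.chart k).norm_dir, mul_one] at h
    · rw [indicator_of_notMem (by exact hpos)]
      exact zero_le
  · have h0 : fderiv ℝ G y = 0 := by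
      refine fderiv_of_notMem_tsupport ℝ fun hmem => hyb ?_
      exact tsupport_mul_subset_left hmem
    refine le_trans (le_of_eq ?_) zero_le
    simp only [indicator, h0]
    simp

/-- The trace estimate, from the exterior side. -/
theorem IsInclusion.exists_lintegral_frontier_le (hω : IsInclusion ω) (m : ℕ) :
    ∃ C : ENNReal, C ≠ ⊤ ∧
      ∀ f : EuclideanSpace ℝ (Fin d) → EuclideanSpace ℝ (Fin m), BddLip f →
        ∫⁻ y, ‖f y‖ₑ ^ 2 ∂surface ω
          ≤ C * ∫⁻ y in cell d \ ω, (‖f y‖ₑ ^ 2 + ‖classicalGrad f y‖ₑ ^ 2) := by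
  obtain ⟨B⟩ := hω.nonempty_boundaryCover
  choose C hC h using fun k => B.exists_lintegral_bump_le hω.isOpen k m
  refine ⟨∑ k, C k, by simpa using hC, fun f hf => ?_⟩
  rw [Finset.sum_mul]
  refine le_trans ?_ (Finset.sum_le_sum fun k _ => h k f hf)
  have hmeas : ∀ k, Measurable fun y => ‖B.bump k y * ‖f y‖ ^ 2‖ₑ := fun k =>
    ((B.bddLip_bump k).mul hf.normSq).continuous.measurable.enorm
  rw [← lintegral_finsetSum _ fun k _ => hmeas k, surface]
  refine setLIntegral_mono' isClosed_frontier.measurableSet fun y hy => ?_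
  have hnn : ∀ k, 0 ≤ B.bump k y * ‖f y‖ ^ 2 := fun k => mul_nonneg (B.bump_nonneg k y) (sq_nonneg _)
  simp_rw [Real.enorm_of_nonneg (hnn _)]
  rw [← ENNReal.ofReal_sum_of_nonneg fun k _ => hnn k, ← Finset.sum_mul,
    B.sum_bump_eq_one hω.isOpen hy, one_mul, enorm_sq_eq_ofReal]

/-- The trace estimate for a constant unit vector bounds the surface measure by the volume of the
cell. -/
theorem IsInclusion.isFiniteMeasure_surface (hω : IsInclusion ω) : IsFiniteMeasure (surface ω) := by
  obtain ⟨C, hC, h⟩ := hω.exists_lintegral_frontier_le 1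
  have h1 := h (fun _ => EuclideanSpace.single 0 1) (bddLip_const _)
  have hs : ‖(EuclideanSpace.single (0 : Fin 1) (1 : ℝ))‖ₑ = 1 := by
    rw [← ofReal_norm, PiLp.norm_single]
    simp
  simp only [classicalGrad_const, hs, one_pow, enorm_zero, lintegral_const, one_mul] at h1
  refine ⟨h1.trans_lt (ENNReal.mul_lt_top hC.lt_top (ENNReal.mul_lt_top (by simp) ?_))⟩
  rw [Measure.restrict_apply_univ]
  exact (measure_mono sdiff_subset).trans_lt isBounded_cell.measure_lt_top

/-- On the support of the bump, ω is the region below a graph, so Green's estimate in the chart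
applies to bump · H. -/
theorem BoundaryCover.exists_enorm_integral_bump_le (B : BoundaryCover ω) (ho : IsOpen ω) (k : B.ι)
    (v : EuclideanSpace ℝ (Fin d)) : ∃ C : ENNReal, C ≠ ⊤ ∧
      ∀ H : EuclideanSpace ℝ (Fin d) → ℝ, BddLip H →
        ‖∫ y in ω, fderiv ℝ (fun x => B.bump k x * H x) y v‖ₑ ≤ C * ∫⁻ y, ‖H y‖ₑ ∂surface ω := by
  obtain ⟨C, hC, h⟩ := (B.chart k).exists_enorm_integral_fderiv_below_le
  refine ⟨C * ENNReal.ofReal ‖v‖, ENNReal.mul_ne_top hC ENNReal.ofReal_ne_top, fun H hH => ?_⟩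
  set G : EuclideanSpace ℝ (Fin d) → ℝ := fun y => B.bump k y * H y with hGdef
  have hGb : BddLip G := (B.bddLip_bump k).mul hH
  obtain ⟨⟨L, hL⟩, -⟩ := id hGb
  have hGc : HasCompactSupport G := (B.hasCompactSupport_bump k).mul_right
  have hGt : tsupport G ⊆ Metric.ball (B.center k) (B.radius k) :=
    (tsupport_mul_subset_left).trans (B.tsupport_bump_subset_ball k)
  have hset : ∫ y in ω, fderiv ℝ G y v
      = ∫ y in {y | (B.chart k).height y < 0}, fderiv ℝ G y v := by
    have hbm : MeasurableSet {y | (B.chart k).height y < 0} :=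
      (B.chart k).continuous_height.measurable measurableSet_Iio
    rw [← integral_indicator ho.measurableSet, ← integral_indicator hbm]
    congr 1
    ext y
    by_cases hy : y ∈ Metric.ball (B.center k) (B.radius k)
    · have := (B.fits k).mem_iff y hy
      by_cases hyω : y ∈ ω
      · rw [indicator_of_mem hyω, indicator_of_mem (by exact this.1 hyω)]
      · rw [indicator_of_notMem hyω, indicator_of_notMem (by exact fun h0 => hyω (this.2 h0))]
    · have h0 : fderiv ℝ G y = 0 := fderiv_of_notMem_tsupport ℝ fun hmem => hy (hGt hmem)
      simp only [indicator, h0]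
      simp
  rw [hset]
  refine (h G L hL hGc v).trans (mul_le_mul_right ?_ _)
  have hGm : Measurable fun y => ‖G y‖ₑ := hGb.continuous.measurable.enorm
  refine ((B.chart k).lintegral_foot_le hGm).trans ?_
  rw [← B.lintegral_frontier_eq ho k _ fun y hy => by
    rw [image_eq_zero_of_notMem_tsupport fun hmem => hy (hGt hmem), enorm_zero], surface]
  refine lintegral_mono fun y => ?_
  rw [hGdef, enorm_mul]
  refine mul_le_of_le_one_left zero_le ?_
  rw [Real.enorm_of_nonneg (B.bump_nonneg k y)]
  exact ENNReal.ofReal_le_one.2 (B.bump_le_one k y)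

/-- Green's estimate for a derivative over `ω`. -/
theorem IsInclusion.exists_enorm_integral_fderiv_le (hω : IsInclusion ω)
    (v : EuclideanSpace ℝ (Fin d)) : ∃ C : ENNReal, C ≠ ⊤ ∧
      ∀ H : EuclideanSpace ℝ (Fin d) → ℝ, BddLip H →
        ‖∫ y in ω, fderiv ℝ H y v‖ₑ ≤ C * ∫⁻ y, ‖H y‖ₑ ∂surface ω := by
  obtain ⟨B⟩ := hω.nonempty_boundaryCover
  choose C hC h using fun k => B.exists_enorm_integral_bump_le hω.isOpen k v
  refine ⟨∑ k, C k, by simpa using hC, fun H hH => ?_⟩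
  have hic : HasCompactSupport B.inner :=
    Metric.isCompact_of_isClosed_isBounded (isClosed_tsupport _)
      (isBounded_cell.subset (B.tsupport_inner.trans (subset_closure.trans hω.closure_subset)))
  have hib : BddLip B.inner := BddLip.of_contDiff B.contDiff_inner hic
  have hG0c : HasCompactSupport fun x => B.inner x * H x := hic.mul_right
  obtain ⟨⟨L0, hL0⟩, -⟩ := hib.mul hH
  -- The interior piece of the partition has support inside ω and hence contributes no boundary
  -- term.
  have hzero : ∫ y in ω, fderiv ℝ (fun x => B.inner x * H x) y v = 0 := by
    rw [← integral_fderiv_eq_zero (ν := volume) hL0 hG0c v]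
    refine setIntegral_eq_integral_of_forall_compl_eq_zero fun y hy => ?_
    rw [fderiv_of_notMem_tsupport ℝ fun hmem =>
      hy (B.tsupport_inner (tsupport_mul_subset_left hmem))]
    rfl
  have hcb : ∀ k, HasCompactSupport fun x => B.bump k x * H x := fun k =>
    (B.hasCompactSupport_bump k).mul_right
  choose L hL using fun k => ((B.bddLip_bump k).mul hH).1
  have hsplit : ∫ y in ω, fderiv ℝ H y v = (∫ y in ω, fderiv ℝ (fun x => B.inner x * H x) y v)
      + ∑ k, ∫ y in ω, fderiv ℝ (fun x => B.bump k x * H x) y v := by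
    rw [← integral_finsetSum _ fun k _ => (integrable_fderiv_apply (hL k) (hcb k) v).integrableOn,
      ← integral_add (integrable_fderiv_apply hL0 hG0c v).integrableOn
        (integrable_finsetSum _ fun k _ => (integrable_fderiv_apply (hL k) (hcb k) v).integrableOn)]
    refine setIntegral_congr_ae hω.isOpen.measurableSet ?_
    filter_upwards [hL0.ae_differentiableAt, ae_all_iff.2 fun k => (hL k).ae_differentiableAt]
      with y h1 h2 hy
    have heq : H =ᶠ[𝓝 y] fun x => B.inner x * H x + ∑ k, B.bump k x * H x := by
      filter_upwards [hω.isOpen.mem_nhds hy] with x hx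
      rw [← Finset.sum_mul, ← add_mul, B.sum_eq_one x (subset_closure hx), one_mul]
    rw [heq.fderiv_eq, fderiv_fun_add h1 (DifferentiableAt.fun_sum fun k _ => h2 k),
      fderiv_fun_sum fun k _ => h2 k]
    simp
  rw [hsplit, hzero, zero_add, Finset.sum_mul]
  refine (enorm_sum_le _ _).trans (Finset.sum_le_sum fun k _ => h k H hH)

end TraceEstimate

/-! ### Existence and uniqueness of traces -/

section Trace

variable {d m : ℕ} {ω : Set (EuclideanSpace ℝ (Fin d))}

theorem sq_add_sq_le_add_sq (a b : ENNReal) : a ^ 2 + b ^ 2 ≤ (a + b) ^ 2 := by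
  rw [add_sq]
  calc a ^ 2 + b ^ 2 ≤ a ^ 2 + 2 * a * b + b ^ 2 := by
        gcongr
        exact le_self_add
    _ = _ := rfl

/-- The trace estimate in terms of norms. -/
theorem IsInclusion.exists_eLpNorm_surface_le (hω : IsInclusion ω) (m : ℕ) :
    ∃ C : ENNReal, C ≠ ⊤ ∧
      ∀ f : EuclideanSpace ℝ (Fin d) → EuclideanSpace ℝ (Fin m), BddLip f →
        eLpNorm f 2 (surface ω) ≤ C * (eLpNorm f 2 (volume.restrict (cell d \ ω))
          + eLpNorm (classicalGrad f) 2 (volume.restrict (cell d \ ω))) := by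
  obtain ⟨C, hC, h⟩ := hω.exists_lintegral_frontier_le m
  -- The estimate available is between squares, and C ≤ (max 1 C)² spares a square root.
  refine ⟨max 1 C, max_ne_top (by simp) hC, fun f hf => ?_⟩
  refine (ENNReal.pow_le_pow_left_iff (n := 2) two_ne_zero).1 ?_
  rw [eLpNorm_two_sq, mul_pow]
  refine (h f hf).trans ?_
  rw [lintegral_add_left (hf.continuous.measurable.enorm.pow_const 2), ← eLpNorm_two_sq,
    ← eLpNorm_two_sq]
  refine mul_le_mul' ?_ (sq_add_sq_le_add_sq _ _)
  calc C ≤ max 1 C := le_max_right _ _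
    _ ≤ max 1 C ^ 2 := le_self_pow₀ (le_max_left _ _) two_ne_zero

/-- Translates the two cell conditions in `HasTrace` into norm convergence in H^1. -/
theorem tendsto_H1_iff {w : ℕ → H1 d m}
    {f : ℕ → EuclideanSpace ℝ (Fin d) → EuclideanSpace ℝ (Fin m)}
    (hw : ∀ n, Represents (w n) (f n)) (v : H1 d m) :
    Tendsto w atTop (𝓝 v) ↔
      Tendsto (fun n => eLpNorm (fun y => f n y - sobVal v y) 2 (volume.restrict (cell d)))
        atTop (𝓝 0) ∧
      Tendsto (fun n => eLpNorm (fun y => classicalGrad (f n) y - sobGrad v y) 2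
        (volume.restrict (cell d))) atTop (𝓝 0) := by
  have e1 : ∀ n, eLpNorm (fun y => f n y - sobVal v y) 2 (volume.restrict (cell d))
      = ‖sobVal (w n) - sobVal v‖ₑ := fun n => by
    rw [Lp.enorm_def]
    refine eLpNorm_congr_ae ?_
    filter_upwards [(hw n).1, Lp.coeFn_sub (sobVal (w n)) (sobVal v)] with y h1 h2
    rw [h2, Pi.sub_apply, h1]
  have e2 : ∀ n, eLpNorm (fun y => classicalGrad (f n) y - sobGrad v y) 2
      (volume.restrict (cell d)) = ‖sobGrad (w n) - sobGrad v‖ₑ := fun n => by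
    rw [Lp.enorm_def]
    refine eLpNorm_congr_ae ?_
    filter_upwards [(hw n).2, Lp.coeFn_sub (sobGrad (w n)) (sobGrad v)] with y h1 h2
    rw [h2, Pi.sub_apply, h1]
  simp_rw [e1, e2]
  constructor
  · intro h
    have h1 := ((valCLM d m).continuous.tendsto v).comp h
    have h2 := ((gradCLM d m).continuous.tendsto v).comp h
    constructor
    · have := (continuous_enorm.tendsto _).comp (tendsto_sub_nhds_zero_iff.2 h1)
      rwa [enorm_zero] at this
    · have := (continuous_enorm.tendsto _).comp (tendsto_sub_nhds_zero_iff.2 h2)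
      rwa [enorm_zero] at this
  · rintro ⟨h1, h2⟩
    have h1' : Tendsto (fun n => sobVal (w n)) atTop (𝓝 (sobVal v)) := by
      rw [tendsto_iff_edist_tendsto_0]
      simpa only [edist_eq_enorm_sub] using h1
    have h2' : Tendsto (fun n => sobGrad (w n)) atTop (𝓝 (sobGrad v)) := by
      rw [tendsto_iff_edist_tendsto_0]
      simpa only [edist_eq_enorm_sub] using h2
    rw [tendsto_subtype_rng]
    have := ((WithLp.prod_continuous_toLp 2 (L2Val d m) (L2Grad d m)).tendsto _).comp
      (h1'.prodMk_nhds h2')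
    exact this

theorem memLp_surface_of_bddLip (hω : IsInclusion ω)
    {f : EuclideanSpace ℝ (Fin d) → EuclideanSpace ℝ (Fin m)} (hf : BddLip f) :
    MemLp f 2 (surface ω) := by
  have := hω.isFiniteMeasure_surface
  obtain ⟨-, C, hC⟩ := id hf
  exact MemLp.of_bound hf.continuous.aestronglyMeasurable C (Eventually.of_forall hC)

theorem eLpNorm_cell_sdiff_le {F : Type*} [NormedAddCommGroup F]
    (f : EuclideanSpace ℝ (Fin d) → F) :
    eLpNorm f 2 (volume.restrict (cell d \ ω)) ≤ eLpNorm f 2 (volume.restrict (cell d)) :=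
  eLpNorm_mono_measure f (Measure.restrict_mono sdiff_subset le_rfl)

theorem Represents.eLpNorm_le {v : H1 d m}
    {f : EuclideanSpace ℝ (Fin d) → EuclideanSpace ℝ (Fin m)} (h : Represents v f) :
    eLpNorm f 2 (volume.restrict (cell d)) ≤ ‖v‖ₑ ∧
      eLpNorm (classicalGrad f) 2 (volume.restrict (cell d)) ≤ ‖v‖ₑ := by
  have h1 := h.enorm_sq
  rw [← eLpNorm_two_sq, ← eLpNorm_two_sq] at h1
  constructor
  · refine (ENNReal.pow_le_pow_left_iff (n := 2) two_ne_zero).1 ?_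
    rw [h1]
    exact le_self_add
  · refine (ENNReal.pow_le_pow_left_iff (n := 2) two_ne_zero).1 ?_
    rw [h1]
    exact le_add_self

theorem IsInclusion.exists_eLpNorm_surface_le_enorm (hω : IsInclusion ω) (m : ℕ) :
    ∃ C : ENNReal, C ≠ ⊤ ∧ ∀ (f : EuclideanSpace ℝ (Fin d) → EuclideanSpace ℝ (Fin m))
      (v : H1 d m), BddLip f → Represents v f → eLpNorm f 2 (surface ω) ≤ C * ‖v‖ₑ := by
  obtain ⟨C, hC, h⟩ := hω.exists_eLpNorm_surface_le m
  refine ⟨C * 2, ENNReal.mul_ne_top hC (by simp), fun f v hf hv => (h f hf).trans ?_⟩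
  rw [mul_assoc, two_mul]
  gcongr
  · exact (eLpNorm_cell_sdiff_le f).trans hv.eLpNorm_le.1
  · exact (eLpNorm_cell_sdiff_le _).trans hv.eLpNorm_le.2

/-- A bounded Lipschitz representative restricts to the trace. -/
theorem Represents.hasTrace (hω : IsInclusion ω) {v : H1 d m}
    {f : EuclideanSpace ℝ (Fin d) → EuclideanSpace ℝ (Fin m)} (hv : Represents v f)
    (hf : BddLip f) {g : L2Bdry ω m} (hg : g =ᵐ[surface ω] f) : HasTrace ω v g := by
  obtain ⟨C, hC, h⟩ := hω.exists_eLpNorm_surface_le_enorm m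
  obtain ⟨F, w, hF, hw, hlim⟩ := exists_smooth_tendsto v
  obtain ⟨l1, l2⟩ := (tendsto_H1_iff hw v).1 hlim
  refine ⟨F, hF, l1, l2, ?_⟩
  have hl : Tendsto (fun n => C * ‖w n - v‖ₑ) atTop (𝓝 0) := by
    have h1 : Tendsto (fun n => ‖w n - v‖ₑ) atTop (𝓝 0) := by
      simpa only [edist_eq_enorm_sub] using tendsto_iff_edist_tendsto_0.1 hlim
    have h2 := ENNReal.Tendsto.const_mul (a := C) h1 (Or.inr hC)
    rwa [mul_zero] at h2
  refine tendsto_of_tendsto_of_tendsto_of_le_of_le tendsto_const_nhds hl (fun _ => zero_le) fun n => ?_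
  have hFb := (hF n).2.bddLip (hF n).1
  -- Any smooth approximation of v will do: the trace estimate applied to its difference with f
  -- forces convergence on the boundary.
  refine le_trans (le_of_eq (eLpNorm_congr_ae ?_)) (h _ _ (hFb.sub hf) ((hw n).sub hv hFb hf))
  filter_upwards [hg] with y hy
  rw [hy]

theorem eLpNorm_le_of_tendsto_sub {X F : Type*} [MeasurableSpace X] [NormedAddCommGroup F]
    {μ : Measure X} {f : ℕ → X → F} {g : X → F} (hf : ∀ n, AEStronglyMeasurable (f n) μ)
    (hg : AEStronglyMeasurable g μ) (n : ℕ) :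
    eLpNorm g 2 μ ≤ eLpNorm (f n) 2 μ + eLpNorm (fun x => f n x - g x) 2 μ ∧
    eLpNorm (f n) 2 μ ≤ eLpNorm g 2 μ + eLpNorm (fun x => f n x - g x) 2 μ := by
  constructor
  · have h : g = f n - fun x => f n x - g x := by ext x; simp
    conv_lhs => rw [h]
    exact eLpNorm_sub_le (hf n) ((hf n).sub hg) (by norm_num)
  · have h : f n = g + fun x => f n x - g x := by ext x; simp
    conv_lhs => rw [h]
    exact eLpNorm_add_le hg ((hf n).sub hg) (by norm_num)

/-- The trace is controlled by the function outside `ω`. -/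
theorem IsInclusion.exists_hasTrace_bound (hω : IsInclusion ω) (m : ℕ) :
    ∃ C : ENNReal, C ≠ ⊤ ∧ ∀ (v : H1 d m) (g : L2Bdry ω m), HasTrace ω v g →
      ‖g‖ₑ ≤ C * (eLpNorm (sobVal v) 2 (volume.restrict (cell d \ ω))
        + eLpNorm (sobGrad v) 2 (volume.restrict (cell d \ ω))) := by
  obtain ⟨C, hC, h⟩ := hω.exists_eLpNorm_surface_le m
  refine ⟨C, hC, fun v g ⟨f, hf, l1, l2, l3⟩ => ?_⟩
  have hle : volume.restrict (cell d \ ω)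
      ≤ (volume : Measure (EuclideanSpace ℝ (Fin d))).restrict (cell d) :=
    Measure.restrict_mono sdiff_subset le_rfl
  have hvm : AEStronglyMeasurable (sobVal v) (volume.restrict (cell d \ ω)) :=
    (Lp.aestronglyMeasurable _).mono_measure hle
  have hgm : AEStronglyMeasurable (sobGrad v) (volume.restrict (cell d \ ω)) :=
    (Lp.aestronglyMeasurable _).mono_measure hle
  have hlim := l3.add (ENNReal.Tendsto.const_mul (a := C)
    ((((tendsto_const_nhds (x := eLpNorm (sobVal v) 2 (volume.restrict (cell d \ ω)))).add l1)).add
      ((tendsto_const_nhds (x := eLpNorm (sobGrad v) 2 (volume.restrict (cell d \ ω)))).add l2))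
    (Or.inr hC))
  simp only [add_zero, zero_add] at hlim
  refine ge_of_tendsto' hlim fun n => ?_
  rw [Lp.enorm_def]
  have hfn := (hf n).1.continuous
  refine (eLpNorm_le_of_tendsto_sub (fun n => (hf n).1.continuous.aestronglyMeasurable)
    (Lp.aestronglyMeasurable g) n).1.trans ?_
  rw [add_comm]
  gcongr
  refine (h _ ((hf n).2.bddLip (hf n).1)).trans ?_
  gcongr
  · refine (eLpNorm_le_of_tendsto_sub (fun n => (hf n).1.continuous.aestronglyMeasurable)
      hvm n).2.trans ?_
    gcongr
  · refine (eLpNorm_le_of_tendsto_sub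
      (fun n => (continuous_classicalGrad (hf n).1).aestronglyMeasurable) hgm n).2.trans ?_
    gcongr

theorem eLpNorm_sobVal_le (v : H1 d m) :
    eLpNorm (sobVal v) 2 (volume.restrict (cell d)) ≤ ‖v‖ₑ := by
  refine (ENNReal.pow_le_pow_left_iff (n := 2) two_ne_zero).1 ?_
  rw [eLpNorm_two_sq, enorm_sq_H1]
  exact le_self_add

theorem eLpNorm_sobGrad_le (v : H1 d m) :
    eLpNorm (sobGrad v) 2 (volume.restrict (cell d)) ≤ ‖v‖ₑ := by
  refine (ENNReal.pow_le_pow_left_iff (n := 2) two_ne_zero).1 ?_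
  rw [eLpNorm_two_sq, enorm_sq_H1]
  exact le_add_self

theorem IsInclusion.exists_hasTrace_bound_norm (hω : IsInclusion ω) (m : ℕ) :
    ∃ C : ℝ, 0 ≤ C ∧ ∀ (v : H1 d m) (g : L2Bdry ω m), HasTrace ω v g → ‖g‖ ≤ C * ‖v‖ := by
  obtain ⟨C, hC, h⟩ := hω.exists_hasTrace_bound m
  refine ⟨(C * 2).toReal, ENNReal.toReal_nonneg, fun v g hvg => ?_⟩
  have h1 : ‖g‖ₑ ≤ C * 2 * ‖v‖ₑ := by
    refine (h v g hvg).trans ?_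
    rw [mul_assoc, two_mul]
    gcongr
    · exact (eLpNorm_cell_sdiff_le _).trans (eLpNorm_sobVal_le v)
    · exact (eLpNorm_cell_sdiff_le _).trans (eLpNorm_sobGrad_le v)
  have h2 := ENNReal.toReal_mono (ENNReal.mul_ne_top (ENNReal.mul_ne_top hC (by simp))
    enorm_ne_top) h1
  rwa [toReal_enorm, ENNReal.toReal_mul, toReal_enorm] at h2

theorem HasTrace.sub {v w : H1 d m} {g h : L2Bdry ω m} (hv : HasTrace ω v g)
    (hw : HasTrace ω w h) : HasTrace ω (v - w) (g - h) :=
  (traceGraph ω m).sub_mem (x := (v, g)) (y := (w, h)) hv hw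

theorem HasTrace.add {v w : H1 d m} {g h : L2Bdry ω m} (hv : HasTrace ω v g)
    (hw : HasTrace ω w h) : HasTrace ω (v + w) (g + h) :=
  (traceGraph ω m).add_mem (x := (v, g)) (y := (w, h)) hv hw

theorem HasTrace.smul {v : H1 d m} {g : L2Bdry ω m} (t : ℝ) (hv : HasTrace ω v g) :
    HasTrace ω (t • v) (t • g) :=
  (traceGraph ω m).smul_mem (x := (v, g)) t hv

/-- The graph of the trace is linear and satisfies a norm bound, so a trace of the zero function
vanishes. -/
theorem IsInclusion.hasTrace_unique (hω : IsInclusion ω) {v : H1 d m} {g h : L2Bdry ω m}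
    (hg : HasTrace ω v g) (hh : HasTrace ω v h) : g = h := by
  obtain ⟨C, -, hC⟩ := hω.exists_hasTrace_bound_norm m
  have h1 := hC _ _ (hg.sub hh)
  rw [sub_self, norm_zero, mul_zero] at h1
  exact sub_eq_zero.1 (norm_le_zero_iff.1 h1)

/-- Every smooth approximation of `v` has restrictions converging in `L^2` of the boundary. -/
theorem IsInclusion.exists_hasTrace (hω : IsInclusion ω) (v : H1 d m) :
    ∃ g : L2Bdry ω m, HasTrace ω v g := by
  obtain ⟨C, hC, h⟩ := hω.exists_eLpNorm_surface_le_enorm m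
  obtain ⟨f, w, hf, hw, hlim⟩ := exists_smooth_tendsto v
  have hb := fun n => (hf n).2.bddLip (hf n).1
  have hmem := fun n => memLp_surface_of_bddLip hω (hb n)
  let g : ℕ → L2Bdry ω m := fun n => (hmem n).toLp (f n)
  have hg : ∀ n k, ‖g n - g k‖ₑ ≤ C * ‖w n - w k‖ₑ := fun n k => by
    rw [Lp.enorm_def]
    refine le_trans (le_of_eq (eLpNorm_congr_ae ?_))
      (h _ _ ((hb n).sub (hb k)) ((hw n).sub (hw k) (hb n) (hb k)))
    filter_upwards [Lp.coeFn_sub (g n) (g k), (hmem n).coeFn_toLp, (hmem k).coeFn_toLp]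
      with y h1 h2 h3
    rw [h1, Pi.sub_apply, h2, h3]
  have hcauchy : CauchySeq g := by
    have hwc := hlim.cauchySeq
    rw [EMetric.cauchySeq_iff] at hwc ⊢
    intro ε hε
    have hC1 : C + 1 ≠ ⊤ := by simp [hC]
    -- Division by C + 1 because C itself may be zero.
    obtain ⟨N, hN⟩ := hwc (ε / (C + 1)) (ENNReal.div_pos hε.ne' hC1)
    refine ⟨N, fun n hn k hk => ?_⟩
    have h1 := hN n hn k hk
    rw [edist_eq_enorm_sub] at h1 ⊢
    refine lt_of_le_of_lt (hg n k) ?_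
    refine lt_of_le_of_lt (mul_le_mul_left (le_self_add (b := 1)) _) ?_
    rwa [mul_comm, ← ENNReal.lt_div_iff_mul_lt (Or.inl (by simp)) (Or.inl hC1)]
  obtain ⟨g0, hg0⟩ := cauchySeq_tendsto_of_complete hcauchy
  obtain ⟨l1, l2⟩ := (tendsto_H1_iff hw v).1 hlim
  refine ⟨g0, f, hf, l1, l2, ?_⟩
  rw [tendsto_iff_edist_tendsto_0] at hg0
  refine hg0.congr fun n => ?_
  rw [edist_eq_enorm_sub, Lp.enorm_def]
  refine eLpNorm_congr_ae ?_
  filter_upwards [Lp.coeFn_sub (g n) g0, (hmem n).coeFn_toLp] with y h1 h2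
  rw [h1, Pi.sub_apply, h2]

theorem IsInclusion.existsUnique_hasTrace (hω : IsInclusion ω) (v : H1 d m) :
    ∃! g : L2Bdry ω m, HasTrace ω v g := by
  obtain ⟨g, hg⟩ := hω.exists_hasTrace v
  exact ⟨g, hg, fun h hh => hω.hasTrace_unique hh hg⟩

end Trace

/-! ### Cutting a function with zero trace at the boundary -/

section Cut

variable {d m : ℕ} {ω : Set (EuclideanSpace ℝ (Fin d))}

theorem IsInclusion.subset_cell (hω : IsInclusion ω) : ω ⊆ cell d :=
  subset_closure.trans hω.closure_subset

theorem exists_clm_coord_setIntegral (hs : MeasurableSet ω) (hsub : ω ⊆ cell d) {ι : Type*}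
    [Fintype ι] [DecidableEq ι] (a : ι) {k : EuclideanSpace ℝ (Fin d) → ℝ} (hk : Continuous k) :
    ∃ L : Lp (EuclideanSpace ℝ ι) 2
        ((volume : Measure (EuclideanSpace ℝ (Fin d))).restrict (cell d)) →L[ℝ] ℝ,
      ∀ u, L u = ∫ y in ω, u y a * k y := by
  obtain ⟨L, hL⟩ := exists_clm_coord a ((memLp_cell_of_continuous hk 2).indicator hs)
  refine ⟨L, fun u => ?_⟩
  rw [hL, ← inter_eq_self_of_subset_right hsub, ← setIntegral_indicator hs,
    inter_eq_self_of_subset_right hsub]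
  congr 1
  ext y
  by_cases hy : y ∈ ω <;> simp [hy]

theorem lintegral_surface_le_eLpNorm {F : Type*} [NormedAddCommGroup F]
    {f : EuclideanSpace ℝ (Fin d) → F} (hf : Continuous f) :
    ∫⁻ y, ‖f y‖ₑ ∂surface ω ≤ eLpNorm f 2 (surface ω) * surface ω univ ^ (1 / 2 : ℝ) := by
  have h := eLpNorm_le_eLpNorm_mul_rpow_measure_univ (μ := surface ω) (f := f) (p := 1) (q := 2)
    (by norm_num) hf.aestronglyMeasurable
  rw [eLpNorm_one_eq_lintegral_enorm] at h
  convert h using 3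
  norm_num

theorem enorm_coord_le {ι : Type*} [Fintype ι] (x : EuclideanSpace ℝ ι) (a : ι) :
    ‖x a‖ₑ ≤ ‖x‖ₑ := by
  rw [← ofReal_norm, ← ofReal_norm]
  exact ENNReal.ofReal_le_ofReal (PiLp.norm_apply_le x a)

/-- Integration by parts in `ω` for a function with zero trace. -/
theorem HasTrace.setIntegral_weakGrad (hω : IsInclusion ω) {v : H1 d m}
    (hv : HasTrace ω v (0 : L2Bdry ω m)) {η : EuclideanSpace ℝ (Fin d) → ℝ}
    (hη : ContDiff ℝ (⊤ : ℕ∞) η) (hp : IsPeriodic η) (i : Fin d) (α : Fin m) :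
    (∫ y in ω, sobVal v y α * pderiv η i y) + ∫ y in ω, sobGrad v y (i, α) * η y = 0 := by
  have hms := hω.isOpen.measurableSet
  obtain ⟨f, hf, l1, l2, l3⟩ := hv
  choose w hw using fun n => exists_represents_of_periodic (hf n).1 (hf n).2
  have hlim := (tendsto_H1_iff hw v).2 ⟨l1, l2⟩
  obtain ⟨L1, hL1⟩ := exists_clm_coord_setIntegral hms hω.subset_cell α (continuous_pderiv hη i)
  obtain ⟨L2, hL2⟩ := exists_clm_coord_setIntegral hms hω.subset_cell (i, α) hη.continuous
  have hL : Tendsto (fun n => L1 (sobVal (w n)) + L2 (sobGrad (w n))) atTop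
      (𝓝 (L1 (sobVal v) + L2 (sobGrad v))) :=
    (((L1.comp (valCLM d m)).continuous.tendsto v).comp hlim).add
      (((L2.comp (gradCLM d m)).continuous.tendsto v).comp hlim)
  rw [← hL1, ← hL2]
  have hfb := fun n => (hf n).2.bddLip (hf n).1
  have hηb := hp.bddLip hη
  have hle : volume.restrict ω
      ≤ (volume : Measure (EuclideanSpace ℝ (Fin d))).restrict (cell d) :=
    Measure.restrict_mono hω.subset_cell le_rfl
  have hn : ∀ n, L1 (sobVal (w n)) + L2 (sobGrad (w n))
      = ∫ y in ω, fderiv ℝ (fun x => f n x α * η x) y (EuclideanSpace.single i 1) := by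
    intro n
    rw [hL1, hL2, ← integral_add
      ((integrable_coord_mul _ _ (continuous_pderiv hη i)).mono_set hω.subset_cell)
      ((integrable_coord_mul _ _ hη.continuous).mono_set hω.subset_cell)]
    refine integral_congr_ae ?_
    filter_upwards [(hw n).1.filter_mono (ae_mono hle), (hw n).2.filter_mono (ae_mono hle)]
      with y h1 h2
    have hd1 := (hf n).1.differentiable (by simp) y
    have hd2 := hη.differentiable (by simp) y
    have hd3 : HasFDerivAt (fun x => f n x α)
        ((EuclideanSpace.proj α : EuclideanSpace ℝ (Fin m) →L[ℝ] ℝ).comp (fderiv ℝ (f n) y)) y :=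
      (EuclideanSpace.proj α : EuclideanSpace ℝ (Fin m) →L[ℝ] ℝ).hasFDerivAt.comp y
        hd1.hasFDerivAt
    rw [h1, h2, (hd3.fun_mul hd2.hasFDerivAt).fderiv]
    simp [classicalGrad, pderiv, mul_comm]
  refine tendsto_nhds_unique hL ?_
  -- For the smooth approximations the two integrals combine into the integral over ω of a
  -- derivative. Green's estimate bounds it by an L^1 norm on the boundary, and finite surface
  -- measure bounds that by the L^2 norm, which tends to zero.
  obtain ⟨C, hC, hbd⟩ := hω.exists_enorm_integral_fderiv_le
    (EuclideanSpace.single i (1 : ℝ))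
  obtain ⟨-, M, hM⟩ := hηb
  have hfin := hω.isFiniteMeasure_surface
  have hS : surface ω univ ^ (1 / 2 : ℝ) ≠ ⊤ :=
    ENNReal.rpow_ne_top_of_nonneg (by norm_num) (measure_ne_top _ _)
  have l3' : Tendsto (fun n => eLpNorm (f n) 2 (surface ω)) atTop (𝓝 0) := by
    refine l3.congr fun n => eLpNorm_congr_ae ?_
    filter_upwards [Lp.coeFn_zero (EuclideanSpace ℝ (Fin m)) 2 (surface ω)] with y hy
    rw [hy]
    simp
  have hz : Tendsto (fun n => C * (eLpNorm (f n) 2 (surface ω)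
      * surface ω univ ^ (1 / 2 : ℝ) * ENNReal.ofReal M)) atTop (𝓝 0) := by
    have h1 := ENNReal.Tendsto.mul_const (b := surface ω univ ^ (1 / 2 : ℝ)) l3' (Or.inr hS)
    have h2 := ENNReal.Tendsto.mul_const (b := ENNReal.ofReal M) h1 (Or.inr ENNReal.ofReal_ne_top)
    have h3 := ENNReal.Tendsto.const_mul (a := C) h2 (Or.inr hC)
    simpa using h3
  rw [tendsto_iff_edist_tendsto_0]
  refine tendsto_of_tendsto_of_tendsto_of_le_of_le tendsto_const_nhds hz (fun _ => zero_le)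
    fun n => ?_
  rw [edist_zero_right, hn]
  refine (hbd _ (bddLip_coord_mul (hfb n) (hp.bddLip hη) α)).trans ?_
  refine mul_le_mul_right ?_ C
  refine le_trans ?_ (mul_le_mul_left (lintegral_surface_le_eLpNorm (hf n).1.continuous) _)
  rw [← lintegral_mul_const _ (hf n).1.continuous.measurable.enorm]
  refine lintegral_mono fun y => ?_
  rw [enorm_mul]
  refine mul_le_mul' (enorm_coord_le _ _) ?_
  rw [← ofReal_norm]
  exact ENNReal.ofReal_le_ofReal (hM y)

/-- A function with zero trace can be cut off outside `ω`. -/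
theorem HasTrace.exists_cut (hω : IsInclusion ω) {v : H1 d m}
    (hv : HasTrace ω v (0 : L2Bdry ω m)) :
    ∃ w : H1 d m, HasTrace ω w (0 : L2Bdry ω m) ∧
      sobGrad w =ᵐ[volume.restrict (cell d)] ω.indicator (sobGrad v) := by
  have hms := hω.isOpen.measurableSet
  have h1 := (Lp.memLp (sobVal v)).indicator hms
  have h2 := (Lp.memLp (sobGrad v)).indicator hms
  have hset : ∀ F : EuclideanSpace ℝ (Fin d) → ℝ,
      ∫ y in cell d, ω.indicator F y = ∫ y in ω, F y := fun F => by
    rw [setIntegral_indicator hms, inter_eq_self_of_subset_right hω.subset_cell]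
  -- Zero trace removes the boundary term in ω, so the extensions by zero of v and of its gradient
  -- satisfy the weak gradient identity on the whole cell.
  have hw : IsWeakGrad (h1.toLp _) (h2.toLp _) := by
    intro η hη hp i α
    have e1 : ∫ y in cell d, h1.toLp _ y α * pderiv η i y
        = ∫ y in ω, sobVal v y α * pderiv η i y := by
      rw [← hset]
      refine integral_congr_ae ?_
      filter_upwards [h1.coeFn_toLp] with y hy
      rw [hy]
      by_cases hyω : y ∈ ω <;> simp [hyω]
    have e2 : ∫ y in cell d, h2.toLp _ y (i, α) * η y = ∫ y in ω, sobGrad v y (i, α) * η y := by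
      rw [← hset]
      refine integral_congr_ae ?_
      filter_upwards [h2.coeFn_toLp] with y hy
      rw [hy]
      by_cases hyω : y ∈ ω <;> simp [hyω]
    rw [e1, e2]
    linarith [hv.setIntegral_weakGrad hω hη hp i α]
  let w : H1 d m := ⟨WithLp.toLp 2 (h1.toLp _, h2.toLp _), hw⟩
  have w1 : sobVal w =ᵐ[volume.restrict (cell d)] ω.indicator (sobVal v) := h1.coeFn_toLp
  have w2 : sobGrad w =ᵐ[volume.restrict (cell d)] ω.indicator (sobGrad v) := h2.coeFn_toLp
  refine ⟨w, ?_, w2⟩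
  have hle : volume.restrict (cell d \ ω)
      ≤ (volume : Measure (EuclideanSpace ℝ (Fin d))).restrict (cell d) :=
    Measure.restrict_mono sdiff_subset le_rfl
  have hmsd : MeasurableSet (cell d \ ω) := measurableSet_cell.diff hms
  have z1 : eLpNorm (sobVal w) 2 (volume.restrict (cell d \ ω)) = 0 := by
    refine (eLpNorm_congr_ae ?_).trans eLpNorm_zero
    filter_upwards [w1.filter_mono (ae_mono hle), ae_restrict_mem hmsd] with y hy hyω
    rw [hy]
    simp [hyω.2]
  have z2 : eLpNorm (sobGrad w) 2 (volume.restrict (cell d \ ω)) = 0 := by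
    refine (eLpNorm_congr_ae ?_).trans eLpNorm_zero
    filter_upwards [w2.filter_mono (ae_mono hle), ae_restrict_mem hmsd] with y hy hyω
    rw [hy]
    simp [hyω.2]
  -- The trace bound uses the exterior only, where the cut function is zero; hence its trace is
  -- zero.
  obtain ⟨C, -, hC⟩ := hω.exists_hasTrace_bound m
  obtain ⟨g, hg⟩ := hω.exists_hasTrace w
  have hb := hC w g hg
  rw [z1, z2, add_zero, mul_zero, nonpos_iff_eq_zero, enorm_eq_zero] at hb
  rwa [hb] at hg

/-- Constants belong to `H^1`, with zero gradient. -/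
theorem exists_const_H1 (hω : IsInclusion ω) (c : EuclideanSpace ℝ (Fin m)) :
    ∃ (v : H1 d m) (g : L2Bdry ω m), Represents v (fun _ => c) ∧ sobGrad v = 0 ∧
      HasTrace ω v g ∧ g =ᵐ[surface ω] fun _ => c := by
  obtain ⟨v, hv⟩ := exists_represents_of_periodic (f := fun _ : EuclideanSpace ℝ (Fin d) => c)
    contDiff_const (fun _ _ => rfl)
  have hm := memLp_surface_of_bddLip hω (bddLip_const c)
  refine ⟨v, hm.toLp _, hv, ?_, hv.hasTrace hω (bddLip_const c) hm.coeFn_toLp, hm.coeFn_toLp⟩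
  refine Lp.ext ?_
  filter_upwards [hv.2, Lp.coeFn_zero (EuclideanSpace ℝ (Fin d × Fin m)) 2
    ((volume : Measure (EuclideanSpace ℝ (Fin d))).restrict (cell d))] with y h1 h2
  rw [h1, h2, classicalGrad_const]
  rfl

end Cut

/-! ### Poincaré inequalities -/

section Poincare

open Metric

variable {d m : ℕ}

/-- The fundamental theorem of calculus along the segment, followed by Cauchy–Schwarz on the unit
interval. -/
theorem enorm_sub_sq_le_lintegral_fderiv {V F : Type*} [NormedAddCommGroup V] [NormedSpace ℝ V]
    [NormedAddCommGroup F] [NormedSpace ℝ F] [CompleteSpace F] {f : V → F} (hf : ContDiff ℝ 1 f)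
    (x v : V) :
    ‖f (x + v) - f x‖ₑ ^ 2 ≤ ‖v‖ₑ ^ 2 * ∫⁻ t in Ioc (0 : ℝ) 1, ‖fderiv ℝ f (x + t • v)‖ₑ ^ 2 := by
  have hc : Continuous fun t : ℝ => fderiv ℝ f (x + t • v) :=
    (hf.continuous_fderiv (by simp)).comp (by fun_prop)
  have hderiv : ∀ t : ℝ, HasDerivAt (fun t : ℝ => f (x + t • v)) (fderiv ℝ f (x + t • v) v) t := by
    intro t
    have h1 : HasDerivAt (fun t : ℝ => x + t • v) v t := by
      simpa using ((hasDerivAt_id t).smul_const v).const_add x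
    exact ((hf.differentiable (by simp)) _).hasFDerivAt.comp_hasDerivAt t h1
  have h0 : f (x + v) - f x = ∫ t in (0 : ℝ)..1, fderiv ℝ f (x + t • v) v := by
    rw [intervalIntegral.integral_eq_sub_of_hasDerivAt (fun t _ => hderiv t)
      ((hc.clm_apply continuous_const).intervalIntegrable _ _)]
    simp
  have h1 : ‖f (x + v) - f x‖ₑ ≤ ‖v‖ₑ * ∫⁻ t in Ioc (0 : ℝ) 1, ‖fderiv ℝ f (x + t • v)‖ₑ := by
    rw [h0, intervalIntegral.integral_of_le zero_le_one, ← lintegral_const_mul' _ _ enorm_ne_top]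
    refine (enorm_integral_le_lintegral_enorm _).trans (lintegral_mono fun t => ?_)
    rw [mul_comm]
    exact ContinuousLinearMap.le_opENorm _ _
  have h2 : (∫⁻ t in Ioc (0 : ℝ) 1, ‖fderiv ℝ f (x + t • v)‖ₑ) ^ 2
      ≤ ∫⁻ t in Ioc (0 : ℝ) 1, ‖fderiv ℝ f (x + t • v)‖ₑ ^ 2 := by
    have h := eLpNorm_le_eLpNorm_mul_rpow_measure_univ (μ := volume.restrict (Ioc (0 : ℝ) 1))
      (f := fun t : ℝ => fderiv ℝ f (x + t • v)) (p := 1) (q := 2) (by norm_num)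
      hc.aestronglyMeasurable
    rw [eLpNorm_one_eq_lintegral_enorm] at h
    simp only [Measure.restrict_apply_univ, Real.volume_Ioc, sub_zero, ENNReal.ofReal_one,
      ENNReal.one_rpow, mul_one] at h
    rw [← eLpNorm_two_sq]
    gcongr
  refine (pow_le_pow_left' h1 2).trans ?_
  rw [mul_pow]
  gcongr

theorem continuous_enorm_sq {X F : Type*} [TopologicalSpace X] [NormedAddCommGroup F] {f : X → F}
    (hf : Continuous f) : Continuous fun x => ‖f x‖ₑ ^ 2 :=
  (ENNReal.continuous_pow 2).comp (continuous_enorm.comp hf)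

theorem enorm_add_sq_le {F : Type*} [NormedAddCommGroup F] (a b : F) :
    ‖a + b‖ₑ ^ 2 ≤ 2 * (‖a‖ₑ ^ 2 + ‖b‖ₑ ^ 2) := by
  refine (pow_le_pow_left' (enorm_add_le a b) 2).trans ?_
  have h := ENNReal.rpow_add_le_mul_rpow_add_rpow ‖a‖ₑ ‖b‖ₑ (p := 2) (by norm_num)
  norm_num at h
  exact h

/-- A Poincaré inequality on `U`, with the gradient integrated over `D`. -/
def PoincareOn (m : ℕ) (D U : Set (EuclideanSpace ℝ (Fin d))) : Prop :=
  ∃ C : ENNReal, C ≠ ⊤ ∧ ∀ f : EuclideanSpace ℝ (Fin d) → EuclideanSpace ℝ (Fin m),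
    ContDiff ℝ 1 f → ∃ c, ∫⁻ y in U, ‖f y - c‖ₑ ^ 2 ≤ C * ∫⁻ y in D, ‖fderiv ℝ f y‖ₑ ^ 2

theorem PoincareOn.mono {D U V : Set (EuclideanSpace ℝ (Fin d))} (h : PoincareOn m D U)
    (hVU : V ⊆ U) : PoincareOn m D V := by
  obtain ⟨C, hC, h⟩ := h
  refine ⟨C, hC, fun f hf => ?_⟩
  obtain ⟨c, hc⟩ := h f hf
  exact ⟨c, (lintegral_mono_set hVU).trans hc⟩

/-- On the overlap, of positive measure, f is close to both constants, so these are close to each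
other. The gradient is integrated over the same D throughout, which lets the inequality be chained
along overlapping sets. -/
theorem PoincareOn.union {D U V : Set (EuclideanSpace ℝ (Fin d))} (hU : PoincareOn m D U)
    (hV : PoincareOn m D V) (hUV : volume (U ∩ V) ≠ 0) (hVt : volume V ≠ ⊤) :
    PoincareOn m D (U ∪ V) := by
  obtain ⟨C1, hC1, h1⟩ := hU
  obtain ⟨C2, hC2, h2⟩ := hV
  have hUVt : volume (U ∩ V) ≠ ⊤ := measure_ne_top_of_subset inter_subset_right hVt
  refine ⟨C1 + 2 * (C2 + volume V * ((volume (U ∩ V))⁻¹ * (2 * (C1 + C2)))), ?_, fun f hf => ?_⟩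
  · have := ENNReal.inv_ne_top.2 hUV
    finiteness
  obtain ⟨a, ha⟩ := h1 f hf
  obtain ⟨b, hb⟩ := h2 f hf
  set I := ∫⁻ y in D, ‖fderiv ℝ f y‖ₑ ^ 2
  refine ⟨a, ?_⟩
  have hm : ∀ c, Measurable fun y => ‖f y - c‖ₑ ^ 2 := fun c =>
    (hf.continuous.sub continuous_const).measurable.enorm.pow_const 2
  have hab : ‖b - a‖ₑ ^ 2 ≤ (volume (U ∩ V))⁻¹ * (2 * (C1 + C2)) * I := by
    rw [mul_assoc, ← ENNReal.mul_le_iff_le_inv hUV hUVt]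
    calc volume (U ∩ V) * ‖b - a‖ₑ ^ 2 = ∫⁻ y in U ∩ V, ‖b - a‖ₑ ^ 2 := by
          rw [lintegral_const, Measure.restrict_apply_univ, mul_comm]
      _ ≤ ∫⁻ y in U ∩ V, 2 * (‖f y - a‖ₑ ^ 2 + ‖f y - b‖ₑ ^ 2) := by
          refine lintegral_mono fun y => ?_
          have := enorm_add_sq_le (f y - a) (-(f y - b))
          rw [enorm_neg] at this
          convert this using 3
          abel
      _ = 2 * ((∫⁻ y in U ∩ V, ‖f y - a‖ₑ ^ 2) + ∫⁻ y in U ∩ V, ‖f y - b‖ₑ ^ 2) := by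
          rw [lintegral_const_mul' _ _ (by finiteness), lintegral_add_left (hm a)]
      _ ≤ 2 * (C1 * I + C2 * I) := by
          gcongr
          · exact (lintegral_mono_set inter_subset_left).trans ha
          · exact (lintegral_mono_set inter_subset_right).trans hb
      _ = 2 * (C1 + C2) * I := by ring
  calc ∫⁻ y in U ∪ V, ‖f y - a‖ₑ ^ 2
      ≤ (∫⁻ y in U, ‖f y - a‖ₑ ^ 2) + ∫⁻ y in V, ‖f y - a‖ₑ ^ 2 := lintegral_union_le _ _ _
    _ ≤ C1 * I + ∫⁻ y in V, 2 * (‖f y - b‖ₑ ^ 2 + ‖b - a‖ₑ ^ 2) := by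
        gcongr with y
        have := enorm_add_sq_le (f y - b) (b - a)
        rwa [sub_add_sub_cancel] at this
    _ = C1 * I + 2 * ((∫⁻ y in V, ‖f y - b‖ₑ ^ 2) + volume V * ‖b - a‖ₑ ^ 2) := by
        rw [lintegral_const_mul' _ _ (by finiteness), lintegral_add_left (hm b), lintegral_const,
          Measure.restrict_apply_univ, mul_comm (‖b - a‖ₑ ^ 2)]
    _ ≤ C1 * I + 2 * (C2 * I + volume V * ((volume (U ∩ V))⁻¹ * (2 * (C1 + C2)) * I)) := by
        gcongr
    _ = _ := by ring

/-- A homothety of ratio s ≤ 1 centred in the convex set U maps U into itself, and s ≥ 1/2 keeps the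
Jacobian factor s^{-d} below 2^d. -/
theorem lintegral_homothety_le {U : Set (EuclideanSpace ℝ (Fin d))} (hU : Convex ℝ U)
    (hm : MeasurableSet U) {y : EuclideanSpace ℝ (Fin d)} (hy : y ∈ U) {s : ℝ} (hs : 1 / 2 ≤ s)
    (hs1 : s ≤ 1) {g : EuclideanSpace ℝ (Fin d) → ENNReal} (hg : Measurable g) :
    ∫⁻ x in U, g (y + s • (x - y)) ≤ 2 ^ d * ∫⁻ x in U, g x := by
  have hs0 : 0 < s := by linarith
  have hG : Measurable (U.indicator g) := hg.indicator hm
  calc ∫⁻ x in U, g (y + s • (x - y)) ≤ ∫⁻ x, U.indicator g (y + s • (x - y)) := by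
        rw [← lintegral_indicator hm]
        refine lintegral_mono fun x => ?_
        by_cases hx : x ∈ U
        · have : y + s • (x - y) ∈ U := hU.add_smul_sub_mem hy hx ⟨hs0.le, hs1⟩
          simp [hx, this]
        · simp [hx]
    _ = ∫⁻ x, U.indicator g (y + s • x) :=
        lintegral_sub_right_eq_self (fun x => U.indicator g (y + s • x)) y
    _ = ∫⁻ z, U.indicator g (y + z) ∂(Measure.map (s • ·) volume) := by
        rw [lintegral_map (f := fun z => U.indicator g (y + z))
          (hG.comp (measurable_const_add y)) (measurable_const_smul s)]
    _ = ENNReal.ofReal |(s ^ d)⁻¹| * ∫⁻ x in U, g x := by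
        rw [Measure.map_addHaar_smul _ hs0.ne', lintegral_smul_measure, smul_eq_mul,
          finrank_euclideanSpace_fin, lintegral_add_left_eq_self, lintegral_indicator hm]
    _ ≤ 2 ^ d * ∫⁻ x in U, g x := by
        gcongr
        rw [abs_of_pos (by positivity), ← inv_pow, ENNReal.ofReal_pow (by positivity)]
        gcongr
        rw [show (2 : ENNReal) = ENNReal.ofReal 2 by simp]
        refine ENNReal.ofReal_le_ofReal ?_
        rw [inv_le_comm₀ hs0 two_pos]
        linarith

/-- The Poincaré inequality on a bounded convex set. -/
theorem poincareOn_of_convex {D U : Set (EuclideanSpace ℝ (Fin d))} (hU : Convex ℝ U)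
    (hm : MeasurableSet U) (hb : Bornology.IsBounded U) (hUD : U ⊆ D) : PoincareOn m D U := by
  by_cases h0 : volume U = 0
  · refine ⟨0, ENNReal.zero_ne_top, fun f _ => ⟨0, ?_⟩⟩
    rw [Measure.restrict_eq_zero.2 h0]
    simp
  have ht : volume U ≠ ⊤ := hb.measure_lt_top.ne
  have : IsFiniteMeasure (volume.restrict U) := ⟨by simpa using ht.lt_top⟩
  obtain ⟨R, hR⟩ := isBounded_iff.1 hb
  refine ⟨4 * (ENNReal.ofReal R ^ 2 * 2 ^ d), by finiteness, fun f hf => ?_⟩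
  set I := ∫⁻ y in U, ‖fderiv ℝ f y‖ₑ ^ 2 with hI
  have hID : I ≤ ∫⁻ y in D, ‖fderiv ℝ f y‖ₑ ^ 2 := lintegral_mono_set hUD
  have hfc := hf.continuous
  have hdc := hf.continuous_fderiv (by simp)
  -- Both f x and f y are compared with the value at the midpoint. The half segment from x is then
  -- made of homotheties centred at y of ratio at least 1/2, which avoids the degenerate ratio 0;
  -- the other half follows by exchanging x and y.
  let J : EuclideanSpace ℝ (Fin d) → EuclideanSpace ℝ (Fin d) → ENNReal := fun x y =>
    ‖f ((1 / 2 : ℝ) • (x + y)) - f x‖ₑ ^ 2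
  have hJc : Continuous fun p : EuclideanSpace ℝ (Fin d) × EuclideanSpace ℝ (Fin d) => J p.1 p.2 := by
    have : Continuous fun p : EuclideanSpace ℝ (Fin d) × EuclideanSpace ℝ (Fin d) =>
        f ((1 / 2 : ℝ) • (p.1 + p.2)) - f p.1 :=
      (hfc.comp (by fun_prop)).sub (hfc.comp continuous_fst)
    exact continuous_enorm_sq this
  have hJ : ∀ y ∈ U, ∫⁻ x in U, J x y ≤ ENNReal.ofReal R ^ 2 * 2 ^ d * I := by
    intro y hy
    have hmeas : Measurable fun p : EuclideanSpace ℝ (Fin d) × ℝ =>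
        ‖fderiv ℝ f (y + (1 - p.2 / 2) • (p.1 - y))‖ₑ ^ 2 :=
      (continuous_enorm_sq (hdc.comp (by fun_prop))).measurable
    calc ∫⁻ x in U, J x y
        ≤ ∫⁻ x in U, ENNReal.ofReal R ^ 2 * ∫⁻ t in Ioc (0 : ℝ) 1,
            ‖fderiv ℝ f (y + (1 - t / 2) • (x - y))‖ₑ ^ 2 := by
          refine setLIntegral_mono' hm fun x hx => ?_
          have h := enorm_sub_sq_le_lintegral_fderiv hf x ((1 / 2 : ℝ) • (y - x))
          have e1 : x + (1 / 2 : ℝ) • (y - x) = (1 / 2 : ℝ) • (x + y) := by module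
          have e2 : ∀ t : ℝ, x + t • (1 / 2 : ℝ) • (y - x) = y + (1 - t / 2) • (x - y) := by
            intro t; module
          rw [e1] at h
          simp_rw [e2] at h
          refine h.trans ?_
          gcongr
          rw [← ofReal_norm]
          refine ENNReal.ofReal_le_ofReal ?_
          rw [norm_smul, ← dist_eq_norm]
          have h3 := hR hy hx
          have h4 : 0 ≤ dist y x := dist_nonneg
          norm_num
          linarith
      _ = ENNReal.ofReal R ^ 2 * ∫⁻ x in U, ∫⁻ t in Ioc (0 : ℝ) 1,
            ‖fderiv ℝ f (y + (1 - t / 2) • (x - y))‖ₑ ^ 2 := by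
          rw [lintegral_const_mul' _ _ (by finiteness)]
      _ = ENNReal.ofReal R ^ 2 * ∫⁻ t in Ioc (0 : ℝ) 1, ∫⁻ x in U,
            ‖fderiv ℝ f (y + (1 - t / 2) • (x - y))‖ₑ ^ 2 := by
          rw [lintegral_lintegral_swap hmeas.aemeasurable]
      _ ≤ ENNReal.ofReal R ^ 2 * ∫⁻ t in Ioc (0 : ℝ) 1, 2 ^ d * I := by
          refine mul_le_mul_right (setLIntegral_mono' measurableSet_Ioc fun t ht => ?_) _
          exact lintegral_homothety_le hU hm hy (by linarith [ht.2]) (by linarith [ht.1])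
            (g := fun z => ‖fderiv ℝ f z‖ₑ ^ 2) (continuous_enorm_sq hdc).measurable
      _ = _ := by simp [mul_assoc]
  have hsum : ∫⁻ y in U, ∫⁻ x in U, ‖f x - f y‖ₑ ^ 2
      ≤ volume U * (4 * (ENNReal.ofReal R ^ 2 * 2 ^ d) * I) := by
    have hswap : ∫⁻ y in U, ∫⁻ x in U, J y x = ∫⁻ y in U, ∫⁻ x in U, J x y :=
      lintegral_lintegral_swap hJc.measurable.aemeasurable
    calc ∫⁻ y in U, ∫⁻ x in U, ‖f x - f y‖ₑ ^ 2
        ≤ ∫⁻ y in U, ∫⁻ x in U, 2 * (J x y + J y x) := by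
          refine lintegral_mono fun y => lintegral_mono fun x => ?_
          have h := enorm_add_sq_le (-(f ((1 / 2 : ℝ) • (x + y)) - f x))
            (f ((1 / 2 : ℝ) • (y + x)) - f y)
          rw [enorm_neg, add_comm y x] at h
          refine le_trans (le_of_eq ?_) (h.trans (le_of_eq ?_))
          · congr 2
            abel
          · simp only [J, add_comm y x]
      _ = ∫⁻ y in U, 2 * ((∫⁻ x in U, J x y) + ∫⁻ x in U, J y x) := by
          refine lintegral_congr fun y => ?_
          have h1 : Measurable fun x => J x y :=
            (hJc.comp (continuous_id.prodMk continuous_const)).measurable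
          rw [lintegral_const_mul' _ _ (by finiteness), lintegral_add_left h1]
      _ = 2 * ((∫⁻ y in U, ∫⁻ x in U, J x y) + ∫⁻ y in U, ∫⁻ x in U, J y x) := by
          have h1 : Measurable fun y => ∫⁻ x in U, J x y :=
            hJc.measurable.lintegral_prod_left'
          rw [lintegral_const_mul' _ _ (by finiteness), lintegral_add_left h1]
      _ = 4 * ∫⁻ y in U, ∫⁻ x in U, J x y := by rw [hswap]; ring
      _ ≤ 4 * ∫⁻ y in U, ENNReal.ofReal R ^ 2 * 2 ^ d * I :=
          mul_le_mul_right (setLIntegral_mono' hm hJ) _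
      _ = _ := by
          rw [lintegral_const, Measure.restrict_apply_univ]
          ring
  have hmf : Measurable fun y => ∫⁻ x in U, ‖f x - f y‖ₑ ^ 2 := by
    have hc : Continuous fun p : EuclideanSpace ℝ (Fin d) × EuclideanSpace ℝ (Fin d) =>
        ‖f p.1 - f p.2‖ₑ ^ 2 :=
      continuous_enorm_sq ((hfc.comp continuous_fst).sub (hfc.comp continuous_snd))
    exact hc.measurable.lintegral_prod_left'
  -- The constant is f y for some y at which the inner integral does not exceed its average over U.
  obtain ⟨y, -, hy⟩ := exists_le_setLAverage h0 ht hmf.aemeasurable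
  refine ⟨f y, (hy.trans ?_).trans (mul_le_mul_right hID _)⟩
  rw [setLAverage_eq]
  exact ENNReal.div_le_of_le_mul' hsum

/-- The Poincaré inequality extends from small sets to compact sets. -/
theorem poincareOn_of_local {D K : Set (EuclideanSpace ℝ (Fin d))} (hD : IsOpen D)
    (hc : IsConnected D) (hb : Bornology.IsBounded D) (hK : IsCompact K)
    (h : ∀ x ∈ K, ∃ V, IsOpen V ∧ x ∈ V ∧ (V ∩ D).Nonempty ∧ PoincareOn m D (V ∩ D)) :
    PoincareOn m D (K ∩ D) := by
  obtain ⟨x₀, hx₀⟩ := hc.nonempty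
  have hfin : ∀ U ⊆ D, volume U ≠ ⊤ := fun U hU => (hb.subset hU).measure_lt_top.ne
  -- The points that can be joined to x₀ by an open subset of D with a Poincaré inequality. This set
  -- is open and, by adding small balls, relatively closed in D, so connectedness makes it all of D.
  let S : Set (EuclideanSpace ℝ (Fin d)) :=
    {y | ∃ U, IsOpen U ∧ x₀ ∈ U ∧ y ∈ U ∧ U ⊆ D ∧ PoincareOn m D U}
  have hball : ∀ y ∈ D, ∃ r > 0, ball y r ⊆ D ∧ PoincareOn m D (ball y r) := fun y hy => by
    obtain ⟨r, hr, hrD⟩ := isOpen_iff.1 hD y hy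
    exact ⟨r, hr, hrD, poincareOn_of_convex (convex_ball y r) measurableSet_ball isBounded_ball hrD⟩
  have hunion : ∀ U V, IsOpen U → IsOpen V → U ⊆ D → V ⊆ D → (U ∩ V).Nonempty →
      PoincareOn m D U → PoincareOn m D V → PoincareOn m D (U ∪ V) :=
    fun U V hU hV _ hVD hne hPU hPV =>
      hPU.union hPV ((hU.inter hV).measure_pos volume hne).ne' (hfin V hVD)
  have hSo : IsOpen S := by
    rw [isOpen_iff_mem_nhds]
    rintro y ⟨U, hU, h0, hy, hUD, hP⟩
    exact mem_of_superset (hU.mem_nhds hy) fun z hz => ⟨U, hU, h0, hz, hUD, hP⟩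
  have hDS : D ⊆ S := by
    refine hc.isPreconnected.subset_of_closure_inter_subset hSo ⟨x₀, hx₀, ?_⟩ ?_
    · obtain ⟨r, hr, hrD, hP⟩ := hball x₀ hx₀
      exact ⟨_, isOpen_ball, mem_ball_self hr, mem_ball_self hr, hrD, hP⟩
    · rintro y ⟨hyS, hyD⟩
      obtain ⟨r, hr, hrD, hP⟩ := hball y hyD
      obtain ⟨z, hz, U, hU, h0, hzU, hUD, hPU⟩ :=
        mem_closure_iff_nhds.1 hyS _ (ball_mem_nhds y hr)
      exact ⟨U ∪ ball y r, hU.union isOpen_ball, Or.inl h0, Or.inr (mem_ball_self hr),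
        union_subset hUD hrD, hunion _ _ hU isOpen_ball hUD hrD ⟨z, hzU, hz⟩ hPU hP⟩
  -- Compactness induction on K. Requiring x₀ in every U makes any two of these sets overlap, so
  -- that unions remain admissible.
  have key : ∃ U, IsOpen U ∧ x₀ ∈ U ∧ K ∩ D ⊆ U ∧ U ⊆ D ∧ PoincareOn m D U := by
    refine hK.induction_on
      (p := fun s => ∃ U, IsOpen U ∧ x₀ ∈ U ∧ s ∩ D ⊆ U ∧ U ⊆ D ∧ PoincareOn m D U) ?_ ?_ ?_ ?_
    · obtain ⟨U, hU, h0, -, hUD, hP⟩ := hDS hx₀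
      exact ⟨U, hU, h0, by simp, hUD, hP⟩
    · rintro s t hst ⟨U, hU, h0, hs, hUD, hP⟩
      exact ⟨U, hU, h0, (inter_subset_inter_left D hst).trans hs, hUD, hP⟩
    · rintro s t ⟨U, hU, h0, hs, hUD, hP⟩ ⟨V, hV, k0, ht, hVD, hQ⟩
      refine ⟨U ∪ V, hU.union hV, Or.inl h0, ?_, union_subset hUD hVD,
        hunion _ _ hU hV hUD hVD ⟨x₀, h0, k0⟩ hP hQ⟩
      rw [union_inter_distrib_right]
      exact union_subset_union hs ht
    · intro x hx
      obtain ⟨V, hV, hxV, ⟨z, hzV, hzD⟩, hP⟩ := h x hx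
      obtain ⟨U, hU, h0, hzU, hUD, hQ⟩ := hDS hzD
      refine ⟨V, mem_nhdsWithin_of_mem_nhds (hV.mem_nhds hxV), U ∪ V ∩ D, hU.union (hV.inter hD),
        Or.inl h0, subset_union_right, union_subset hUD inter_subset_right,
        hunion _ _ hU (hV.inter hD) hUD inter_subset_right ⟨z, hzU, hzV, hzD⟩ hQ hP⟩
  obtain ⟨U, -, -, hKU, -, hP⟩ := key
  exact hP.mono hKU

theorem poincareOn_of_isCompact {D K : Set (EuclideanSpace ℝ (Fin d))} (hD : IsOpen D)
    (hc : IsConnected D) (hb : Bornology.IsBounded D) (hK : IsCompact K) (hKD : K ⊆ D) :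
    PoincareOn m D K := by
  rw [← inter_eq_self_of_subset_left hKD]
  refine poincareOn_of_local hD hc hb hK fun x hx => ?_
  obtain ⟨r, hr, hrD⟩ := isOpen_iff.1 hD x (hKD hx)
  have hP : PoincareOn m D (ball x r) :=
    poincareOn_of_convex (convex_ball x r) measurableSet_ball isBounded_ball hrD
  exact ⟨ball x r, isOpen_ball, mem_ball_self hr, ⟨x, mem_ball_self hr, hKD hx⟩,
    hP.mono inter_subset_left⟩

/-- The Poincaré inequality on a set that can be translated inside `D` into a good set. -/
theorem PoincareOn.of_translate {D U K : Set (EuclideanSpace ℝ (Fin d))}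
    {z : EuclideanSpace ℝ (Fin d)} (hm : MeasurableSet U) (hKm : MeasurableSet K)
    (hDm : MeasurableSet D) (hK : PoincareOn m D K) (hz : ∀ y ∈ U, y + z ∈ K)
    (hseg : ∀ y ∈ U, ∀ t ∈ Ioc (0 : ℝ) 1, y + t • z ∈ D) : PoincareOn m D U := by
  obtain ⟨C, hC, h⟩ := hK
  refine ⟨2 * (C + ‖z‖ₑ ^ 2), by finiteness, fun f hf => ?_⟩
  obtain ⟨c, hc⟩ := h f hf
  refine ⟨c, ?_⟩
  set I := ∫⁻ y in D, ‖fderiv ℝ f y‖ₑ ^ 2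
  have hdc := hf.continuous_fderiv (by simp)
  have htr : ∀ (A B : Set (EuclideanSpace ℝ (Fin d))) (w : EuclideanSpace ℝ (Fin d))
      (g : EuclideanSpace ℝ (Fin d) → ENNReal), MeasurableSet A → MeasurableSet B →
      (∀ y ∈ A, y + w ∈ B) → ∫⁻ y in A, g (y + w) ≤ ∫⁻ y in B, g y := by
    intro A B w g hA hB hAB
    rw [← lintegral_indicator hA, ← lintegral_indicator hB,
      ← lintegral_add_right_eq_self (B.indicator g) w]
    refine lintegral_mono fun y => ?_
    by_cases hy : y ∈ A
    · simp [hy, hAB y hy]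
    · simp [hy]
  have hmv : Measurable fun y => ‖f (y + z) - c‖ₑ ^ 2 :=
    (continuous_enorm_sq ((hf.continuous.comp (by fun_prop)).sub continuous_const)).measurable
  have hmeas : Measurable fun p : EuclideanSpace ℝ (Fin d) × ℝ =>
      ‖fderiv ℝ f (p.1 + p.2 • z)‖ₑ ^ 2 :=
    (continuous_enorm_sq (hdc.comp (by fun_prop))).measurable
  calc ∫⁻ y in U, ‖f y - c‖ₑ ^ 2
      ≤ ∫⁻ y in U, 2 * (‖f (y + z) - c‖ₑ ^ 2 + ‖f (y + z) - f y‖ₑ ^ 2) := by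
        refine lintegral_mono fun y => ?_
        have := enorm_add_sq_le (f (y + z) - c) (-(f (y + z) - f y))
        rw [enorm_neg] at this
        convert this using 3
        abel
    _ = 2 * ((∫⁻ y in U, ‖f (y + z) - c‖ₑ ^ 2) + ∫⁻ y in U, ‖f (y + z) - f y‖ₑ ^ 2) := by
        rw [lintegral_const_mul' _ _ (by finiteness), lintegral_add_left hmv]
    _ ≤ 2 * (C * I + ‖z‖ₑ ^ 2 * I) := by
        gcongr
        · exact (htr U K z (fun y => ‖f y - c‖ₑ ^ 2) hm hKm hz).trans hc
        · calc ∫⁻ y in U, ‖f (y + z) - f y‖ₑ ^ 2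
              ≤ ∫⁻ y in U, ‖z‖ₑ ^ 2 * ∫⁻ t in Ioc (0 : ℝ) 1, ‖fderiv ℝ f (y + t • z)‖ₑ ^ 2 :=
                lintegral_mono fun y => enorm_sub_sq_le_lintegral_fderiv hf y z
            _ = ‖z‖ₑ ^ 2 * ∫⁻ t in Ioc (0 : ℝ) 1, ∫⁻ y in U, ‖fderiv ℝ f (y + t • z)‖ₑ ^ 2 := by
                rw [lintegral_const_mul' _ _ (by finiteness),
                  lintegral_lintegral_swap hmeas.aemeasurable]
            _ ≤ ‖z‖ₑ ^ 2 * ∫⁻ t in Ioc (0 : ℝ) 1, I := by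
                refine mul_le_mul_right (setLIntegral_mono' measurableSet_Ioc fun t ht => ?_) _
                exact htr U D (t • z) (fun y => ‖fderiv ℝ f y‖ₑ ^ 2) hm hDm
                  fun y hy => hseg y hy t ht
            _ = ‖z‖ₑ ^ 2 * I := by simp
    _ = _ := by ring

/-- The Poincaré inequality near a Lipschitz boundary point. -/
theorem poincareOn_of_graph {D : Set (EuclideanSpace ℝ (Fin d))} (hD : IsOpen D)
    (hc : IsConnected D) (hb : Bornology.IsBounded D) (c : GraphChart d)
    {x : EuclideanSpace ℝ (Fin d)} {ρ : ℝ} (hρ : 0 < ρ)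
    (h : ∀ y ∈ ball x ρ, c.height y < 0 → y ∈ D) :
    PoincareOn m D (ball x (ρ / 4) ∩ {y | c.height y < 0}) := by
  -- Moving down by ρ/2 takes points of the ball of radius ρ/4 below the graph into this compact
  -- subset of D, along segments staying below the graph and in the chart ball.
  have hK : IsCompact (closedBall x (3 / 4 * ρ) ∩ {y | c.height y ≤ -(ρ / 2)}) :=
    (isCompact_closedBall x _).inter_right (isClosed_le c.continuous_height continuous_const)
  have hKD : closedBall x (3 / 4 * ρ) ∩ {y | c.height y ≤ -(ρ / 2)} ⊆ D := fun y hy =>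
    h y (closedBall_subset_ball (by linarith) hy.1) (lt_of_le_of_lt hy.2 (by linarith))
  have hht : ∀ y (t : ℝ), c.height (y + t • (-(ρ / 2)) • c.dir) = c.height y - t * (ρ / 2) :=
    fun y t => by rw [smul_smul, c.height_add]; ring
  have hdist : ∀ y ∈ ball x (ρ / 4), ∀ t ∈ Ioc (0 : ℝ) 1,
      y + t • (-(ρ / 2)) • c.dir ∈ closedBall x (3 / 4 * ρ) := by
    intro y hy t ht
    rw [mem_ball, dist_eq_norm] at hy
    rw [mem_closedBall, dist_eq_norm, add_sub_right_comm]
    refine (norm_add_le _ _).trans ?_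
    rw [norm_smul, norm_smul, c.norm_dir, mul_one, norm_neg, Real.norm_of_nonneg ht.1.le,
      Real.norm_of_nonneg (by positivity)]
    nlinarith [ht.2]
  have hmU : MeasurableSet (ball x (ρ / 4) ∩ {y | c.height y < 0}) :=
    (isOpen_ball.inter (isOpen_lt c.continuous_height continuous_const)).measurableSet
  refine PoincareOn.of_translate (z := (-(ρ / 2)) • c.dir) hmU hK.measurableSet hD.measurableSet
    (poincareOn_of_isCompact hD hc hb hK hKD) (fun y hy => ?_) fun y hy t ht => ?_
  · have h1 := hdist y hy.1 1 (by simp)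
    have h2 := hht y 1
    have h3 : c.height y < 0 := hy.2
    rw [one_smul] at h1 h2
    refine ⟨h1, ?_⟩
    rw [mem_ofPred_eq, h2]
    linarith
  · refine h _ (closedBall_subset_ball (by linarith) (hdist y hy.1 t ht)) ?_
    have h3 : c.height y < 0 := hy.2
    rw [hht]
    nlinarith [ht.1]

end Poincare

/-! ### Extension of functions from one side of the boundary -/

section Extension

open Metric

variable {d m : ℕ} {ω : Set (EuclideanSpace ℝ (Fin d))}

theorem enorm_classicalGrad_sq_le (f : EuclideanSpace ℝ (Fin d) → EuclideanSpace ℝ (Fin m))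
    (y : EuclideanSpace ℝ (Fin d)) :
    ‖classicalGrad f y‖ₑ ^ 2 ≤ d * ‖fderiv ℝ f y‖ₑ ^ 2 := by
  rw [enorm_sq_eq_ofReal, enorm_sq_eq_ofReal, ← ENNReal.ofReal_natCast,
    ← ENNReal.ofReal_mul (Nat.cast_nonneg d)]
  exact ENNReal.ofReal_le_ofReal (norm_classicalGrad_le f y)

theorem enorm_fderiv_smul_le {V F : Type*} [NormedAddCommGroup V] [NormedSpace ℝ V]
    [NormedAddCommGroup F] [NormedSpace ℝ F] {b : V → ℝ} {f : V → F} {y : V}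
    (hb : DifferentiableAt ℝ b y) (hf : DifferentiableAt ℝ f y) :
    ‖fderiv ℝ (fun x => b x • f x) y‖ₑ ≤ ‖b y‖ₑ * ‖fderiv ℝ f y‖ₑ + ‖fderiv ℝ b y‖ₑ * ‖f y‖ₑ := by
  rw [fderiv_fun_smul hb hf]
  refine (enorm_add_le (b y • fderiv ℝ f y) ((fderiv ℝ b y).smulRight (f y))).trans ?_
  rw [enorm_smul]
  gcongr
  rw [← ofReal_norm, ← ofReal_norm, ← ofReal_norm, ContinuousLinearMap.norm_smulRight_apply,
    ENNReal.ofReal_mul (norm_nonneg _)]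

/-- Folding a localized function along a graph gives an element of `H^1` that is controlled on the
lower side of the graph. -/
theorem GraphChart.exists_represents_fold (c : GraphChart d) {x : EuclideanSpace ℝ (Fin d)}
    {ρ : ℝ} (hρ : 0 < ρ) (hx : c.height x = 0) (hcell : ball x ρ ⊆ cell d)
    {D : Set (EuclideanSpace ℝ (Fin d))} (hDm : MeasurableSet D)
    (hD : ∀ y ∈ ball x ρ, c.height y < 0 → y ∈ D) {b : EuclideanSpace ℝ (Fin d) → ℝ}
    (hb : ContDiff ℝ (⊤ : ℕ∞) b) (hbs : tsupport b ⊆ ball x (ρ / (2 * (1 + 2 * c.lip)))) (m : ℕ) :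
    ∃ C : ENNReal, C ≠ ⊤ ∧ ∀ f : EuclideanSpace ℝ (Fin d) → EuclideanSpace ℝ (Fin m),
      ContDiff ℝ (⊤ : ℕ∞) f → BddLip f → BddLip (fun y => b (c.fold y) • f (c.fold y)) ∧
        ∃ w : H1 d m, Represents w (fun y => b (c.fold y) • f (c.fold y)) ∧
          ‖w‖ₑ ≤ C * (eLpNorm f 2 (volume.restrict D)
            + eLpNorm (fderiv ℝ f) 2 (volume.restrict D)) := by
  have hL : (0 : ℝ) < 1 + 2 * c.lip := by positivity
  have hball : ball x (ρ / (2 * (1 + 2 * c.lip))) ⊆ ball x ρ := by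
    refine ball_subset_ball (div_le_self hρ.le ?_)
    have : (0 : ℝ) ≤ c.lip := NNReal.coe_nonneg _
    linarith
  have hcs : HasCompactSupport b :=
    isCompact_of_isClosed_isBounded (isClosed_tsupport _) (isBounded_ball.subset hbs)
  have hbb : BddLip b := BddLip.of_contDiff hb hcs
  obtain ⟨⟨Kb, hKb⟩, Mb, hMb⟩ := id hbb
  set M : ENNReal := ENNReal.ofReal Mb + Kb with hM
  have hMt : M ≠ ⊤ := by finiteness
  have hb1 : ∀ y, ‖b y‖ₑ ≤ M := fun y => by
    refine le_trans ?_ le_self_add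
    rw [← ofReal_norm]
    exact ENNReal.ofReal_le_ofReal (hMb y)
  have hb2 : ∀ y, ‖fderiv ℝ b y‖ₑ ≤ M := fun y => by
    refine le_trans ?_ le_add_self
    rw [← ofReal_norm, ← ENNReal.ofReal_coe_nnreal]
    exact ENNReal.ofReal_le_ofReal (norm_fderiv_le_of_lipschitz ℝ hKb)
  set K : NNReal := 1 + 2 * c.lip with hK
  -- An integral over the cell of a folded integrand costs twice the integral below the graph, and
  -- on the support of b that region lies in D.
  have key : ∀ (q : EuclideanSpace ℝ (Fin d) → ENNReal) (G : EuclideanSpace ℝ (Fin d) → ENNReal),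
      Measurable q → (∀ y, q y ≤ G y) → (∀ y ∉ tsupport b, q y = 0) →
      ∫⁻ y in cell d, q (c.fold y) ≤ 2 * ∫⁻ y in D, G y := by
    intro q G hq hqG hq0
    refine (setLIntegral_le_lintegral _ _).trans ((c.lintegral_comp_fold_le hq).trans ?_)
    refine mul_le_mul_right ?_ _
    have hmh : MeasurableSet {y | c.height y < 0} :=
      (isOpen_lt c.continuous_height continuous_const).measurableSet
    rw [← lintegral_indicator hmh, ← lintegral_indicator hDm]
    refine lintegral_mono fun y => ?_
    by_cases hy : y ∈ tsupport b
    · by_cases hyh : y ∈ {y | c.height y < 0}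
      · rw [indicator_of_mem hyh, indicator_of_mem (hD y (hball (hbs hy)) hyh)]
        exact hqG y
      · rw [indicator_of_notMem hyh]
        exact zero_le
    · have : {y | c.height y < 0}.indicator q y = 0 := by
        by_cases hyh : y ∈ {y | c.height y < 0}
        · rw [indicator_of_mem hyh, hq0 y hy]
        · rw [indicator_of_notMem hyh]
      rw [this]
      exact zero_le
  -- Here 2 comes from the fold, 2M² from the product rule for b • f, and dK² from the Lipschitz
  -- constant of the fold and the comparison of gradient norms.
  set C0 : ENNReal := 2 * (2 * M ^ 2) * (1 + d * K ^ 2) with hC0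
  refine ⟨max 1 C0, max_ne_top (by simp) (by finiteness), fun f hf hfb => ?_⟩
  have hhb : BddLip fun y => b y • f y := hbb.smul hfb
  have hhF := hhb.comp_lipschitz c.fold_lipschitz
  refine ⟨hhF, ?_⟩
  have hhd : ContDiff ℝ (⊤ : ℕ∞) fun y => b y • f y := hb.smul hf
  have hts : tsupport (fun y => b (c.fold y) • f (c.fold y)) ⊆ cell d := by
    refine (closure_minimal (t := closedBall x (ρ / 2)) (fun y hy => ?_) isClosed_closedBall).trans
      ((closedBall_subset_ball (by linarith)).trans hcell)
    have hby : b (c.fold y) ≠ 0 := fun h0 => hy (by simp [h0])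
    have h1 := c.mem_closedBall_of_fold_mem hx
      (ball_subset_closedBall (hbs (subset_tsupport _ hby)))
    convert h1 using 1
    field_simp
  obtain ⟨w, hw⟩ := exists_represents_of_tsupport_subset hhF hts
  refine ⟨w, hw, ?_⟩
  have hsq : ∀ a b : ENNReal, (M * (a + b)) ^ 2 ≤ 2 * M ^ 2 * (a ^ 2 + b ^ 2) := fun a b => by
    rw [mul_pow]
    have h := ENNReal.rpow_add_le_mul_rpow_add_rpow a b (p := 2) (by norm_num)
    norm_num at h
    calc M ^ 2 * (a + b) ^ 2 ≤ M ^ 2 * (2 * (a ^ 2 + b ^ 2)) := by gcongr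
      _ = _ := by ring
  set G : EuclideanSpace ℝ (Fin d) → ENNReal :=
    fun y => 2 * M ^ 2 * (‖f y‖ₑ ^ 2 + ‖fderiv ℝ f y‖ₑ ^ 2) with hG
  have i1 : ∫⁻ y in cell d, ‖b (c.fold y) • f (c.fold y)‖ₑ ^ 2 ≤ 2 * ∫⁻ y in D, G y := by
    refine key (fun y => ‖b y • f y‖ₑ ^ 2) G (continuous_enorm_sq hhd.continuous).measurable
      (fun y => ?_) fun y hy => ?_
    · refine le_trans (pow_le_pow_left' ?_ 2) (hsq _ _)
      rw [enorm_smul]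
      exact mul_le_mul' (hb1 y) le_self_add
    · simp [image_eq_zero_of_notMem_tsupport hy]
  have i2 : ∫⁻ y in cell d, ‖fderiv ℝ (fun y => b y • f y) (c.fold y)‖ₑ ^ 2
      ≤ 2 * ∫⁻ y in D, G y := by
    refine key (fun y => ‖fderiv ℝ (fun y => b y • f y) y‖ₑ ^ 2) G
      (continuous_enorm_sq (hhd.continuous_fderiv (by simp))).measurable
      (fun y => ?_) fun y hy => ?_
    · refine le_trans (pow_le_pow_left' ?_ 2) (hsq _ _)
      refine (enorm_fderiv_smul_le (hb.differentiable (by simp) y)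
        (hf.differentiable (by simp) y)).trans ?_
      rw [add_comm, mul_add]
      gcongr
      · exact hb2 y
      · exact hb1 y
    · have : y ∉ tsupport fun y => b y • f y := fun h => hy (tsupport_smul_subset_left b f h)
      simp only [fderiv_of_notMem_tsupport ℝ this, ← ofReal_norm, norm_zero]
      simp
  have i3 : ∫⁻ y in cell d, ‖classicalGrad (fun y => b (c.fold y) • f (c.fold y)) y‖ₑ ^ 2
      ≤ d * K ^ 2 * ∫⁻ y in cell d, ‖fderiv ℝ (fun y => b y • f y) (c.fold y)‖ₑ ^ 2 := by
    rw [← lintegral_const_mul' _ _ (by finiteness)]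
    refine lintegral_mono fun y => (enorm_classicalGrad_sq_le _ y).trans ?_
    rw [mul_assoc, ← mul_pow]
    gcongr
    have h := norm_fderiv_comp_le c.fold_lipschitz (y := y) (hhd.differentiable (by simp) _)
    rw [← ofReal_norm, ← ofReal_norm, ← ENNReal.ofReal_coe_nnreal,
      ← ENNReal.ofReal_mul (NNReal.coe_nonneg _)]
    exact ENNReal.ofReal_le_ofReal h
  have i4 : ∫⁻ y in D, G y = 2 * M ^ 2 * (eLpNorm f 2 (volume.restrict D) ^ 2
      + eLpNorm (fderiv ℝ f) 2 (volume.restrict D) ^ 2) := by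
    rw [hG, lintegral_const_mul' _ _ (by finiteness),
      lintegral_add_left (continuous_enorm_sq hf.continuous).measurable, eLpNorm_two_sq,
      eLpNorm_two_sq]
  refine (ENNReal.pow_le_pow_left_iff (n := 2) two_ne_zero).1 ?_
  rw [hw.enorm_sq]
  calc _ ≤ 2 * (∫⁻ y in D, G y) + d * K ^ 2 * (2 * ∫⁻ y in D, G y) :=
        add_le_add i1 (i3.trans (mul_le_mul_right i2 _))
    _ = C0 * (eLpNorm f 2 (volume.restrict D) ^ 2
          + eLpNorm (fderiv ℝ f) 2 (volume.restrict D) ^ 2) := by rw [i4, hC0]; ring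
    _ ≤ max 1 C0 ^ 2 * (eLpNorm f 2 (volume.restrict D)
          + eLpNorm (fderiv ℝ f) 2 (volume.restrict D)) ^ 2 := by
        refine mul_le_mul' ?_ (sq_add_sq_le_add_sq _ _)
        exact (le_max_right 1 C0).trans (le_self_pow₀ (le_max_left _ _) two_ne_zero)
    _ = _ := by rw [mul_pow]

theorem Represents.sum {ι : Type*} (s : Finset ι) {w : ι → H1 d m}
    {F : ι → EuclideanSpace ℝ (Fin d) → EuclideanSpace ℝ (Fin m)}
    (hw : ∀ k, Represents (w k) (F k)) (hF : ∀ k, BddLip (F k)) :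
    Represents (∑ k ∈ s, w k) fun y => ∑ k ∈ s, F k y := by
  classical
  induction s using Finset.induction_on with
  | empty =>
    constructor
    · exact Lp.coeFn_zero _ _ _
    · have h0 : classicalGrad (fun _ : EuclideanSpace ℝ (Fin d) =>
          (0 : EuclideanSpace ℝ (Fin m))) = 0 := funext fun y => classicalGrad_const 0 y
      simp only [Finset.sum_empty]
      rw [h0]
      exact Lp.coeFn_zero _ _ _
  | insert a s ha ih =>
    simp only [Finset.sum_insert ha]
    exact (hw a).add ih (hF a) (BddLip.sum s fun k _ => hF k)

/-- If the charts of the boundary are oriented so that `D` is their lower side, every smooth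
function has, up to a constant, the trace of a function controlled by its gradient on `D`. -/
theorem exists_extension (hω : IsInclusion ω) (B : BoundaryCover ω) (c : B.ι → GraphChart d)
    (hlip : ∀ k, (c k).lip = (B.chart k).lip)
    (hzero : ∀ k y, (c k).height y = 0 ↔ (B.chart k).height y = 0)
    {D : Set (EuclideanSpace ℝ (Fin d))} (hDm : MeasurableSet D)
    (hD : ∀ k, ∀ y ∈ ball (B.center k) (B.radius k), (c k).height y < 0 → y ∈ D)
    (hP : PoincareOn m D D) :
    ∃ C : ENNReal, C ≠ ⊤ ∧ ∀ (f : EuclideanSpace ℝ (Fin d) → EuclideanSpace ℝ (Fin m))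
      (v : H1 d m), ContDiff ℝ (⊤ : ℕ∞) f → IsPeriodic f → Represents v f →
        ∃ a w : H1 d m, sobGrad a = 0 ∧ HasTrace ω (v - a - w) (0 : L2Bdry ω m) ∧
          ‖w‖ₑ ≤ C * eLpNorm (classicalGrad f) 2 (volume.restrict D) := by
  have hbs : ∀ k, tsupport (B.bump k)
      ⊆ ball (B.center k) (B.radius k / (2 * (1 + 2 * (c k).lip))) := fun k => by
    rw [hlip]
    exact B.tsupport_bump k
  choose C hC hfold using fun k => (c k).exists_represents_fold (B.fits k).pos
    ((hzero k _).2 (B.height_center k)) (B.fits k).ball_subset hDm (hD k) (B.contDiff_bump k)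
    (hbs k) m
  obtain ⟨CP, hCP, hP⟩ := hP
  refine ⟨(∑ k, C k) * (max 1 CP + 1), ENNReal.mul_ne_top (ENNReal.sum_ne_top.2 fun k _ => hC k)
    (by simp [hCP]), fun f v hf hfp hv => ?_⟩
  -- Subtracting the Poincaré constant before folding makes the full H^1 norm of the extension
  -- controlled by the gradient alone.
  obtain ⟨a, ha⟩ := hP f (hf.of_le (by exact_mod_cast le_top))
  obtain ⟨va, ga, hva, hva0, hta, hga⟩ := exists_const_H1 (m := m) hω a
  have hfb := hfp.bddLip hf
  have hfa : ContDiff ℝ (⊤ : ℕ∞) fun y => f y - a := hf.sub contDiff_const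
  have hfab : BddLip fun y => f y - a := hfb.sub (bddLip_const a)
  have hFb := fun k => (hfold k _ hfa hfab).1
  choose w hw hwn using fun k => (hfold k _ hfa hfab).2
  have hsum := Represents.sum Finset.univ hw hFb
  refine ⟨va, ∑ k, w k, hva0, ?_, ?_⟩
  · have hb1 := hfb.sub (bddLip_const a)
    have hb2 := BddLip.sum Finset.univ fun k _ => hFb k
    refine ((hv.sub hva hfb (bddLip_const a)).sub hsum hb1 hb2).hasTrace hω (hb1.sub hb2) ?_
    have hmem : ∀ᵐ y ∂surface ω, y ∈ frontier ω := ae_restrict_mem isClosed_frontier.measurableSet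
    filter_upwards [Lp.coeFn_zero (EuclideanSpace ℝ (Fin m)) 2 (surface ω), hmem] with y h0 hy
    -- On the boundary of ω, points of a chart ball lie on the graph and are fixed by the fold;
    -- outside the chart ball both the bump and its folded version vanish. So the folded pieces
    -- still sum to f - a there.
    have hk : ∀ k, B.bump k ((c k).fold y) • (f ((c k).fold y) - a) = B.bump k y • (f y - a) := by
      intro k
      by_cases hyb : y ∈ ball (B.center k) (B.radius k)
      · have h1 := (hzero k y).2 (((B.fits k).mem_frontier_iff hω.isOpen hyb).1 hy)
        rw [(c k).fold_of_nonpos h1.le]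
      · have h1 : B.bump k y = 0 := by
          by_contra h
          exact hyb (B.mem_ball_of_bump_ne_zero h)
        have h2 : B.bump k ((c k).fold y) = 0 := by
          by_contra h
          have h3 := (c k).mem_closedBall_of_fold_mem ((hzero k _).2 (B.height_center k))
            (ball_subset_closedBall (hbs k (subset_tsupport _ h)))
          refine hyb (closedBall_subset_ball ?_ h3)
          have hr := (B.fits k).pos
          have hL : (0 : ℝ) < 1 + 2 * (c k).lip := by positivity
          rw [show (1 + 2 * ((c k).lip : ℝ)) * (B.radius k / (2 * (1 + 2 * (c k).lip)))
            = B.radius k / 2 by field_simp]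
          linarith
        rw [h1, h2, zero_smul, zero_smul]
    simp_rw [hk]
    rw [h0, ← Finset.sum_smul, B.sum_bump_eq_one hω.isOpen hy, one_smul, sub_self]
    rfl
  · have hN : eLpNorm (fderiv ℝ f) 2 (volume.restrict D)
        ≤ eLpNorm (classicalGrad f) 2 (volume.restrict D) :=
      eLpNorm_mono fun y => norm_fderiv_le_classicalGrad f y
    have hPn : eLpNorm (fun y => f y - a) 2 (volume.restrict D)
        ≤ max 1 CP * eLpNorm (fderiv ℝ f) 2 (volume.restrict D) := by
      refine (ENNReal.pow_le_pow_left_iff (n := 2) two_ne_zero).1 ?_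
      rw [mul_pow, eLpNorm_two_sq, eLpNorm_two_sq]
      refine ha.trans (mul_le_mul_left ?_ _)
      exact (le_max_right 1 CP).trans (le_self_pow₀ (le_max_left _ _) two_ne_zero)
    have hfd : fderiv ℝ (fun y => f y - a) = fderiv ℝ f := funext fun y => fderiv_sub_const a
    calc ‖∑ k, w k‖ₑ ≤ ∑ k, ‖w k‖ₑ := enorm_sum_le _ _
      _ ≤ ∑ k, C k * ((max 1 CP + 1) * eLpNorm (classicalGrad f) 2 (volume.restrict D)) := by
          refine Finset.sum_le_sum fun k _ => (hwn k).trans ?_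
          rw [hfd, add_mul, one_mul]
          gcongr
          exact hPn.trans (by gcongr)
      _ = _ := by rw [← Finset.sum_mul, mul_assoc]

/-- The local hypothesis of `poincareOn_of_local` holds at every point of the closure: small balls
are convex inside ω, and `poincareOn_of_graph` handles boundary points. -/
theorem IsInclusion.poincareOn_inner (hω : IsInclusion ω) (m : ℕ) : PoincareOn m ω ω := by
  have hb : Bornology.IsBounded ω := isBounded_cell.subset hω.subset_cell
  have h := poincareOn_of_local (m := m) hω.isOpen hω.isConnected hb hω.isCompact_closure ?_
  · rwa [inter_eq_self_of_subset_right subset_closure] at h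
  · intro x hx
    by_cases hxω : x ∈ ω
    · obtain ⟨r, hr, hrD⟩ := isOpen_iff.1 hω.isOpen x hxω
      have hP : PoincareOn m ω (ball x r) :=
        poincareOn_of_convex (convex_ball x r) measurableSet_ball isBounded_ball hrD
      exact ⟨ball x r, isOpen_ball, mem_ball_self hr, ⟨x, mem_ball_self hr, hxω⟩,
        hP.mono inter_subset_left⟩
    · obtain ⟨c, ρ, hc⟩ := hω.exists_fits (x := x) (by rw [hω.isOpen.frontier_eq]; exact ⟨hx, hxω⟩)
      have hρ := hc.pos
      have hsub : ball x (ρ / 4) ⊆ ball x ρ := ball_subset_ball (by linarith)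
      refine ⟨ball x (ρ / 4), isOpen_ball, mem_ball_self (by linarith),
        mem_closure_iff_nhds.1 hx _ (ball_mem_nhds x (by linarith)), ?_⟩
      refine (poincareOn_of_graph hω.isOpen hω.isConnected hb c hρ
        fun y hy hh => (hc.mem_iff y hy).2 hh).mono ?_
      rintro y ⟨hy, hyω⟩
      exact ⟨hy, (hc.mem_iff y (hsub hy)).1 hyω⟩

theorem isOpen_outer (ω : Set (EuclideanSpace ℝ (Fin d))) : IsOpen (cell d \ closure ω) :=
  isOpen_cell.sdiff isClosed_closure

theorem GraphChart.Fits.mem_outer_iff {c : GraphChart d} {x y : EuclideanSpace ℝ (Fin d)} {ρ : ℝ}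
    (hc : c.Fits ω x ρ) (hy : y ∈ ball x ρ) :
    y ∈ cell d \ closure ω ↔ c.flip.height y < 0 := by
  change _ ↔ -c.height y < 0
  rw [Set.mem_sdiff, hc.mem_closure_iff hy, not_le, neg_lt_zero]
  exact ⟨fun h => h.2, fun h => ⟨hc.ball_subset hy, h⟩⟩

/-- At the boundary of ω the flipped charts present the exterior as the lower side. Elsewhere,
including at the boundary of the cell, a small ball intersected with the cell is convex and avoids
ω. Connectedness of the complement enters here. -/
theorem IsInclusion.poincareOn_outer (hω : IsInclusion ω) (m : ℕ) :
    PoincareOn m (cell d \ closure ω) (cell d \ closure ω) := by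
  have hb : Bornology.IsBounded (cell d \ closure ω) := isBounded_cell.subset sdiff_subset
  have h := poincareOn_of_local (m := m) (isOpen_outer ω) hω.isConnected_compl hb
    hb.isCompact_closure ?_
  · rwa [inter_eq_self_of_subset_right subset_closure] at h
  · intro x hx
    by_cases hxω : x ∈ closure ω
    · have hxf : x ∈ frontier ω := by
        rw [hω.isOpen.frontier_eq]
        refine ⟨hxω, fun h => ?_⟩
        obtain ⟨y, hy, hy'⟩ := mem_closure_iff.1 hx ω hω.isOpen h
        exact hy'.2 (subset_closure hy)
      obtain ⟨c, ρ, hc⟩ := hω.exists_fits hxf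
      have hρ := hc.pos
      have hsub : ball x (ρ / 4) ⊆ ball x ρ := ball_subset_ball (by linarith)
      refine ⟨ball x (ρ / 4), isOpen_ball, mem_ball_self (by linarith),
        mem_closure_iff_nhds.1 hx _ (ball_mem_nhds x (by linarith)), ?_⟩
      refine (poincareOn_of_graph (isOpen_outer ω) hω.isConnected_compl hb c.flip hρ
        fun y hy hh => (hc.mem_outer_iff hy).2 hh).mono ?_
      rintro y ⟨hy, hyω⟩
      exact ⟨hy, (hc.mem_outer_iff (hsub hy)).1 hyω⟩
    · obtain ⟨r, hr, hrD⟩ := isOpen_iff.1 isClosed_closure.isOpen_compl x hxω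
      refine ⟨ball x r, isOpen_ball, mem_ball_self hr,
        mem_closure_iff_nhds.1 hx _ (ball_mem_nhds x hr), ?_⟩
      have hP : PoincareOn m (cell d \ closure ω) (ball x r ∩ cell d) :=
        poincareOn_of_convex ((convex_ball x r).inter convex_cell)
          (measurableSet_ball.inter measurableSet_cell) (isBounded_ball.subset inter_subset_left)
          fun y hy => ⟨hy.2, hrD hy.1⟩
      exact hP.mono (inter_subset_inter_right _ sdiff_subset)

/-- A functional that vanishes on functions with zero trace and on functions with zero gradient is
controlled by the gradient on one side of the boundary. -/
theorem exists_functional_bound {D : Set (EuclideanSpace ℝ (Fin d))} (hDc : D ⊆ cell d)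
    (h : ∃ C : ENNReal, C ≠ ⊤ ∧ ∀ (f : EuclideanSpace ℝ (Fin d) → EuclideanSpace ℝ (Fin m))
      (v : H1 d m), ContDiff ℝ (⊤ : ℕ∞) f → IsPeriodic f → Represents v f →
        ∃ a w : H1 d m, sobGrad a = 0 ∧ HasTrace ω (v - a - w) (0 : L2Bdry ω m) ∧
          ‖w‖ₑ ≤ C * eLpNorm (classicalGrad f) 2 (volume.restrict D)) :
    ∃ C : ENNReal, C ≠ ⊤ ∧ ∀ ℓ : H1 d m →L[ℝ] ℝ,
      (∀ v, HasTrace ω v (0 : L2Bdry ω m) → ℓ v = 0) → (∀ v, sobGrad v = 0 → ℓ v = 0) →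
      ∀ v, ‖ℓ v‖ₑ ≤ ‖ℓ‖ₑ * (C * eLpNorm (sobGrad v) 2 (volume.restrict D)) := by
  obtain ⟨C, hC, h⟩ := h
  refine ⟨C, hC, fun ℓ h1 h2 v => ?_⟩
  obtain ⟨f, w, hf, hw, hlim⟩ := exists_smooth_tendsto v
  obtain ⟨-, l2⟩ := (tendsto_H1_iff hw v).1 hlim
  have hle : volume.restrict D
      ≤ (volume : Measure (EuclideanSpace ℝ (Fin d))).restrict (cell d) :=
    Measure.restrict_mono hDc le_rfl
  have hgm : AEStronglyMeasurable (sobGrad v) (volume.restrict D) :=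
    (Lp.aestronglyMeasurable _).mono_measure hle
  have hl : Tendsto (fun n => ‖ℓ (w n)‖ₑ) atTop (𝓝 ‖ℓ v‖ₑ) :=
    ((continuous_enorm.comp ℓ.continuous).tendsto v).comp hlim
  have hr : Tendsto (fun n => ‖ℓ‖ₑ * (C * (eLpNorm (sobGrad v) 2 (volume.restrict D)
      + eLpNorm (fun y => classicalGrad (f n) y - sobGrad v y) 2 (volume.restrict (cell d)))))
      atTop (𝓝 (‖ℓ‖ₑ * (C * (eLpNorm (sobGrad v) 2 (volume.restrict D) + 0)))) :=
    ENNReal.Tendsto.const_mul (ENNReal.Tendsto.const_mul (tendsto_const_nhds.add l2) (Or.inr hC))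
      (Or.inr enorm_ne_top)
  rw [add_zero] at hr
  refine le_of_tendsto_of_tendsto' hl hr fun n => ?_
  obtain ⟨a, z, ha, ht, hz⟩ := h (f n) (w n) (hf n).1 (hf n).2 (hw n)
  -- The functional cannot distinguish the approximation from its controlled extension, since they
  -- differ by a function of zero gradient and one of zero trace.
  have e : ℓ (w n) = ℓ z := by
    have h3 := h1 _ ht
    rw [map_sub, map_sub, h2 a ha, sub_zero, sub_eq_zero] at h3
    exact h3
  rw [e]
  refine (ℓ.le_opENorm z).trans ?_
  gcongr
  refine hz.trans ?_
  gcongr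
  refine (eLpNorm_le_of_tendsto_sub
    (fun n => (continuous_classicalGrad (hf n).1).aestronglyMeasurable) hgm n).2.trans ?_
  gcongr

theorem IsInclusion.exists_functional_bound_inner (hω : IsInclusion ω) (m : ℕ) :
    ∃ C : ENNReal, C ≠ ⊤ ∧ ∀ ℓ : H1 d m →L[ℝ] ℝ,
      (∀ v, HasTrace ω v (0 : L2Bdry ω m) → ℓ v = 0) → (∀ v, sobGrad v = 0 → ℓ v = 0) →
      ∀ v, ‖ℓ v‖ₑ ≤ ‖ℓ‖ₑ * (C * eLpNorm (sobGrad v) 2 (volume.restrict ω)) := by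
  obtain ⟨B⟩ := hω.nonempty_boundaryCover
  exact exists_functional_bound hω.subset_cell (exists_extension hω B B.chart (fun _ => rfl)
    (fun _ _ => Iff.rfl) hω.isOpen.measurableSet (fun k y hy h => ((B.fits k).mem_iff y hy).2 h)
    (hω.poincareOn_inner m))

/-- The extension is built from the open exterior of the closure; the bound then passes to the
larger set outside ω by monotonicity, without discussing the volume of the boundary. -/
theorem IsInclusion.exists_functional_bound_outer (hω : IsInclusion ω) (m : ℕ) :
    ∃ C : ENNReal, C ≠ ⊤ ∧ ∀ ℓ : H1 d m →L[ℝ] ℝ,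
      (∀ v, HasTrace ω v (0 : L2Bdry ω m) → ℓ v = 0) → (∀ v, sobGrad v = 0 → ℓ v = 0) →
      ∀ v, ‖ℓ v‖ₑ ≤ ‖ℓ‖ₑ * (C * eLpNorm (sobGrad v) 2 (volume.restrict (cell d \ ω))) := by
  obtain ⟨B⟩ := hω.nonempty_boundaryCover
  obtain ⟨C, hC, h⟩ := exists_functional_bound (ω := ω) (m := m) (D := cell d \ closure ω)
    sdiff_subset
    (exists_extension hω B (fun k => (B.chart k).flip) (fun _ => rfl)
      (fun _ _ => neg_eq_zero) (isOpen_outer ω).measurableSet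
      (fun k y hy h => ((B.fits k).mem_outer_iff hy).2 h) (hω.poincareOn_outer m))
  refine ⟨C, hC, fun ℓ h1 h2 v => (h ℓ h1 h2 v).trans ?_⟩
  have hsub : cell d \ closure ω ⊆ cell d \ ω :=
    fun _ hy => ⟨hy.1, fun h => hy.2 (subset_closure h)⟩
  have hle : volume.restrict (cell d \ closure ω)
      ≤ (volume : Measure (EuclideanSpace ℝ (Fin d))).restrict (cell d \ ω) :=
    Measure.restrict_mono hsub le_rfl
  gcongr

/-- The Poincaré inequality for functions of mean zero on the torus. -/
theorem exists_norm_sobVal_le (d m : ℕ) : ∃ C : ℝ, 0 ≤ C ∧ ∀ u : H1 d m,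
    ∫ y in cell d, sobVal u y = 0 → ‖sobVal u‖ ≤ C * ‖sobGrad u‖ := by
  obtain ⟨C, hC, h⟩ := poincareOn_of_convex (m := m) convex_cell measurableSet_cell
    isBounded_cell (subset_refl (cell d))
  set C' : ENNReal := max 1 C with hC'
  have hCt : C' ≠ ⊤ := max_ne_top (by simp) hC
  refine ⟨C'.toReal, ENNReal.toReal_nonneg, fun u hu => ?_⟩
  obtain ⟨f, w, hf, hw, hlim⟩ := exists_smooth_tendsto u
  -- Mean zero makes u orthogonal to constants, so a Poincaré constant can be subtracted from the
  -- approximation for free; it need not be the mean.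
  have hbound : ∀ n, ⟪sobVal u, sobVal (w n)⟫_ℝ ≤ ‖sobVal u‖ * (C'.toReal * ‖sobGrad (w n)‖) := by
    intro n
    obtain ⟨c, hc⟩ := h (f n) ((hf n).1.of_le (by exact_mod_cast le_top))
    obtain ⟨a, ha⟩ := exists_represents_of_periodic (f := fun _ : EuclideanSpace ℝ (Fin d) => c)
      contDiff_const (fun _ _ => rfl)
    have h0 : ⟪sobVal u, sobVal a⟫_ℝ = 0 := by
      rw [L2.inner_def]
      have hi : Integrable (sobVal u) (volume.restrict (cell d)) :=
        (Lp.memLp (sobVal u)).integrable (by norm_num)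
      have e : ∫ y in cell d, ⟪sobVal u y, sobVal a y⟫_ℝ
          = ∫ y in cell d, ⟪c, sobVal u y⟫_ℝ := by
        refine integral_congr_ae ?_
        filter_upwards [ha.1] with y hy
        rw [hy, real_inner_comm]
      rw [e, integral_inner hi, hu, inner_zero_right]
    have h1 : ‖sobVal (w n) - sobVal a‖ₑ ≤ C' * ‖sobGrad (w n)‖ₑ := by
      refine (ENNReal.pow_le_pow_left_iff (n := 2) two_ne_zero).1 ?_
      rw [mul_pow, enorm_sq_eq_lintegral, enorm_sq_eq_lintegral]
      calc ∫⁻ y in cell d, ‖(sobVal (w n) - sobVal a : L2Val d m) y‖ₑ ^ 2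
          = ∫⁻ y in cell d, ‖f n y - c‖ₑ ^ 2 := by
            refine lintegral_congr_ae ?_
            filter_upwards [Lp.coeFn_sub (sobVal (w n)) (sobVal a), (hw n).1, ha.1]
              with y e1 e2 e3
            rw [e1, Pi.sub_apply, e2, e3]
        _ ≤ C * ∫⁻ y in cell d, ‖fderiv ℝ (f n) y‖ₑ ^ 2 := hc
        _ ≤ C' ^ 2 * ∫⁻ y in cell d, ‖sobGrad (w n) y‖ₑ ^ 2 := by
            refine mul_le_mul' ((le_max_right 1 C).trans
              (le_self_pow₀ (le_max_left _ _) two_ne_zero)) (lintegral_mono_ae ?_)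
            filter_upwards [(hw n).2] with y e
            rw [e]
            gcongr
            rw [← ofReal_norm, ← ofReal_norm]
            exact ENNReal.ofReal_le_ofReal (norm_fderiv_le_classicalGrad _ y)
    have h2 := ENNReal.toReal_mono (ENNReal.mul_ne_top hCt enorm_ne_top) h1
    rw [toReal_enorm, ENNReal.toReal_mul, toReal_enorm] at h2
    calc ⟪sobVal u, sobVal (w n)⟫_ℝ = ⟪sobVal u, sobVal (w n) - sobVal a⟫_ℝ := by
          rw [inner_sub_right, h0, sub_zero]
      _ ≤ ‖sobVal u‖ * ‖sobVal (w n) - sobVal a‖ := real_inner_le_norm _ _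
      _ ≤ _ := by gcongr
  have l1 : Tendsto (fun n => ⟪sobVal u, sobVal (w n)⟫_ℝ) atTop (𝓝 ⟪sobVal u, sobVal u⟫_ℝ) :=
    (((innerSL ℝ (sobVal u)).comp (valCLM d m)).continuous.tendsto u).comp hlim
  have l2 : Tendsto (fun n => ‖sobGrad (w n)‖) atTop (𝓝 ‖sobGrad u‖) :=
    ((continuous_norm.comp (gradCLM d m).continuous).tendsto u).comp hlim
  have h3 := le_of_tendsto_of_tendsto' l1 ((l2.const_mul _).const_mul _) hbound
  rw [real_inner_self_eq_norm_sq, sq] at h3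
  rcases (norm_nonneg (sobVal u)).eq_or_lt with h4 | h4
  · rw [← h4]
    positivity
  · exact le_of_mul_le_mul_left h3 h4

end Extension

/-! ### The energy forms -/

section Form

variable {d m : ℕ} {A : EuclideanSpace ℝ (Fin d) → Fin d → Fin d → Fin m → Fin m → ℝ} {μ : ℝ}
  {D : Set (EuclideanSpace ℝ (Fin d))}

/-- The bilinear form `(ξ, ζ) ↦ a_{ij}^{αβ} ξ_j^β ζ_i^α` of a coefficient tensor. -/
def tensorForm (a : Fin d → Fin d → Fin m → Fin m → ℝ) :
    LinearMap.BilinForm ℝ (EuclideanSpace ℝ (Fin d × Fin m)) :=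
  LinearMap.mk₂ ℝ (fun ξ ζ => ∑ i, ∑ j, ∑ α, ∑ β, a i j α β * ξ (j, β) * ζ (i, α))
    (fun ξ ξ' ζ => by simp only [PiLp.add_apply, mul_add, add_mul, Finset.sum_add_distrib])
    (fun t ξ ζ => by
      simp only [PiLp.smul_apply, smul_eq_mul, Finset.mul_sum]
      congr! 4
      ring)
    (fun ξ ζ ζ' => by simp only [PiLp.add_apply, mul_add, Finset.sum_add_distrib])
    (fun t ξ ζ => by
      simp only [PiLp.smul_apply, smul_eq_mul, Finset.mul_sum]
      congr! 4
      ring)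

theorem tensorForm_apply (a : Fin d → Fin d → Fin m → Fin m → ℝ)
    (ξ ζ : EuclideanSpace ℝ (Fin d × Fin m)) :
    tensorForm a ξ ζ = ∑ i, ∑ j, ∑ α, ∑ β, a i j α β * ξ (j, β) * ζ (i, α) := rfl

theorem form_eq (D : Set (EuclideanSpace ℝ (Fin d))) (u v : H1 d m) :
    form A D u v = ∫ y in D, tensorForm (A y) (sobGrad u y) (sobGrad v y) := rfl

theorem IsCoefficient.tensorForm_symm (hA : IsCoefficient A μ) (y : EuclideanSpace ℝ (Fin d))
    (ξ ζ : EuclideanSpace ℝ (Fin d × Fin m)) :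
    tensorForm (A y) ξ ζ = tensorForm (A y) ζ ξ := by
  rw [tensorForm_apply, tensorForm_apply, Finset.sum_comm]
  refine Finset.sum_congr rfl fun i _ => Finset.sum_congr rfl fun j _ => ?_
  rw [Finset.sum_comm]
  refine Finset.sum_congr rfl fun α _ => Finset.sum_congr rfl fun β _ => ?_
  rw [hA.symm y j i β α]
  ring

theorem tensorForm_self (a : Fin d → Fin d → Fin m → Fin m → ℝ)
    (ξ : EuclideanSpace ℝ (Fin d × Fin m)) :
    tensorForm a ξ ξ = ∑ i, ∑ j, ∑ α, ∑ β, a i j α β * ξ (i, α) * ξ (j, β) := by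
  rw [tensorForm_apply]
  refine Finset.sum_congr rfl fun i _ => Finset.sum_congr rfl fun j _ =>
    Finset.sum_congr rfl fun α _ => Finset.sum_congr rfl fun β _ => ?_
  ring

/-- Ellipticity bounds only the quadratic form; Cauchy–Schwarz for the nonnegative symmetric form at
y gives the bilinear bound. -/
theorem IsCoefficient.abs_tensorForm_le (hA : IsCoefficient A μ) (y : EuclideanSpace ℝ (Fin d))
    (ξ ζ : EuclideanSpace ℝ (Fin d × Fin m)) :
    |tensorForm (A y) ξ ζ| ≤ μ⁻¹ * (‖ξ‖ * ‖ζ‖) := by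
  have hμ := hA.pos
  have h0 : ∀ ξ, 0 ≤ tensorForm (A y) ξ ξ := fun ξ => by
    rw [tensorForm_self]
    exact le_trans (by positivity) (hA.lower y ξ)
  have h1 : ∀ ξ, tensorForm (A y) ξ ξ ≤ μ⁻¹ * ‖ξ‖ ^ 2 := fun ξ => by
    rw [tensorForm_self]
    exact hA.upper y ξ
  have hcs := LinearMap.BilinForm.apply_sq_le_of_symm (tensorForm (A y)) h0
    ⟨fun ξ ζ => hA.tensorForm_symm y ξ ζ⟩ ξ ζ
  refine abs_le_of_sq_le_sq (hcs.trans ?_) (by positivity)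
  calc _ ≤ (μ⁻¹ * ‖ξ‖ ^ 2) * (μ⁻¹ * ‖ζ‖ ^ 2) := mul_le_mul (h1 ξ) (h1 ζ) (h0 ζ) (by positivity)
    _ = _ := by ring

theorem IsCoefficient.integrable (hA : IsCoefficient A μ) (hD : D ⊆ cell d) (u v : H1 d m) :
    IntegrableOn (fun y => tensorForm (A y) (sobGrad u y) (sobGrad v y)) D := by
  refine IntegrableOn.mono_set ?_ hD
  have hcoord : ∀ (w : H1 d m) p, AEStronglyMeasurable (fun y => sobGrad w y p)
      (volume.restrict (cell d)) := fun w p =>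
    (EuclideanSpace.proj p : EuclideanSpace ℝ (Fin d × Fin m) →L[ℝ] ℝ).continuous.comp_aestronglyMeasurable
      (Lp.aestronglyMeasurable (sobGrad w))
  refine Integrable.mono' (g := fun y => μ⁻¹ * (‖sobGrad u y‖ * ‖sobGrad v y‖)) ?_ ?_ ?_
  · exact ((Lp.memLp (sobGrad u)).norm.integrable_mul (Lp.memLp (sobGrad v)).norm).const_mul _
  · simp only [tensorForm_apply]
    refine Finset.aestronglyMeasurable_fun_sum _ fun i _ =>
      Finset.aestronglyMeasurable_fun_sum _ fun j _ =>
      Finset.aestronglyMeasurable_fun_sum _ fun α _ =>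
      Finset.aestronglyMeasurable_fun_sum _ fun β _ => ?_
    exact ((hA.measurable i j α β).aestronglyMeasurable.mul (hcoord u _)).mul (hcoord v _)
  · exact Eventually.of_forall fun y => hA.abs_tensorForm_le y _ _

theorem form_symm (hA : IsCoefficient A μ) (D : Set (EuclideanSpace ℝ (Fin d))) (u v : H1 d m) :
    form A D u v = form A D v u := by
  rw [form_eq, form_eq]
  congr 1
  ext y
  exact hA.tensorForm_symm y _ _

theorem form_add_left (hA : IsCoefficient A μ) (hD : D ⊆ cell d) (u u' v : H1 d m) :
    form A D (u + u') v = form A D u v + form A D u' v := by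
  rw [form_eq, form_eq, form_eq, ← integral_add (hA.integrable hD u v) (hA.integrable hD u' v)]
  refine integral_congr_ae ?_
  filter_upwards [(Lp.coeFn_add (sobGrad u) (sobGrad u')).filter_mono
    (ae_mono (Measure.restrict_mono hD le_rfl))] with y hy
  have : sobGrad (u + u') y = sobGrad u y + sobGrad u' y := hy
  rw [this, map_add, LinearMap.add_apply]

theorem form_smul_left (hD : D ⊆ cell d) (t : ℝ) (u v : H1 d m) :
    form A D (t • u) v = t * form A D u v := by
  rw [form_eq, form_eq, ← integral_const_mul]
  refine integral_congr_ae ?_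
  filter_upwards [(Lp.coeFn_smul t (sobGrad u)).filter_mono
    (ae_mono (Measure.restrict_mono hD le_rfl))] with y hy
  have : sobGrad (t • u) y = t • sobGrad u y := hy
  rw [this, map_smul, LinearMap.smul_apply, smul_eq_mul]

/-- The norm of the gradient in `L^2(D)`. -/
def gradNorm (D : Set (EuclideanSpace ℝ (Fin d))) (u : H1 d m) : ℝ :=
  (eLpNorm (sobGrad u) 2 (volume.restrict D)).toReal

theorem memLp_sobGrad (hD : D ⊆ cell d) (u : H1 d m) :
    MemLp (sobGrad u) 2 (volume.restrict D) :=
  (Lp.memLp (sobGrad u)).mono_measure (Measure.restrict_mono hD le_rfl)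

theorem gradNorm_cell (u : H1 d m) : gradNorm (cell d) u = ‖sobGrad u‖ := (Lp.norm_def _).symm

theorem gradNorm_nonneg (D : Set (EuclideanSpace ℝ (Fin d))) (u : H1 d m) : 0 ≤ gradNorm D u :=
  ENNReal.toReal_nonneg

theorem integrable_sobGrad_sq (hD : D ⊆ cell d) (u : H1 d m) :
    IntegrableOn (fun y => ‖sobGrad u y‖ ^ 2) D :=
  (memLp_sobGrad hD u).norm.integrable_sq

theorem gradNorm_sq (hD : D ⊆ cell d) (u : H1 d m) :
    gradNorm D u ^ 2 = ∫ y in D, ‖sobGrad u y‖ ^ 2 := by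
  rw [gradNorm, ← ENNReal.toReal_pow, eLpNorm_two_sq,
    integral_eq_lintegral_of_nonneg_ae (Eventually.of_forall fun y => sq_nonneg _)
      (integrable_sobGrad_sq hD u).aestronglyMeasurable]
  congr 1
  refine lintegral_congr fun y => ?_
  rw [enorm_sq_eq_ofReal]

theorem IsCoefficient.le_form_self (hA : IsCoefficient A μ) (hD : D ⊆ cell d) (u : H1 d m) :
    μ * gradNorm D u ^ 2 ≤ form A D u u := by
  rw [form_eq, gradNorm_sq hD, ← integral_const_mul]
  refine integral_mono ((integrable_sobGrad_sq hD u).const_mul μ) (hA.integrable hD u u) fun y => ?_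
  simp only
  rw [tensorForm_self]
  exact hA.lower y _

theorem norm_sobGrad_le (u : H1 d m) : ‖sobGrad u‖ ≤ ‖u‖ := by
  refine abs_le_of_sq_le_sq' ?_ (norm_nonneg _) |>.2
  rw [norm_sq_H1]
  nlinarith [sq_nonneg ‖sobVal u‖]

theorem IsCoefficient.abs_form_le (hA : IsCoefficient A μ) (hD : D ⊆ cell d) (u v : H1 d m) :
    |form A D u v| ≤ μ⁻¹ * ‖sobGrad u‖ * ‖sobGrad v‖ := by
  have hμ := hA.pos
  have hp := ((Lp.memLp (sobGrad u)).norm.integrable_mul (Lp.memLp (sobGrad v)).norm).const_mul μ⁻¹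
  have hi : ∫ y in cell d, ‖sobGrad u y‖ * ‖sobGrad v y‖ ≤ ‖sobGrad u‖ * ‖sobGrad v‖ := by
    have hu : MemLp (fun y => ‖sobGrad u y‖) (ENNReal.ofReal 2) (volume.restrict (cell d)) := by
      simpa using (Lp.memLp (sobGrad u)).norm
    have hv : MemLp (fun y => ‖sobGrad v y‖) (ENNReal.ofReal 2) (volume.restrict (cell d)) := by
      simpa using (Lp.memLp (sobGrad v)).norm
    refine (integral_mul_le_Lp_mul_Lq_of_nonneg Real.HolderConjugate.two_two
      (Eventually.of_forall fun y => norm_nonneg _) (Eventually.of_forall fun y => norm_nonneg _)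
      hu hv).trans (le_of_eq ?_)
    have e : ∀ w : H1 d m, (∫ y in cell d, ‖sobGrad w y‖ ^ (2 : ℝ)) ^ (1 / 2 : ℝ) = ‖sobGrad w‖ := by
      intro w
      simp only [Real.rpow_two]
      rw [← gradNorm_sq subset_rfl, gradNorm_cell, ← Real.sqrt_eq_rpow, Real.sqrt_sq (norm_nonneg _)]
    rw [e, e]
  rw [form_eq, ← Real.norm_eq_abs]
  calc ‖∫ y in D, tensorForm (A y) (sobGrad u y) (sobGrad v y)‖
      ≤ ∫ y in D, μ⁻¹ * (‖sobGrad u y‖ * ‖sobGrad v y‖) :=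
        norm_integral_le_of_norm_le (hp.mono_measure (Measure.restrict_mono hD le_rfl))
          (Eventually.of_forall fun y => hA.abs_tensorForm_le y _ _)
    _ ≤ ∫ y in cell d, μ⁻¹ * (‖sobGrad u y‖ * ‖sobGrad v y‖) :=
        setIntegral_mono_set hp (Eventually.of_forall fun y => by positivity) hD.eventuallyLE
    _ ≤ μ⁻¹ * (‖sobGrad u‖ * ‖sobGrad v‖) := by
        rw [integral_const_mul]
        gcongr
    _ = _ := by ring

/-- The energy on `D`, as a bounded bilinear form on `H^1`. -/
def formCLM (hA : IsCoefficient A μ) (hD : D ⊆ cell d) : H1 d m →L[ℝ] H1 d m →L[ℝ] ℝ :=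
  LinearMap.mkContinuous₂
    (LinearMap.mk₂ ℝ (form A D) (form_add_left hA hD) (fun t u v => form_smul_left hD t u v)
      (fun u v v' => by
        rw [form_symm hA, form_add_left hA hD, form_symm hA D v, form_symm hA D v'])
      (fun t u v => by
        rw [form_symm hA, form_smul_left hD, form_symm hA D v, smul_eq_mul]))
    μ⁻¹ fun u v => by
      have hμ := hA.pos
      refine (hA.abs_form_le hD u v).trans ?_
      gcongr <;> exact norm_sobGrad_le _

theorem formCLM_apply (hA : IsCoefficient A μ) (hD : D ⊆ cell d) (u v : H1 d m) :
    formCLM hA hD u v = form A D u v := rfl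

/-- Bounding the functional by the gradient of u rather than its full norm is what allows the energy
comparison to close. -/
theorem norm_formCLM_apply_le (hA : IsCoefficient A μ) (hD : D ⊆ cell d) (u : H1 d m) :
    ‖formCLM hA hD u‖ ≤ μ⁻¹ * ‖sobGrad u‖ := by
  have hμ := hA.pos
  refine ContinuousLinearMap.opNorm_le_bound _ (by positivity) fun v => ?_
  refine (hA.abs_form_le hD u v).trans ?_
  gcongr
  exact norm_sobGrad_le v

theorem form_of_sobGrad_eq_zero (hA : IsCoefficient A μ) (hD : D ⊆ cell d) (u : H1 d m)
    {v : H1 d m} (hv : sobGrad v = 0) : form A D u v = 0 := by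
  have h := hA.abs_form_le hD u v
  rw [hv, norm_zero, mul_zero] at h
  exact abs_nonpos_iff.1 h

theorem form_cell_eq_add {ω : Set (EuclideanSpace ℝ (Fin d))} (hA : IsCoefficient A μ)
    (hω : IsInclusion ω) (u v : H1 d m) :
    form A (cell d) u v = form A ω u v + form A (cell d \ ω) u v := by
  have h := setIntegral_union (disjoint_sdiff_right (s := ω) (t := cell d))
    (measurableSet_cell.diff hω.isOpen.measurableSet) (hA.integrable hω.subset_cell u v)
    (hA.integrable sdiff_subset u v)
  rw [union_sdiff_cancel hω.subset_cell] at h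
  exact h

theorem form_eq_of_indicator {ω : Set (EuclideanSpace ℝ (Fin d))} (hω : IsInclusion ω)
    (u : H1 d m) {v w : H1 d m}
    (hw : sobGrad w =ᵐ[volume.restrict (cell d)] ω.indicator (sobGrad v)) :
    form A (cell d) u w = form A ω u v := by
  have h : ∫ y in cell d, ω.indicator (fun y => tensorForm (A y) (sobGrad u y) (sobGrad v y)) y
      = form A ω u v := by
    rw [setIntegral_indicator hω.isOpen.measurableSet,
      inter_eq_self_of_subset_right hω.subset_cell, form_eq]
  rw [← h, form_eq]
  refine integral_congr_ae ?_
  filter_upwards [hw] with y hy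
  rw [hy]
  by_cases hyω : y ∈ ω <;> simp [hyω]

/-- The energy on `ω` vanishes on functions with zero trace, if the total energy does. -/
theorem form_inclusion_eq_zero {ω : Set (EuclideanSpace ℝ (Fin d))} (hω : IsInclusion ω)
    {u : H1 d m}
    (hu : ∀ v, HasTrace ω v (0 : L2Bdry ω m) → form A (cell d) u v = 0) {v : H1 d m}
    (hv : HasTrace ω v (0 : L2Bdry ω m)) : form A ω u v = 0 := by
  -- The energy of u against v in ω is its total energy against v cut off outside ω, and the cut
  -- function still has zero trace.
  obtain ⟨w, hw, hg⟩ := hv.exists_cut hω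
  rw [← form_eq_of_indicator hω u hg, hu w hw]

/-- The energy is controlled by the energy on one side of the boundary. -/
theorem exists_le_form_of_bound {ω : Set (EuclideanSpace ℝ (Fin d))} (hA : IsCoefficient A μ)
    (hD : D ⊆ cell d)
    (h : ∃ C : ENNReal, C ≠ ⊤ ∧ ∀ ℓ : H1 d m →L[ℝ] ℝ,
      (∀ v, HasTrace ω v (0 : L2Bdry ω m) → ℓ v = 0) → (∀ v, sobGrad v = 0 → ℓ v = 0) →
      ∀ v, ‖ℓ v‖ₑ ≤ ‖ℓ‖ₑ * (C * eLpNorm (sobGrad v) 2 (volume.restrict D))) :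
    ∃ κ : ℝ, 0 < κ ∧ ∀ u : H1 d m,
      (∀ v, HasTrace ω v (0 : L2Bdry ω m) → form A (cell d) u v = 0) →
      κ * form A (cell d) u u ≤ form A D u u := by
  obtain ⟨C, hC, h⟩ := h
  have hμ := hA.pos
  -- With a, b the energies over Y and D and g, N the corresponding gradient norms, a ≤ μ⁻¹gCN, g² ≤
  -- μ⁻¹a and N² ≤ μ⁻¹b give a² ≤ μ⁻⁴C²ab. The summand 1 keeps the constant positive when C is zero.
  refine ⟨(μ⁻¹ ^ 4 * C.toReal ^ 2 + 1)⁻¹, by positivity, fun u hu => ?_⟩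
  rw [inv_mul_le_iff₀ (by positivity)]
  have h1 := h (formCLM hA subset_rfl u) hu
    (fun v hv => form_of_sobGrad_eq_zero hA subset_rfl u hv) u
  have h2 := ENNReal.toReal_mono (ENNReal.mul_ne_top enorm_ne_top
    (ENNReal.mul_ne_top hC (memLp_sobGrad hD u).2.ne)) h1
  rw [toReal_enorm, ENNReal.toReal_mul, ENNReal.toReal_mul, toReal_enorm] at h2
  change |form A (cell d) u u| ≤ ‖formCLM hA subset_rfl u‖ * (C.toReal * gradNorm D u) at h2
  have h3 := norm_formCLM_apply_le hA (subset_refl (cell d)) u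
  have h4 := hA.le_form_self (subset_refl (cell d)) u
  have h5 := hA.le_form_self hD u
  rw [gradNorm_cell] at h4
  set a := form A (cell d) u u
  set b := form A D u u
  set g := ‖sobGrad u‖
  set N := gradNorm D u
  have hN : 0 ≤ N := gradNorm_nonneg D u
  have hg : 0 ≤ g := norm_nonneg _
  have ha : 0 ≤ a := le_trans (by positivity) h4
  have hb : 0 ≤ b := le_trans (by positivity) h5
  have h6 : a ≤ μ⁻¹ * g * (C.toReal * N) := (le_abs_self a).trans
    (h2.trans (mul_le_mul_of_nonneg_right h3 (by positivity)))
  have h7 : g ^ 2 ≤ μ⁻¹ * a := by rwa [← div_eq_inv_mul, le_div_iff₀' hμ]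
  have h8 : N ^ 2 ≤ μ⁻¹ * b := by rwa [← div_eq_inv_mul, le_div_iff₀' hμ]
  have h9 : a * a ≤ a * (μ⁻¹ ^ 4 * C.toReal ^ 2 * b) := by
    calc a * a ≤ (μ⁻¹ * g * (C.toReal * N)) * (μ⁻¹ * g * (C.toReal * N)) :=
          mul_le_mul h6 h6 ha (by positivity)
      _ = μ⁻¹ ^ 2 * C.toReal ^ 2 * (g ^ 2 * N ^ 2) := by ring
      _ ≤ μ⁻¹ ^ 2 * C.toReal ^ 2 * ((μ⁻¹ * a) * (μ⁻¹ * b)) := by gcongr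
      _ = _ := by ring
  rcases ha.eq_or_lt with h0 | h0
  · rw [← h0]
    positivity
  · have := le_of_mul_le_mul_left h9 h0
    linarith

end Form

/-! ### Hilbert spaces from an energy, and operators on them -/

section Energy

/-- Lax–Milgram: the operator is the one representing a coercive bilinear form. -/
theorem isUnit_of_coercive {E : Type*} [NormedAddCommGroup E] [InnerProductSpace ℝ E]
    [CompleteSpace E] (T : E →L[ℝ] E) {κ : ℝ} (hκ : 0 < κ) (h : ∀ x, κ * ‖x‖ ^ 2 ≤ ⟪T x, x⟫_ℝ) :
    IsUnit T := by
  have hco : IsCoercive ((innerSL ℝ (E := E)).comp T) := ⟨κ, hκ, fun x => by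
    have := h x
    rw [sq, ← mul_assoc] at this
    exact this⟩
  have e : (hco.continuousLinearEquivOfBilin : E →L[ℝ] E) = T := by
    ext x
    refine ext_inner_right ℝ fun y => ?_
    exact hco.continuousLinearEquivOfBilin_apply x y
  rw [← e]
  exact ⟨ContinuousLinearEquiv.toUnit hco.continuousLinearEquivOfBilin, rfl⟩

/-- The spectrum of an operator whose quadratic form lies strictly between `-r` and `r`. -/
theorem spectrum_subset_Ioo {E : Type*} [NormedAddCommGroup E] [InnerProductSpace ℝ E]
    [CompleteSpace E] (T : E →L[ℝ] E) {κ r : ℝ} (hκ : 0 < κ)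
    (h1 : ∀ x, ⟪T x, x⟫_ℝ ≤ (r - κ) * ‖x‖ ^ 2) (h2 : ∀ x, -((r - κ) * ‖x‖ ^ 2) ≤ ⟪T x, x⟫_ℝ) :
    spectrum ℝ T ⊆ Ioo (-r) r := by
  intro t ht
  by_contra hnot
  refine ht ?_
  rw [mem_Ioo, not_and_or, not_lt, not_lt] at hnot
  have hval : ∀ x, ⟪(algebraMap ℝ (E →L[ℝ] E) t - T) x, x⟫_ℝ = t * ‖x‖ ^ 2 - ⟪T x, x⟫_ℝ := by
    intro x
    rw [_root_.sub_apply, inner_sub_left, Algebra.algebraMap_eq_smul_one,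
      _root_.smul_apply, one_apply_eq_self, real_inner_smul_left,
      real_inner_self_eq_norm_sq]
  -- For t ≤ -r the operator T - t has quadratic form at least κ‖x‖², and for t ≥ r so does t - T;
  -- either way t is in the resolvent set.
  rcases hnot with hle | hge
  · have hu : IsUnit (-(algebraMap ℝ (E →L[ℝ] E) t - T)) := by
      refine isUnit_of_coercive _ hκ fun x => ?_
      rw [_root_.neg_apply, inner_neg_left, hval]
      nlinarith [h2 x, sq_nonneg ‖x‖]
    have := hu.neg
    rwa [neg_neg] at this
  · refine isUnit_of_coercive _ hκ fun x => ?_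
    rw [hval]
    nlinarith [h1 x, sq_nonneg ‖x‖]

/-- The space `X` with the energy of `S x` as inner product, and a symmetric operator on it. -/
theorem exists_core_of_energy {X V : Type*} [AddCommGroup X] [Module ℝ X] [NormedAddCommGroup V]
    [NormedSpace ℝ V] [CompleteSpace V] (S : X →ₗ[ℝ] V) (s : X → V) (hs : ∀ x, S x = s x)
    (hS : Function.Injective s) (hclosed : IsClosed (range s)) (a : V →L[ℝ] V →L[ℝ] ℝ)
    (q : V → V → ℝ) (hq : ∀ u v, a u v = q u v) (ha : ∀ u v, q u v = q v u) {α : ℝ}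
    (hα : 0 < α) (hco : ∀ x, α * ‖s x‖ ^ 2 ≤ q (s x) (s x)) (T : X →ₗ[ℝ] X) (t : X → X)
    (ht : ∀ x, T x = t x) (hT : ∀ x y, q (s (t x)) (s y) = q (s x) (s (t y))) {κ r : ℝ}
    (hκ : 0 < κ) (h1 : ∀ x, q (s (t x)) (s x) ≤ (r - κ) * q (s x) (s x))
    (h2 : ∀ x, -((r - κ) * q (s x) (s x)) ≤ q (s (t x)) (s x)) :
    ∃ ip : InnerProductSpace.Core ℝ X,
      (∀ x y, ip.inner x y = q (s x) (s y)) ∧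
      letI : NormedAddCommGroup X := ip.toNormedAddCommGroup
      letI : InnerProductSpace ℝ X := InnerProductSpace.ofCore ip.toCore
      ∃ _ : CompleteSpace X, ∃ K : X →L[ℝ] X,
        (∀ x, K x = t x) ∧ IsSelfAdjoint K ∧ spectrum ℝ K ⊆ Ioo (-r) r := by
  obtain rfl : s = S := funext fun x => (hs x).symm
  obtain rfl : t = T := funext fun x => (ht x).symm
  simp only [← hq] at ha hco hT h1 h2 ⊢
  have hnonneg : ∀ x, 0 ≤ a (S x) (S x) := fun x => le_trans (by positivity) (hco x)
  let ip : InnerProductSpace.Core ℝ X :=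
    { inner := fun x y => a (S x) (S y)
      conj_inner_symm := fun x y => ha _ _
      re_inner_nonneg := hnonneg
      add_left := fun x y z => by simp only [map_add, _root_.add_apply]
      smul_left := fun x y t => by
        simp only [map_smul, _root_.smul_apply, smul_eq_mul, conj_trivial]
      definite := fun x hx => by
        have h := hco x
        have hx' : a (S x) (S x) = 0 := hx
        rw [hx'] at h
        have h0 : ‖S x‖ ^ 2 = 0 :=
          le_antisymm (nonpos_of_mul_nonpos_right h hα) (sq_nonneg _)
        exact (map_eq_zero_iff S hS).1 (norm_eq_zero.1 (pow_eq_zero_iff two_ne_zero |>.1 h0)) }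
  refine ⟨ip, fun x y => rfl, ?_⟩
  let _ : NormedAddCommGroup X := ip.toNormedAddCommGroup
  let _ : InnerProductSpace ℝ X := InnerProductSpace.ofCore ip.toCore
  have hinner : ∀ x y : X, ⟪x, y⟫_ℝ = a (S x) (S y) := fun x y => rfl
  have hnorm : ∀ x : X, ‖x‖ ^ 2 = a (S x) (S x) := fun x => by
    rw [← real_inner_self_eq_norm_sq, hinner]
  have hup : ∀ x : X, ‖S x‖ ≤ (Real.sqrt α)⁻¹ * ‖x‖ := fun x => by
    rw [← div_eq_inv_mul, le_div_iff₀' (Real.sqrt_pos.2 hα)]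
    refine (pow_le_pow_iff_left₀ (by positivity) (norm_nonneg _) two_ne_zero).1 ?_
    rw [mul_pow, Real.sq_sqrt hα.le, hnorm]
    exact hco x
  have hlow : ∀ x : X, ‖x‖ ≤ Real.sqrt ‖a‖ * ‖S x‖ := fun x => by
    refine (pow_le_pow_iff_left₀ (norm_nonneg _) (by positivity) two_ne_zero).1 ?_
    rw [mul_pow, Real.sq_sqrt (norm_nonneg a), hnorm]
    refine (le_abs_self _).trans ((a.le_opNorm₂ _ _).trans (le_of_eq ?_))
    ring
  let Sc : X →L[ℝ] V := S.mkContinuous _ hup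
  have hanti : AntilipschitzWith (Real.sqrt ‖a‖).toNNReal Sc :=
    Sc.antilipschitz_of_bound fun x => by
      rw [Real.coe_toNNReal _ (Real.sqrt_nonneg _)]
      exact hlow x
  -- The energy norm is equivalent to the norm of S x, so X is uniformly isomorphic to the closed
  -- range of S.
  have hcomp : CompleteSpace X :=
    (completeSpace_iff_isComplete_range (hanti.isUniformInducing Sc.uniformContinuous)).2
      hclosed.isComplete
  refine ⟨hcomp, ?_⟩
  have hsym : T.IsSymmetric := fun x y => hT x y
  -- Continuity is the Hellinger–Toeplitz theorem: completeness of X was needed first.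
  let K : X →L[ℝ] X := ⟨T, hsym.continuous⟩
  refine ⟨K, fun x => rfl, ContinuousLinearMap.isSelfAdjoint_iff_isSymmetric.2 hsym, ?_⟩
  refine spectrum_subset_Ioo K hκ (fun x => ?_) fun x => ?_
  · rw [hnorm]
    exact h1 x
  · rw [hnorm]
    exact h2 x

/-- Solvability for a form that is coercive on the orthogonal complement of its kernel. -/
theorem exists_solution_of_coercive {V : Type*} [NormedAddCommGroup V] [InnerProductSpace ℝ V]
    [CompleteSpace V] (Z : Submodule ℝ V) (hZ : IsClosed (Z : Set V)) (a : V →L[ℝ] V →L[ℝ] ℝ)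
    {α : ℝ} (hα : 0 < α) (hco : ∀ u ∈ Zᗮ, α * ‖u‖ ^ 2 ≤ a u u) (haZ : ∀ u, ∀ z ∈ Z, a u z = 0)
    (ℓ : V →L[ℝ] ℝ) (hℓ : ∀ z ∈ Z, ℓ z = 0) : ∃ u ∈ Zᗮ, ∀ v, a u v = ℓ v := by
  have : CompleteSpace Z := hZ.completeSpace_coe
  let B : Zᗮ →L[ℝ] Zᗮ →L[ℝ] ℝ := a.bilinearComp Zᗮ.subtypeL Zᗮ.subtypeL
  have hB : IsCoercive B := ⟨α, hα, fun u => by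
    have := hco u.1 u.2
    rw [sq, ← mul_assoc] at this
    exact this⟩
  obtain ⟨w, hw⟩ := (InnerProductSpace.toDual ℝ Zᗮ).surjective (ℓ.comp Zᗮ.subtypeL)
  obtain ⟨u, hu⟩ := hB.continuousLinearEquivOfBilin.surjective w
  refine ⟨u.1, u.2, fun v => ?_⟩
  have hkey : ∀ v : Zᗮ, a u.1 v.1 = ℓ v.1 := fun v => by
    have h1 := hB.continuousLinearEquivOfBilin_apply u v
    rw [hu, ← InnerProductSpace.toDual_apply_apply, hw] at h1
    exact h1.symm
  -- The equation was solved against the orthogonal complement only; both sides vanish on Z, so it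
  -- holds for all v.
  rw [← Z.starProjection_add_starProjection_orthogonal v, map_add, map_add,
    haZ _ _ (Z.starProjection_apply_mem v), hℓ _ (Z.starProjection_apply_mem v)]
  exact congrArg _ (hkey ⟨_, Zᗮ.starProjection_apply_mem v⟩)

end Energy

/-! ### The single-layer potential -/

section SingleLayer

variable {d m : ℕ} {ω : Set (EuclideanSpace ℝ (Fin d))}
  {A : EuclideanSpace ℝ (Fin d) → Fin d → Fin d → Fin m → Fin m → ℝ} {μ : ℝ}

/-- The trace map. -/
def traceMap (hω : IsInclusion ω) (m : ℕ) : H1 d m →ₗ[ℝ] HHalf ω m where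
  toFun v := ⟨(hω.exists_hasTrace v).choose, ⟨(v, _), (hω.exists_hasTrace v).choose_spec, rfl⟩⟩
  map_add' v w := Subtype.ext <| hω.hasTrace_unique (hω.exists_hasTrace (v + w)).choose_spec
    ((hω.exists_hasTrace v).choose_spec.add (hω.exists_hasTrace w).choose_spec)
  map_smul' t v := Subtype.ext <| hω.hasTrace_unique (hω.exists_hasTrace (t • v)).choose_spec
    ((hω.exists_hasTrace v).choose_spec.smul t)

theorem hasTrace_traceMap (hω : IsInclusion ω) (v : H1 d m) :
    HasTrace ω v (traceMap hω m v : L2Bdry ω m) := (hω.exists_hasTrace v).choose_spec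

theorem HasTrace.eq_traceMap (hω : IsInclusion ω) {v : H1 d m} {g : HHalf ω m}
    (h : HasTrace ω v (g : L2Bdry ω m)) : g = traceMap hω m v :=
  Subtype.ext (hω.hasTrace_unique h (hasTrace_traceMap hω v))

theorem traceMap_eq_zero (hω : IsInclusion ω) {v : H1 d m} :
    traceMap hω m v = 0 ↔ HasTrace ω v (0 : L2Bdry ω m) := by
  constructor
  · intro h
    have := hasTrace_traceMap hω v
    rwa [h] at this
  · intro h
    exact (HasTrace.eq_traceMap hω (g := 0) h).symm

theorem traceMap_surjective (hω : IsInclusion ω) : Function.Surjective (traceMap hω m) := by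
  intro g
  obtain ⟨p, hp, hg⟩ := g.2
  have h : HasTrace ω p.1 (g : L2Bdry ω m) := by
    rw [← hg]
    exact hp
  exact ⟨p.1, (HasTrace.eq_traceMap hω h).symm⟩

theorem halfNorm_nonneg (g : HHalf ω m) : 0 ≤ halfNorm g := by
  refine Real.sInf_nonneg ?_
  rintro r ⟨v, -, rfl⟩
  exact norm_nonneg v

theorem halfNorm_le {g : HHalf ω m} {v : H1 d m} (h : HasTrace ω v (g : L2Bdry ω m)) :
    halfNorm g ≤ ‖v‖ := by
  refine csInf_le ⟨0, ?_⟩ ⟨v, h, rfl⟩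
  rintro r ⟨v, -, rfl⟩
  exact norm_nonneg v

/-- A function with zero gradient is constant. -/
theorem exists_represents_const_of_sobGrad_eq_zero {v : H1 d m} (hv : sobGrad v = 0) :
    ∃ c, Represents v fun _ => c := by
  obtain ⟨C, -, hC⟩ := exists_norm_sobVal_le d m
  have hM0 : ((volume : Measure (EuclideanSpace ℝ (Fin d))).restrict (cell d)).real univ ≠ 0 := by
    rw [measureReal_restrict_apply_univ]
    refine (ENNReal.toReal_pos (isOpen_cell.measure_pos volume ⟨0, zero_mem_cell⟩).ne'
      isBounded_cell.measure_lt_top.ne).ne'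
  set c : EuclideanSpace ℝ (Fin m) := (((volume : Measure (EuclideanSpace ℝ (Fin d))).restrict (cell d)).real univ)⁻¹
    • ∫ y in cell d, sobVal v y with hc
  obtain ⟨a, ha⟩ := exists_represents_of_periodic (f := fun _ : EuclideanSpace ℝ (Fin d) => c)
    contDiff_const (fun _ _ => rfl)
  have ha0 : sobGrad a = 0 := by
    refine Lp.ext ?_
    filter_upwards [ha.2, Lp.coeFn_zero (EuclideanSpace ℝ (Fin d × Fin m)) 2
      ((volume : Measure (EuclideanSpace ℝ (Fin d))).restrict (cell d))] with y h1 h2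
    rw [h1, h2, classicalGrad_const]
    rfl
  have hmean : ∫ y in cell d, sobVal (v - a) y = 0 := by
    have e : ∫ y in cell d, sobVal (v - a) y = ∫ y in cell d, (sobVal v y - c) := by
      refine integral_congr_ae ?_
      filter_upwards [Lp.coeFn_sub (sobVal v) (sobVal a), ha.1] with y h1 h2
      have h3 : sobVal (v - a) y = (sobVal v - sobVal a : L2Val d m) y := rfl
      rw [h3, h1, Pi.sub_apply, h2]
    rw [e, integral_sub ((Lp.memLp (sobVal v)).integrable (by norm_num)) (integrable_const c),
      integral_const, hc, smul_smul, mul_inv_cancel₀ hM0, one_smul, sub_self]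
  have hgrad : sobGrad (v - a) = 0 := by
    have h : sobGrad (v - a) = sobGrad v - sobGrad a := rfl
    rw [h, hv, ha0, sub_zero]
  have hz : v - a = 0 := by
    have h1 := hC _ hmean
    rw [hgrad, norm_zero, mul_zero] at h1
    have h2 := norm_sq_H1 (v - a)
    rw [hgrad, le_antisymm h1 (norm_nonneg _), norm_zero] at h2
    have h3 : ‖v - a‖ = 0 := by
      refine pow_eq_zero_iff two_ne_zero |>.1 ?_
      rw [h2]
      ring
    exact norm_eq_zero.1 h3
  rw [sub_eq_zero.1 hz]
  exact ⟨c, ha⟩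

/-! ### Duality between H_0^{-1/2} and functionals on H^1. -/

theorem HMinusHalfZero.exists_bound (hω : IsInclusion ω) (ψ : HMinusHalfZero ω m) :
    ∃ C : ℝ, ∀ v, ‖ψ.1 (traceMap hω m v)‖ ≤ C * ‖v‖ := by
  obtain ⟨C, hC⟩ := ψ.2.1
  refine ⟨|C|, fun v => (hC _).trans ?_⟩
  calc C * halfNorm (traceMap hω m v) ≤ |C| * halfNorm (traceMap hω m v) :=
        mul_le_mul_of_nonneg_right (le_abs_self C) (halfNorm_nonneg _)
    _ ≤ |C| * ‖v‖ := by
        gcongr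
        exact halfNorm_le (hasTrace_traceMap hω v)

/-- Zero gradient means constant, and a constant restricts to its own value on the boundary. This is
the compatibility condition for the variational problem. -/
theorem HMinusHalfZero.apply_of_sobGrad_eq_zero (hω : IsInclusion ω) (ψ : HMinusHalfZero ω m)
    {v : H1 d m} (hv : sobGrad v = 0) : ψ.1 (traceMap hω m v) = 0 := by
  obtain ⟨c, hc⟩ := exists_represents_const_of_sobGrad_eq_zero hv
  have hm := memLp_surface_of_bddLip hω (bddLip_const c)
  have ht : HasTrace ω v (hm.toLp _) := hc.hasTrace hω (bddLip_const c) hm.coeFn_toLp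
  refine ψ.2.2 c _ ?_
  rw [hω.hasTrace_unique (hasTrace_traceMap hω v) ht]
  exact hm.coeFn_toLp

/-- Bounded functionals on `H^1` that vanish on functions with zero trace and on constants come
from `H_0^{-1/2}`. -/
theorem exists_dual (hω : IsInclusion ω) (ℓ : H1 d m →L[ℝ] ℝ)
    (h1 : ∀ v, HasTrace ω v (0 : L2Bdry ω m) → ℓ v = 0) (h2 : ∀ v, sobGrad v = 0 → ℓ v = 0) :
    ∃ ψ : HMinusHalfZero ω m, ∀ v, ψ.1 (traceMap hω m v) = ℓ v := by
  -- A linear right inverse of the trace map, not assumed bounded. Its choice is irrelevant because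
  -- the functional kills the kernel of the trace; the bound in the quotient norm comes from taking
  -- the infimum over all functions with the given trace.
  obtain ⟨s, hs⟩ := (traceMap hω m).exists_rightInverse_of_surjective
    (LinearMap.range_eq_top.2 (traceMap_surjective hω))
  have hτ : ∀ v, ℓ (s (traceMap hω m v)) = ℓ v := by
    intro v
    rw [← sub_eq_zero, ← map_sub]
    refine h1 _ ((traceMap_eq_zero hω).1 ?_)
    rw [map_sub, sub_eq_zero]
    exact LinearMap.congr_fun hs _
  refine ⟨⟨(ℓ : H1 d m →ₗ[ℝ] ℝ).comp s, ⟨‖ℓ‖, fun g => ?_⟩, fun c g hg => ?_⟩, hτ⟩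
  · have hle : ∀ v : H1 d m, HasTrace ω v (g : L2Bdry ω m) → |ℓ (s g)| ≤ ‖ℓ‖ * ‖v‖ := by
      intro v hv
      rw [HasTrace.eq_traceMap hω hv, hτ]
      exact ℓ.le_opNorm v
    obtain ⟨v₀, hv₀⟩ := traceMap_surjective hω g
    have ht₀ : HasTrace ω v₀ (g : L2Bdry ω m) := by
      rw [← hv₀]
      exact hasTrace_traceMap hω v₀
    change |ℓ (s g)| ≤ ‖ℓ‖ * halfNorm g
    rcases (norm_nonneg ℓ).eq_or_lt with h0 | h0
    · have := hle v₀ ht₀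
      rw [← h0, zero_mul] at this ⊢
      exact this
    · rw [← div_le_iff₀' h0]
      refine le_csInf ⟨_, v₀, ht₀, rfl⟩ ?_
      rintro r ⟨v, hv, rfl⟩
      rw [div_le_iff₀' h0]
      exact hle v hv
  · obtain ⟨v, g', hv, hv0, ht, hg'⟩ := exists_const_H1 hω c
    have hgg : (g : L2Bdry ω m) = g' := Lp.ext (hg.trans hg'.symm)
    rw [← hgg] at ht
    change ℓ (s g) = 0
    rw [HasTrace.eq_traceMap hω ht, hτ, h2 v hv0]

/-! ### Solvability, uniqueness and the range of the single-layer potential. -/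

theorem isSingleLayer_iff (hω : IsInclusion ω) {ψ : HMinusHalfZero ω m} {u : H1 d m} :
    IsSingleLayer A ψ.1 u ↔ ∫ y in cell d, sobVal u y = 0 ∧
      ∀ v, form A (cell d) u v = -ψ.1 (traceMap hω m v) := by
  refine and_congr_right fun _ => ⟨fun h v => ?_, fun h v g hg => ?_⟩
  · exact eq_neg_of_add_eq_zero_left (h v _ (hasTrace_traceMap hω v))
  · rw [HasTrace.eq_traceMap hω hg, h v, neg_add_cancel]

/-- Functions of mean zero whose energy functional vanishes are zero. -/
theorem eq_zero_of_form_self_eq_zero (hA : IsCoefficient A μ) {u : H1 d m}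
    (hu : ∫ y in cell d, sobVal u y = 0) (h : form A (cell d) u u = 0) : u = 0 := by
  obtain ⟨C, -, hC⟩ := exists_norm_sobVal_le d m
  have h1 := hA.le_form_self (subset_refl (cell d)) u
  rw [h, gradNorm_cell] at h1
  have h2 : ‖sobGrad u‖ ^ 2 = 0 := le_antisymm (nonpos_of_mul_nonpos_right h1 hA.pos) (sq_nonneg _)
  have h3 : ‖sobGrad u‖ = 0 := pow_eq_zero_iff two_ne_zero |>.1 h2
  have h4 := hC u hu
  rw [h3, mul_zero] at h4
  have h5 := norm_sq_H1 u
  rw [h2, le_antisymm h4 (norm_nonneg _)] at h5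
  refine norm_eq_zero.1 (pow_eq_zero_iff two_ne_zero |>.1 (h5.trans ?_))
  ring

theorem integral_sobVal_add (u v : H1 d m) : ∫ y in cell d, sobVal (u + v) y
    = (∫ y in cell d, sobVal u y) + ∫ y in cell d, sobVal v y := by
  rw [← integral_add ((Lp.memLp (sobVal u)).integrable (by norm_num))
    ((Lp.memLp (sobVal v)).integrable (by norm_num))]
  exact integral_congr_ae (Lp.coeFn_add (sobVal u) (sobVal v))

theorem integral_sobVal_smul (t : ℝ) (u : H1 d m) : ∫ y in cell d, sobVal (t • u) y
    = t • ∫ y in cell d, sobVal u y := by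
  rw [← integral_smul]
  exact integral_congr_ae (Lp.coeFn_smul t (sobVal u))

/-- By Poincaré ‖u‖² ≤ (C² + 1)‖∇u‖² for mean-zero u, and ellipticity bounds the energy below by
μ‖∇u‖². -/
theorem exists_coercive (hA : IsCoefficient A μ) : ∃ α : ℝ, 0 < α ∧ ∀ u : H1 d m,
    ∫ y in cell d, sobVal u y = 0 → α * ‖u‖ ^ 2 ≤ form A (cell d) u u := by
  obtain ⟨C, hC0, hC⟩ := exists_norm_sobVal_le d m
  have hμ := hA.pos
  refine ⟨μ / (C ^ 2 + 1), by positivity, fun u hu => ?_⟩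
  refine le_trans ?_ (hA.le_form_self (subset_refl (cell d)) u)
  rw [gradNorm_cell, norm_sq_H1, div_mul_eq_mul_div, mul_div_assoc]
  gcongr
  rw [div_le_iff₀ (by positivity)]
  have := pow_le_pow_left₀ (norm_nonneg _) (hC u hu) 2
  rw [mul_pow] at this
  linarith

theorem isSingleLayer_unique (hω : IsInclusion ω) (hA : IsCoefficient A μ)
    {ψ : HMinusHalfZero ω m} {u v : H1 d m} (hu : IsSingleLayer A ψ.1 u)
    (hv : IsSingleLayer A ψ.1 v) : u = v := by
  rw [isSingleLayer_iff hω] at hu hv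
  have e : u - v = u + (-1 : ℝ) • v := by module
  refine sub_eq_zero.1 (eq_zero_of_form_self_eq_zero hA ?_ ?_)
  · rw [e, integral_sobVal_add, integral_sobVal_smul, hu.1, hv.1, smul_zero, add_zero]
  · have h : ∀ w, form A (cell d) (u - v) w = 0 := fun w => by
      rw [e, form_add_left hA subset_rfl, form_smul_left subset_rfl, hu.2, hv.2]
      ring
    exact h _

theorem integral_sobVal_eq_zero_of_orthogonal {u : H1 d m}
    (hu : ∀ a : H1 d m, sobGrad a = 0 → ⟪a, u⟫_ℝ = 0) : ∫ y in cell d, sobVal u y = 0 := by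
  set c := ∫ y in cell d, sobVal u y with hc
  obtain ⟨a, ha⟩ := exists_represents_of_periodic (f := fun _ : EuclideanSpace ℝ (Fin d) => c)
    contDiff_const (fun _ _ => rfl)
  have ha0 : sobGrad a = 0 := by
    refine Lp.ext ?_
    filter_upwards [ha.2, Lp.coeFn_zero (EuclideanSpace ℝ (Fin d × Fin m)) 2
      ((volume : Measure (EuclideanSpace ℝ (Fin d))).restrict (cell d))] with y h1 h2
    rw [h1, h2, classicalGrad_const]
    rfl
  have h := hu a ha0
  have e : ⟪sobVal a, sobVal u⟫_ℝ = ∫ y in cell d, ⟪c, sobVal u y⟫_ℝ := by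
    rw [L2.inner_def]
    refine integral_congr_ae ?_
    filter_upwards [ha.1] with y hy
    rw [hy]
  rw [inner_H1, ha0, inner_zero_left, add_zero, e,
    integral_inner ((Lp.memLp (sobVal u)).integrable (by norm_num)), ← hc] at h
  exact inner_self_eq_zero.1 h

theorem exists_isSingleLayer (hω : IsInclusion ω) (hA : IsCoefficient A μ)
    (ψ : HMinusHalfZero ω m) : ∃ u : H1 d m, IsSingleLayer A ψ.1 u := by
  -- The constants. Functions orthogonal to Z have mean zero, so the energy is coercive there, and ψ
  -- vanishes on Z.
  let Z : Submodule ℝ (H1 d m) := (gradCLM d m).ker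
  have hZ : ∀ z ∈ Z, sobGrad z = 0 := fun z hz => hz
  have hZc : IsClosed (Z : Set (H1 d m)) := (gradCLM d m).isClosed_ker
  have hmean : ∀ u ∈ Zᗮ, ∫ y in cell d, sobVal u y = 0 := fun u hu =>
    integral_sobVal_eq_zero_of_orthogonal fun a ha => (Submodule.mem_orthogonal Z u).1 hu a ha
  obtain ⟨α, hα, hco⟩ := exists_coercive hA
  obtain ⟨C, hC⟩ := HMinusHalfZero.exists_bound hω ψ
  obtain ⟨u, hu, h⟩ := exists_solution_of_coercive Z hZc (formCLM hA (subset_refl (cell d))) hα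
    (fun u hu => hco u (hmean u hu))
    (fun u z hz => form_of_sobGrad_eq_zero hA subset_rfl u (hZ z hz))
    (-(ψ.1.comp (traceMap hω m)).mkContinuous C hC) (fun z hz => by
      rw [_root_.neg_apply, neg_eq_zero]
      exact HMinusHalfZero.apply_of_sobGrad_eq_zero hω ψ (hZ z hz))
  exact ⟨u, (isSingleLayer_iff hω).2 ⟨hmean u hu, h⟩⟩

/-- The single-layer potential as a linear map. -/
def singleLayer (hω : IsInclusion ω) (hA : IsCoefficient A μ) : HMinusHalfZero ω m →ₗ[ℝ] H1 d m where
  toFun ψ := (exists_isSingleLayer hω hA ψ).choose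
  map_add' φ ψ := by
    refine isSingleLayer_unique hω hA (exists_isSingleLayer hω hA (φ + ψ)).choose_spec ?_
    have h1 := (isSingleLayer_iff hω).1 (exists_isSingleLayer hω hA φ).choose_spec
    have h2 := (isSingleLayer_iff hω).1 (exists_isSingleLayer hω hA ψ).choose_spec
    refine (isSingleLayer_iff hω).2 ⟨?_, fun v => ?_⟩
    · rw [integral_sobVal_add, h1.1, h2.1, add_zero]
    · rw [form_add_left hA subset_rfl, h1.2, h2.2, ← neg_add]
      rfl
  map_smul' t ψ := by
    refine isSingleLayer_unique hω hA (exists_isSingleLayer hω hA (t • ψ)).choose_spec ?_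
    have h1 := (isSingleLayer_iff hω).1 (exists_isSingleLayer hω hA ψ).choose_spec
    refine (isSingleLayer_iff hω).2 ⟨?_, fun v => ?_⟩
    · rw [RingHom.id_apply, integral_sobVal_smul, h1.1, smul_zero]
    · rw [RingHom.id_apply, form_smul_left subset_rfl, h1.2, mul_neg]
      rfl

theorem isSingleLayer_singleLayer (hω : IsInclusion ω) (hA : IsCoefficient A μ)
    (ψ : HMinusHalfZero ω m) : IsSingleLayer A ψ.1 (singleLayer hω hA ψ) :=
  (exists_isSingleLayer hω hA ψ).choose_spec

theorem isSingleLayer_iff_eq (hω : IsInclusion ω) (hA : IsCoefficient A μ)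
    (ψ : HMinusHalfZero ω m) (u : H1 d m) :
    IsSingleLayer A ψ.1 u ↔ u = singleLayer hω hA ψ := by
  constructor
  · intro h
    exact isSingleLayer_unique hω hA h (isSingleLayer_singleLayer hω hA ψ)
  · rintro rfl
    exact isSingleLayer_singleLayer hω hA ψ

theorem form_singleLayer (hω : IsInclusion ω) (hA : IsCoefficient A μ) (ψ : HMinusHalfZero ω m)
    (v : H1 d m) :
    form A (cell d) (singleLayer hω hA ψ) v = -ψ.1 (traceMap hω m v) :=
  ((isSingleLayer_iff hω).1 (isSingleLayer_singleLayer hω hA ψ)).2 v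

theorem form_singleLayer_of_hasTrace_zero (hω : IsInclusion ω) (hA : IsCoefficient A μ)
    (ψ : HMinusHalfZero ω m) {v : H1 d m} (hv : HasTrace ω v (0 : L2Bdry ω m)) :
    form A (cell d) (singleLayer hω hA ψ) v = 0 := by
  rw [form_singleLayer, (traceMap_eq_zero hω).2 hv, map_zero, neg_zero]

theorem HMinusHalfZero.ext_traceMap (hω : IsInclusion ω) {φ ψ : HMinusHalfZero ω m}
    (h : ∀ v, φ.1 (traceMap hω m v) = ψ.1 (traceMap hω m v)) : φ = ψ := by
  refine Subtype.ext (LinearMap.ext fun g => ?_)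
  obtain ⟨v, rfl⟩ := traceMap_surjective hω g
  exact h v

theorem singleLayer_injective (hω : IsInclusion ω) (hA : IsCoefficient A μ) :
    Function.Injective (singleLayer hω hA) := by
  intro φ ψ h
  refine HMinusHalfZero.ext_traceMap hω fun v => ?_
  have h1 := form_singleLayer hω hA φ v
  rw [h, form_singleLayer] at h1
  exact (neg_injective h1).symm

/-- The energy functional of such a u kills zero traces and constants, so minus it is an element of
H_0^{-1/2}, whose potential is u by uniqueness. The range is thus cut out by conditions that pass to
limits. -/
theorem mem_range_singleLayer (hω : IsInclusion ω) (hA : IsCoefficient A μ) {u : H1 d m}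
    (hu : ∫ y in cell d, sobVal u y = 0)
    (h : ∀ v, HasTrace ω v (0 : L2Bdry ω m) → form A (cell d) u v = 0) :
    u ∈ range (singleLayer hω hA) := by
  obtain ⟨ψ, hψ⟩ := exists_dual hω (-(formCLM hA (subset_refl (cell d)) u))
    (fun v hv => by
      rw [_root_.neg_apply, formCLM_apply, h v hv, neg_zero])
    (fun v hv => by
      rw [_root_.neg_apply, formCLM_apply, form_of_sobGrad_eq_zero hA subset_rfl u hv, neg_zero])
  refine ⟨ψ, ((isSingleLayer_iff_eq hω hA ψ u).1 ((isSingleLayer_iff hω).2 ⟨hu, fun v => ?_⟩)).symm⟩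
  rw [hψ, _root_.neg_apply, formCLM_apply, neg_neg]

theorem isClosed_range_singleLayer (hω : IsInclusion ω) (hA : IsCoefficient A μ) :
    IsClosed (range (singleLayer hω hA)) := by
  obtain ⟨C, -, hC⟩ := exists_norm_sobVal_le d m
  refine IsSeqClosed.isClosed fun u v hu hlim => ?_
  choose ψ hψ using hu
  have hmean : ∀ n, ∫ y in cell d, sobVal (u n) y = 0 := fun n => by
    rw [← hψ n]
    exact (isSingleLayer_singleLayer hω hA (ψ n)).1
  refine mem_range_singleLayer hω hA ?_ fun w hw => ?_
  · refine integral_sobVal_eq_zero_of_orthogonal fun a ha => ?_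
    -- Mean zero is expressed as orthogonality in H^1 to the functions of zero gradient, a condition
    -- visibly closed under limits.
    have h0 : ∀ n, ⟪a, u n⟫_ℝ = 0 := fun n => by
      obtain ⟨c, hc⟩ := exists_represents_const_of_sobGrad_eq_zero ha
      rw [inner_H1, ha, inner_zero_left, add_zero, L2.inner_def]
      have e : ∫ y in cell d, ⟪sobVal a y, sobVal (u n) y⟫_ℝ
          = ∫ y in cell d, ⟪c, sobVal (u n) y⟫_ℝ := by
        refine integral_congr_ae ?_
        filter_upwards [hc.1] with y hy
        rw [hy]
      rw [e, integral_inner ((Lp.memLp (sobVal (u n))).integrable (by norm_num)), hmean n,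
        inner_zero_right]
    have h1 := ((innerSL ℝ a).continuous.tendsto v).comp hlim
    refine tendsto_nhds_unique h1 (tendsto_const_nhds.congr fun n => (h0 n).symm)
  · have h1 := (((formCLM hA (subset_refl (cell d))).flip w).continuous.tendsto v).comp hlim
    refine tendsto_nhds_unique h1 (tendsto_const_nhds.congr fun n => ?_)
    change 0 = form A (cell d) (u n) w
    rw [← hψ n, form_singleLayer_of_hasTrace_zero hω hA _ hw]

end SingleLayer

/-! ### The Neumann–Poincaré operator -/

section NeumannPoincare

variable {d m : ℕ} {ω : Set (EuclideanSpace ℝ (Fin d))}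
  {A : EuclideanSpace ℝ (Fin d) → Fin d → Fin d → Fin m → Fin m → ℝ} {μ : ℝ}

/-- The interior energy functional kills zero-trace functions by the cutting argument and constants
because their gradient vanishes, so it descends to traces. -/
theorem exists_conormal (hω : IsInclusion ω) (hA : IsCoefficient A μ) (ψ : HMinusHalfZero ω m) :
    ∃ φ : HMinusHalfZero ω m, ∀ v,
      φ.1 (traceMap hω m v) = form A ω (singleLayer hω hA ψ) v :=
  exists_dual hω (formCLM hA hω.subset_cell (singleLayer hω hA ψ))
    (fun _ hv => form_inclusion_eq_zero hω
      (fun _ hw => form_singleLayer_of_hasTrace_zero hω hA ψ hw) hv)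
    (fun _ hv => form_of_sobGrad_eq_zero hA hω.subset_cell _ hv)

/-- The interior conormal derivative of the single-layer potential. -/
def conormal (hω : IsInclusion ω) (hA : IsCoefficient A μ) :
    HMinusHalfZero ω m →ₗ[ℝ] HMinusHalfZero ω m where
  toFun ψ := (exists_conormal hω hA ψ).choose
  map_add' φ ψ := HMinusHalfZero.ext_traceMap hω fun v => by
    rw [(exists_conormal hω hA (φ + ψ)).choose_spec v, map_add, form_add_left hA hω.subset_cell,
      ← (exists_conormal hω hA φ).choose_spec v, ← (exists_conormal hω hA ψ).choose_spec v]
    rfl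
  map_smul' t ψ := HMinusHalfZero.ext_traceMap hω fun v => by
    rw [(exists_conormal hω hA (t • ψ)).choose_spec v, map_smul, form_smul_left hω.subset_cell,
      ← (exists_conormal hω hA ψ).choose_spec v]
    rfl

theorem conormal_apply (hω : IsInclusion ω) (hA : IsCoefficient A μ) (ψ : HMinusHalfZero ω m)
    (v : H1 d m) : (conormal hω hA ψ).1 (traceMap hω m v)
      = form A ω (singleLayer hω hA ψ) v :=
  (exists_conormal hω hA ψ).choose_spec v

theorem isConormalInt_conormal (hω : IsInclusion ω) (hA : IsCoefficient A μ)
    (ψ : HMinusHalfZero ω m) :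
    IsConormalInt A (singleLayer hω hA ψ) (conormal hω hA ψ).1 := by
  intro v g hg
  rw [HasTrace.eq_traceMap hω hg, conormal_apply]

/-- The jump relation: interior plus exterior energy equals -ψ on every trace, so the exterior
conormal derivative exceeds the interior one by ψ. -/
theorem isConormalExt_conormal_add (hω : IsInclusion ω) (hA : IsCoefficient A μ)
    (ψ : HMinusHalfZero ω m) :
    IsConormalExt A (singleLayer hω hA ψ) (conormal hω hA ψ + ψ).1 := by
  intro v g hg
  have h1 := form_singleLayer hω hA ψ v
  rw [form_cell_eq_add hA hω] at h1
  rw [HasTrace.eq_traceMap hω hg]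
  change (conormal hω hA ψ).1 _ + ψ.1 _ = _
  rw [conormal_apply]
  linarith

/-- The Neumann–Poincaré operator. -/
def neumannPoincare (hω : IsInclusion ω) (hA : IsCoefficient A μ) :
    HMinusHalfZero ω m →ₗ[ℝ] HMinusHalfZero ω m :=
  conormal hω hA + (1 / 2 : ℝ) • LinearMap.id

theorem neumannPoincare_apply (hω : IsInclusion ω) (hA : IsCoefficient A μ)
    (ψ : HMinusHalfZero ω m) :
    neumannPoincare hω hA ψ = conormal hω hA ψ + (1 / 2 : ℝ) • ψ := rfl

/-- In the energy product K is represented by half the difference of the exterior and interior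
energies. Both the symmetry and the strict bounds on K are read off from this identity. -/
theorem form_singleLayer_neumannPoincare (hω : IsInclusion ω) (hA : IsCoefficient A μ)
    (ψ : HMinusHalfZero ω m) (v : H1 d m) :
    form A (cell d) (singleLayer hω hA (neumannPoincare hω hA ψ)) v
      = 1 / 2 * form A (cell d) (singleLayer hω hA ψ) v - form A ω (singleLayer hω hA ψ) v := by
  rw [form_singleLayer, form_singleLayer, ← conormal_apply hω hA ψ v]
  change -((conormal hω hA ψ).1 _ + (1 / 2 : ℝ) • ψ.1 _) = _
  rw [smul_eq_mul]
  ring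

theorem form_self_nonneg (hA : IsCoefficient A μ) (u : H1 d m) : 0 ≤ form A (cell d) u u :=
  le_trans (mul_nonneg hA.pos.le (sq_nonneg _)) (hA.le_form_self subset_rfl u)

/-- The quadratic form of the Neumann–Poincaré operator lies strictly between `-1/2` and `1/2`. -/
theorem exists_neumannPoincare_bound (hω : IsInclusion ω) (hA : IsCoefficient A μ) :
    ∃ κ : ℝ, 0 < κ ∧ ∀ ψ : HMinusHalfZero ω m,
      form A (cell d) (singleLayer hω hA (neumannPoincare hω hA ψ)) (singleLayer hω hA ψ)
        ≤ (1 / 2 - κ) * form A (cell d) (singleLayer hω hA ψ) (singleLayer hω hA ψ) ∧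
      -((1 / 2 - κ) * form A (cell d) (singleLayer hω hA ψ) (singleLayer hω hA ψ))
        ≤ form A (cell d) (singleLayer hω hA (neumannPoincare hω hA ψ)) (singleLayer hω hA ψ) := by
  obtain ⟨κ₁, hκ₁, h₁⟩ := exists_le_form_of_bound (m := m) hA hω.subset_cell
    (hω.exists_functional_bound_inner m)
  obtain ⟨κ₂, hκ₂, h₂⟩ := exists_le_form_of_bound (m := m) hA sdiff_subset
    (hω.exists_functional_bound_outer m)
  refine ⟨min κ₁ κ₂, lt_min hκ₁ hκ₂, fun ψ => ?_⟩
  have e := form_singleLayer_neumannPoincare hω hA ψ (singleLayer hω hA ψ)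
  have htr : ∀ v : H1 d m, HasTrace ω v (0 : L2Bdry ω m) →
      form A (cell d) (singleLayer hω hA ψ) v = 0 :=
    fun v hv => form_singleLayer_of_hasTrace_zero hω hA ψ hv
  have b1 := h₁ _ htr
  have b2 := h₂ _ htr
  have b3 := form_cell_eq_add hA hω (singleLayer hω hA ψ) (singleLayer hω hA ψ)
  have hpos := form_self_nonneg hA (singleLayer hω hA ψ)
  have c1 := mul_le_mul_of_nonneg_right (min_le_left κ₁ κ₂) hpos
  have c2 := mul_le_mul_of_nonneg_right (min_le_right κ₁ κ₂) hpos
  -- The quadratic form of K is half the total energy minus the interior one, equivalently the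
  -- exterior one minus half the total. The lower bound on the interior energy gives the upper
  -- estimate, that on the exterior energy the lower estimate.
  rw [e]
  constructor <;> linarith

theorem neumannPoincare_symm (hω : IsInclusion ω) (hA : IsCoefficient A μ)
    (φ ψ : HMinusHalfZero ω m) :
    form A (cell d) (singleLayer hω hA (neumannPoincare hω hA φ)) (singleLayer hω hA ψ)
      = form A (cell d) (singleLayer hω hA φ) (singleLayer hω hA (neumannPoincare hω hA ψ)) := by
  rw [form_symm hA _ (singleLayer hω hA φ), form_singleLayer_neumannPoincare,
    form_singleLayer_neumannPoincare, form_symm hA _ (singleLayer hω hA ψ),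
    form_symm hA ω (singleLayer hω hA ψ)]

theorem exists_energy_core (hω : IsInclusion ω) (hA : IsCoefficient A μ) :
    ∃ ip : InnerProductSpace.Core ℝ (HMinusHalfZero ω m),
      (∀ φ ψ, ip.inner φ ψ = form A (cell d) (singleLayer hω hA φ) (singleLayer hω hA ψ)) ∧
      letI : NormedAddCommGroup (HMinusHalfZero ω m) := ip.toNormedAddCommGroup
      letI : InnerProductSpace ℝ (HMinusHalfZero ω m) := InnerProductSpace.ofCore ip.toCore
      ∃ _ : CompleteSpace (HMinusHalfZero ω m),
        ∃ K : HMinusHalfZero ω m →L[ℝ] HMinusHalfZero ω m,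
          (∀ ψ, K ψ = neumannPoincare hω hA ψ) ∧ IsSelfAdjoint K ∧
            spectrum ℝ K ⊆ Ioo (-(1 / 2) : ℝ) (1 / 2) := by
  obtain ⟨α, hα, hco⟩ := exists_coercive (m := m) hA
  obtain ⟨κ, hκ, hb⟩ := exists_neumannPoincare_bound (m := m) hω hA
  exact exists_core_of_energy (singleLayer hω hA) (fun ψ => singleLayer hω hA ψ) (fun _ => rfl)
    (singleLayer_injective hω hA) (isClosed_range_singleLayer hω hA)
    (formCLM hA (subset_refl (cell d))) (form A (cell d)) (formCLM_apply hA (subset_refl (cell d)))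
    (form_symm hA (cell d)) hα (fun ψ => hco _ (isSingleLayer_singleLayer hω hA ψ).1)
    (neumannPoincare hω hA) (fun ψ => neumannPoincare hω hA ψ) (fun _ => rfl)
    (neumannPoincare_symm hω hA) hκ (fun ψ => (hb ψ).1) (fun ψ => (hb ψ).2)

end NeumannPoincare

end PeriodicLayer

end


theorem propositionA1 {d m : ℕ} (hd : 2 ≤ d) (hm : 1 ≤ m)
    (A : EuclideanSpace ℝ (Fin d) → Fin d → Fin d → Fin m → Fin m → ℝ) (μ : ℝ)
    (hA : IsCoefficient A μ)
    (ω : Set (EuclideanSpace ℝ (Fin d))) (hω : IsInclusion ω) :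
    -- every `H^1` function has exactly one trace on the boundary of `ω`
    (∀ v : H1 d m, ∃! g : L2Bdry ω m, HasTrace ω v g) ∧
    -- the single-layer potential is a well-defined linear map `S`
    ∃ S : HMinusHalfZero ω m →ₗ[ℝ] H1 d m,
      (∀ (ψ : HMinusHalfZero ω m) (u : H1 d m), IsSingleLayer A ψ.1 u ↔ u = S ψ) ∧
      -- the energy is an inner product
      ∃ ip : InnerProductSpace.Core ℝ (HMinusHalfZero ω m),
        (∀ φ ψ : HMinusHalfZero ω m, ip.inner φ ψ = form A (cell d) (S φ) (S ψ)) ∧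
        letI : NormedAddCommGroup (HMinusHalfZero ω m) := ip.toNormedAddCommGroup
        letI : InnerProductSpace ℝ (HMinusHalfZero ω m) := InnerProductSpace.ofCore ip.toCore
        -- `H` is a Hilbert space
        ∃ _ : CompleteSpace (HMinusHalfZero ω m),
          -- the operator `K` is well defined, self-adjoint, and its spectrum is as claimed
          ∃ K : HMinusHalfZero ω m →L[ℝ] HMinusHalfZero ω m,
            (∀ ψ : HMinusHalfZero ω m,
              IsConormalExt A (S ψ) ((K ψ + (1 / 2 : ℝ) • ψ : HMinusHalfZero ω m)).1 ∧
              IsConormalInt A (S ψ) ((K ψ - (1 / 2 : ℝ) • ψ : HMinusHalfZero ω m)).1) ∧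
            IsSelfAdjoint K ∧
            spectrum ℝ K ⊆ Ioo (-(1 / 2) : ℝ) (1 / 2) := by
  refine ⟨hω.existsUnique_hasTrace, singleLayer hω hA, isSingleLayer_iff_eq hω hA, ?_⟩
  obtain ⟨ip, hip, hcomp, K, hK, hsa, hspec⟩ := exists_energy_core (m := m) hω hA
  refine ⟨ip, hip, hcomp, K, fun ψ => ⟨?_, ?_⟩, hsa, hspec⟩
  · rw [hK, neumannPoincare_apply, add_assoc, ← add_smul, add_halves, one_smul]
    exact isConormalExt_conormal_add hω hA ψ
  · rw [hK, neumannPoincare_apply]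
    convert isConormalInt_conormal hω hA ψ
    exact add_sub_cancel_right (conormal hω hA ψ) _
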